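/- **Setting.** Graphs are finite, simple and undirected. A *matching multicut of $G$ on $t$ parts* is given by a partition of $V(G)$ into $t$ nonempty sets such that every vertex has at most one neighbour outside its part; it is identified with the set $M\subseteq E(G)$ of edges joining different parts. Thus $M\subseteq E(G)$ is a matching multicut on at least $\ell$ parts if it is the set of edges between the parts of some such partition with at least $\ell$ parts. *Enum Matching Multicut*: given a graph $G$ and an integer $\ell$, list all matching multicuts $M\subseteq E(G)$ of $G$ on at least $\ell$ parts. The parameter is the vertex cover number $\tau(G)$. A *polynomial-delay enumeration kernel* for an enumeration problem with instances $x$, solution sets $\mathrm{Sol}(x)$ and parameter $\kappa(x)$ is a pair of algorithms $\mathcal A,\mathcal A'$ such that: (i) given $(x,k)$ with $k=\kappa(x)$, $\mathcal A$ outputs, in time polynomial in $|x|+k$, a pair $(x',k')$ with $x'$ an instance, $k'=\kappa(x')$ and $|x'|,k'\le g(k)$ for a computable function $g$; (ii) given $(x,k)$, $(x',k')$ and $s\in\mathrm{Sol}(x')$, $\mathcal A'$ lists without repetition, with delay polynomial in $|x|+|x'|+k+k'$ (including the time before the first and after the last output), a nonempty set $S_s$, and the sets $S_s$, $s\in \mathrm{Sol}(x')$,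 are pairwise disjoint with union $\mathrm{Sol}(x)$. **Theorem.** (1) Enum Matching Multicut parameterized by the vertex cover number $k$ admits a polynomial-delay enumeration kernel with $O(k^2)$ vertices, i.e. there is a constant $C$ such that the compressed instance $(H,\ell')$ always satisfies $|V(H)|\le C\,k^2$. (2) Let $G$ be a finite graph without isolated vertices, let $X$ be a vertex cover of $G$, and let $I_1$ and $I_{\ge2}$ be the sets of vertices outside $X$ of degree $1$ and of degree at least $2$. Let $Z$ be any set obtained by marking, for every $x\in X$, one vertex of $N(x)\cap I_1$ (if there is one) and, for every two distinct $x,y\in X$, any $\min\{3,|N(x)\cap N(y)\cap I_{\ge2}|\}$ vertices of $N(x)\cap N(y)\cap I_{\ge 2}$. Put $H=G[X\cup Z]$. Then $|V(H)|\le 2|X|+3\binom{|X|}{2}$. Moreover, for $x\in X$ let $L_x=\{xy\in E(G): y\in I_1\}$, let $L=\bigcup_{x\in X}L_x$, and call two edge sets $M_1,M_2$ equivalent if $M_1\setminus L=M_2\setminus L$ and $|M_1\cap L_x|=|M_2\cap L_x|$ for all $x\in X$. Then for every integer $\ell$, a set $M\subseteq E(G)$ is a matching multicut of $G$ on at least $\ell$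 parts if and only if $H$ has a matching multicut on at least $\ell$ parts that is equivalent to $M$. -/

import Mathlib

/-! ## Random access machine programs with a step count

The machine model: structured programs over finitely many registers and arrays of natural numbers,
with constants, addition and truncated subtraction as the only arithmetic, at unit cost.  (There is
no multiplication, so the bit length of a stored number grows by `O(1)` per step and the model is
polynomially equivalent to Turing machines.) -/

namespace RAM

/-- Expressions: constants, registers, array cells (with computed index), sum, truncated
difference. -/
inductive Expr : Type where
  | const (n : ℕ)
  | var (i : ℕ)
  | get (a : ℕ) (idx : Expr)
  | add (e₁ e₂ : Expr)
  | sub (e₁ e₂ : Expr)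

/-- Programs.  `write e` appends the number `e` to the output, and `yield` declares the current
output item to be complete. -/
inductive Cmd : Type where
  | assign (i : ℕ) (e : Expr)
  | store (a : ℕ) (idx e : Expr)
  | write (e : Expr)
  | yield
  | seq (c₁ c₂ : Cmd)
  | ite (e : Expr) (c₁ c₂ : Cmd)
  | while (e : Expr) (c : Cmd)

/-- Memory: registers and arrays. -/
structure Store where
  var : ℕ → ℕ
  arr : ℕ → ℕ → ℕ

/-- Value of an expression. -/
def Expr.eval (σ : Store) : Expr → ℕ
  | const n => n
  | var i => σ.var i
  | get a idx => σ.arr a (idx.eval σ)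
  | add e₁ e₂ => e₁.eval σ + e₂.eval σ
  | sub e₁ e₂ => e₁.eval σ - e₂.eval σ

/-- Number of steps taken to evaluate an expression. -/
def Expr.cost : Expr → ℕ
  | const _ => 1
  | var _ => 1
  | get _ idx => idx.cost + 1
  | add e₁ e₂ => e₁.cost + e₂.cost + 1
  | sub e₁ e₂ => e₁.cost + e₂.cost + 1

/-- What happens in one step of a run: an internal operation, a number written to the output, or
the completion of an output item. -/
inductive Event : Type where
  | tick
  | write (n : ℕ)
  | yield
  deriving DecidableEq

/-- The internal steps spent on evaluating `e`. -/
def Expr.ticks (e : Expr) : List Event := List.replicate e.cost Event.tick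

/-- `Exec c σ τ σ'`: the program `c`, started in memory `σ`, halts in memory `σ'`, and `τ` is the
list of its steps. In `ite e c₁ c₂` and `while e c` a nonzero value of `e` means "true". -/
inductive Exec : Cmd → Store → List Event → Store → Prop where
  | assign (i : ℕ) (e : Expr) (σ : Store) :
      Exec (Cmd.assign i e) σ (e.ticks ++ [Event.tick])
        ⟨Function.update σ.var i (e.eval σ), σ.arr⟩
  | store (a : ℕ) (idx e : Expr) (σ : Store) :
      Exec (Cmd.store a idx e) σ (idx.ticks ++ e.ticks ++ [Event.tick])
        ⟨σ.var, Function.update σ.arr a (Function.update (σ.arr a) (idx.eval σ) (e.eval σ))⟩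
  | write (e : Expr) (σ : Store) :
      Exec (Cmd.write e) σ (e.ticks ++ [Event.write (e.eval σ)]) σ
  | yield (σ : Store) : Exec Cmd.yield σ [Event.yield] σ
  | seq {c₁ c₂ : Cmd} {σ₁ σ₂ σ₃ : Store} {τ₁ τ₂ : List Event} :
      Exec c₁ σ₁ τ₁ σ₂ → Exec c₂ σ₂ τ₂ σ₃ → Exec (Cmd.seq c₁ c₂) σ₁ (τ₁ ++ τ₂) σ₃
  | ite_true {e : Expr} {c₁ c₂ : Cmd} {σ σ' : Store} {τ : List Event} :
      e.eval σ ≠ 0 → Exec c₁ σ τ σ' → Exec (Cmd.ite e c₁ c₂) σ (e.ticks ++ [Event.tick] ++ τ) σ'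
  | ite_false {e : Expr} {c₁ c₂ : Cmd} {σ σ' : Store} {τ : List Event} :
      e.eval σ = 0 → Exec c₂ σ τ σ' → Exec (Cmd.ite e c₁ c₂) σ (e.ticks ++ [Event.tick] ++ τ) σ'
  | while_true {e : Expr} {c : Cmd} {σ₁ σ₂ σ₃ : Store} {τ₁ τ₂ : List Event} :
      e.eval σ₁ ≠ 0 → Exec c σ₁ τ₁ σ₂ → Exec (Cmd.while e c) σ₂ τ₂ σ₃ →
      Exec (Cmd.while e c) σ₁ (e.ticks ++ [Event.tick] ++ τ₁ ++ τ₂) σ₃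
  | while_false {e : Expr} {c : Cmd} {σ : Store} :
      e.eval σ = 0 → Exec (Cmd.while e c) σ (e.ticks ++ [Event.tick]) σ

/-- Initial memory on the inputs `args`: array `i` holds the `i`-th input, register `i` its
length; everything else is zero. -/
def initStore (args : List (List ℕ)) : Store where
  var i := (args.getD i []).length
  arr i j := (args.getD i []).getD j 0

/-- The numbers written during a run, in order. -/
def written (τ : List Event) : List ℕ :=
  τ.filterMap fun ev => match ev with
    | Event.write n => some n
    | _ => none

/-- On the inputs `args` the program halts within `t` steps and its output is `out`. -/
def Computes (c : Cmd) (args : List (List ℕ)) (out : List ℕ) (t : ℕ) : Prop :=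
  ∃ τ σ', Exec c (initStore args) τ σ' ∧ written τ = out ∧ τ.length ≤ t

/-- On the inputs `args` the program halts, having output exactly the items `items`, one after the
other, with delay at most `d`: at most `d` steps precede the completion of the first item, at most
`d` steps lie between the completions of two consecutive items, and at most `d` steps follow the
completion of the last item (the whole run has at most `d` steps if there is no item). -/
def EnumeratesWithDelay (c : Cmd) (args : List (List ℕ)) (items : List (List ℕ)) (d : ℕ) : Prop :=
  ∃ (blocks : List (List Event)) (last : List Event) (σ' : Store),
    Exec c (initStore args) ((blocks.map fun b => b ++ [Event.yield]).flatten ++ last) σ' ∧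
    (∀ b ∈ blocks, Event.yield ∉ b ∧ b.length ≤ d) ∧
    Event.yield ∉ last ∧ last.length ≤ d ∧ written last = [] ∧
    blocks.map written = items

end RAM

/-! ## Parameterized enumeration problems and polynomial-delay enumeration kernels -/

/-- Length, up to a factor of two, of a binary encoding of a list of natural numbers. -/
def bitSize (w : List ℕ) : ℕ := (w.map fun a => a.size + 1).sum

/-- A parameterized enumeration problem. Instances are encoded by words (lists of natural numbers,
measured by `bitSize`), `Sol x` is the set of all solutions, again as words, and `param` is the
parameterization. -/
structure ParamEnumProblem where
  Inst : Type
  encode : Inst → List ℕ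
  encode_injective : Function.Injective encode
  Sol : Inst → Set (List ℕ)
  param : Inst → ℕ

/-- The size `|x|` of an instance. -/
def ParamEnumProblem.size (Q : ParamEnumProblem) (x : Q.Inst) : ℕ := bitSize (Q.encode x)

/-- The programs `A` (compressor) and `A'` (lifting algorithm) form a polynomial-delay enumeration
kernel for `Q`, where `comp x` denotes the instance computed by `A` on the instance `x`. -/
structure IsPDEKernel (Q : ParamEnumProblem) (A A' : RAM.Cmd) (comp : Q.Inst → Q.Inst) : Prop where
  /-- Given `(x, k)` with `k` the parameter of `x`, the compressor outputs `(x', k')` with `k'` the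
  parameter of `x'`, in time polynomial in `|x| + k`. -/
  compress : ∃ p : Polynomial ℕ, ∀ x : Q.Inst,
    RAM.Computes A [Q.encode x, [Q.param x]]
      (Q.param (comp x) :: Q.encode (comp x)) (p.eval (Q.size x + Q.param x))
  /-- The size and the parameter of `x'` are bounded by a computable function of `k`. -/
  bounded : ∃ g : ℕ → ℕ, Computable g ∧ ∀ x : Q.Inst,
    Q.size (comp x) ≤ g (Q.param x) ∧ Q.param (comp x) ≤ g (Q.param x)
  /-- Given `(x, k)`, `(x', k')` and a solution `s` of `x'`, the lifting algorithm lists a set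
  `S x s`, without repetitions and with delay polynomial in `|x| + |x'| + k + k'`; these sets, for
  `s` ranging over the solutions of `x'`, form a partition of the solutions of `x`. -/
  lift : ∃ S : Q.Inst → List ℕ → Set (List ℕ),
    (∃ p : Polynomial ℕ, ∀ x : Q.Inst, ∀ s ∈ Q.Sol (comp x), ∃ items : List (List ℕ),
      RAM.EnumeratesWithDelay A'
        [Q.encode x, [Q.param x], Q.encode (comp x), [Q.param (comp x)], s] items
        (p.eval (Q.size x + Q.size (comp x) + Q.param x + Q.param (comp x))) ∧
      items.Nodup ∧ {w | w ∈ items} = S x s) ∧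
    ∀ x : Q.Inst,
      (∀ s ∈ Q.Sol (comp x), (S x s).Nonempty) ∧
      (∀ s ∈ Q.Sol (comp x), ∀ s' ∈ Q.Sol (comp x), s ≠ s' → Disjoint (S x s) (S x s')) ∧
      (⋃ s ∈ Q.Sol (comp x), S x s) = Q.Sol x

/-! ## Matching multicuts -/

section Multicut

variable {V : Type*}

/-- `P` is a partition of the vertex set such that every vertex has at most one neighbour outside
its part. -/
def IsMatchingMulticutPartition (G : SimpleGraph V) (P : Set (Set V)) : Prop :=
  Setoid.IsPartition P ∧ ∀ A ∈ P, ∀ v ∈ A, (G.neighborSet v \ A).encard ≤ 1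

/-- The edges of `G` that lie in no part of `P`, that is, that join different parts. -/
def cutEdges (G : SimpleGraph V) (P : Set (Set V)) : Set (Sym2 V) :=
  {e | e ∈ G.edgeSet ∧ ∀ A ∈ P, ¬ ∀ v ∈ e, v ∈ A}

/-- The matching multicuts of `G` on at least `l` parts, as sets of edges. -/
def matchingMulticuts (G : SimpleGraph V) (l : ℤ) : Set (Set (Sym2 V)) :=
  {M | ∃ P : Set (Set V), IsMatchingMulticutPartition G P ∧ l ≤ (P.ncard : ℤ) ∧ M = cutEdges G P}

end Multicut

/-! ## The problem Enum Matching Multicut, parameterized by the vertex cover number -/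

/-- An instance: a finite graph (on the vertices `0, …, order - 1`) and an integer. -/
structure MulticutInstance where
  order : ℕ
  graph : SimpleGraph (Fin order)
  parts : ℤ

/-- The `n × n` symmetric 0/1-matrix, row by row, of a set of edges: the entry in position
`i * n + j` tells whether `s(i, j)` is in the set. -/
noncomputable def encodeEdges {n : ℕ} (M : Set (Sym2 (Fin n))) : List ℕ :=
  open Classical in
  List.ofFn fun t : Fin (n * n) => if s(t.divNat, t.modNat) ∈ M then 1 else 0

theorem encodeEdges_injective {n : ℕ} :
    Function.Injective (encodeEdges : Set (Sym2 (Fin n)) → List ℕ) := by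
  intro M N h
  have h2 := List.ofFn_injective h
  ext e
  induction e using Sym2.ind with
  | _ i j =>
    have h3 := congrFun h2 (finProdFinEquiv (i, j))
    have h4 : ((finProdFinEquiv (i, j)).divNat, (finProdFinEquiv (i, j)).modNat) = (i, j) :=
      finProdFinEquiv.symm_apply_apply (i, j)
    rw [Prod.mk.injEq] at h4
    rw [h4.1, h4.2] at h3
    by_cases h5 : s(i, j) ∈ M <;> by_cases h6 : s(i, j) ∈ N <;> simp_all

/-- An instance as a word: the order, the integer (positive part and negative part), and the
adjacency matrix. -/
noncomputable def MulticutInstance.encode (x : MulticutInstance) : List ℕ :=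
  x.order :: x.parts.toNat :: (-x.parts).toNat :: encodeEdges x.graph.edgeSet

theorem MulticutInstance.encode_injective : Function.Injective MulticutInstance.encode := by
  rintro ⟨n, G, l⟩ ⟨n', G', l'⟩ h
  simp only [MulticutInstance.encode, List.cons.injEq] at h
  obtain ⟨h1, h2, h3, h4⟩ := h
  subst h1
  have h5 : l = l' := by omega
  have h6 : G = G' := SimpleGraph.edgeSet_injective (encodeEdges_injective h4)
  rw [h5, h6]

/-- Enum Matching Multicut, parameterized by the vertex cover number. -/
noncomputable def EnumMatchingMulticut : ParamEnumProblem where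
  Inst := MulticutInstance
  encode := MulticutInstance.encode
  encode_injective := MulticutInstance.encode_injective
  Sol x := encodeEdges '' matchingMulticuts x.graph x.parts
  param x := x.graph.vertexCoverNum.toNat

/-! ## The marking procedure -/

section Marking

variable {V : Type*}

/-- The neighbours of `x` outside `X` that have degree one. -/
def pendantNbrs (G : SimpleGraph V) (X : Set V) (x : V) : Set V :=
  {v | v ∉ X ∧ G.Adj x v ∧ (G.neighborSet v).encard = 1}

/-- The common neighbours of `x` and `y` outside `X` that have degree at least two. -/
def commonNbrs (G : SimpleGraph V) (X : Set V) (x y : V) : Set V :=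
  {v | v ∉ X ∧ G.Adj x v ∧ G.Adj y v ∧ 2 ≤ (G.neighborSet v).encard}

/-- `Z` is a possible set of marked vertices: for every `x ∈ X` one pendant neighbour of `x` is
marked (if it exists), and for every two distinct vertices `x, y ∈ X` three vertices of
`commonNbrs G X x y` are marked (all of them, if there are fewer than three). -/
def IsMarking (G : SimpleGraph V) (X Z : Set V) : Prop :=
  ∃ (m₁ : V → Set V) (m₂ : Sym2 V → Set V),
    (∀ x ∈ X, m₁ x ⊆ pendantNbrs G X x ∧ (m₁ x).encard = min 1 (pendantNbrs G X x).encard) ∧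
    (∀ x ∈ X, ∀ y ∈ X, x ≠ y → m₂ s(x, y) ⊆ commonNbrs G X x y ∧
      (m₂ s(x, y)).encard = min 3 (commonNbrs G X x y).encard) ∧
    Z = {v | (∃ x ∈ X, v ∈ m₁ x) ∨ ∃ x ∈ X, ∃ y ∈ X, x ≠ y ∧ v ∈ m₂ s(x, y)}

/-- The pendant edges at `x` whose other end lies outside `X` and has degree one. -/
def pendantEdges (G : SimpleGraph V) (X : Set V) (x : V) : Set (Sym2 V) :=
  {e | ∃ y ∈ pendantNbrs G X x, e = s(x, y)}

/-- Two sets of edges are equivalent if they agree outside the pendant edges at vertices of `X`,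
and contain, for every `x ∈ X`, equally many of the pendant edges at `x`. -/
def PendantEquiv (G : SimpleGraph V) (X : Set V) (M₁ M₂ : Set (Sym2 V)) : Prop :=
  M₁ \ (⋃ x ∈ X, pendantEdges G X x) = M₂ \ (⋃ x ∈ X, pendantEdges G X x) ∧
  ∀ x ∈ X, (M₁ ∩ pendantEdges G X x).encard = (M₂ ∩ pendantEdges G X x).encard

end Marking

/-! A matching multicut is the set of bichromatic edges of a colouring in which every vertex has at
most one neighbour of another colour, and the number of parts is the number of colours used. Three
facts drive the proof. If `x` and `y` have three common neighbours, they share a colour, for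
otherwise each of the three differs from `x` or from `y`, and each of these two tolerates one
exception only (`IsMulticutColoring.eq_of_three_le_encard`). Hence a vertex with at least two
neighbours, any two of which have three common neighbours, is coloured like its neighbours: deleting
it loses no cut edge and no colour. Next, at most one pendant edge at `x` is cut, and which one is
immaterial, so a single pendant neighbour represents all of them. Finally, an isolated vertex is
always a part by itself, so deleting it lowers the number of parts by exactly one.

`IsMarkedEmbedding` isolates what a set of retained vertices has to satisfy for these facts to
apply. A colouring of `G` restricts to `H` after exchanging the retained pendant vertex for the cut
one, and a colouring of `H` extends to `G`; together this is
`IsMarkedEmbedding.mem_matchingMulticuts_iff`. Part (2) of the theorem is this equivalence for a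
marking, without isolated vertices.

For part (1) the compressor knows the number `k` but no minimum vertex cover. It uses instead the
complement of `lowRest`, which is read off from the degrees. This cover may have order `k ^ 2`
vertices, but the neighbours of `lowRest` all have degree more than `k`, so they lie in every cover
of size at most `k`; marking for pairs of such vertices costs only `O(k ^ 2)`. The first `k + 1`
neighbours (of degree at least two) of each such vertex are retained as well, in order that the
vertex cover number of the kernel is exactly `k` (`vertexCoverNum_comap_keptVertices`) and the
compressor can output its input parameter. The number of parts demanded is clamped to the possible
range, to bound its encoding.

The solutions of `G` equivalent to a solution of the kernel arise by independently choosing, at each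
vertex with a cut pendant edge, which pendant edge is cut. They are therefore enumerated by a mixed
radix counter, one digit for each vertex. Different solutions of the kernel have disjoint lifts
because the kernel has at most one pendant vertex for each centre.

The programs are not verified instruction by instruction. All tables are given by terms of a small
language with bounded sums, which is compiled uniformly with a polynomial time bound
(`RAM.Term.block_compile`); correctness then becomes a matter of evaluating formulas. -/

/-! ## Matching multicuts as colourings -/

section Coloring

variable {V W ι κ : Type*}

/-- A colouring such that every vertex has at most one neighbour of another colour. -/
def IsMulticutColoring (G : SimpleGraph V) (f : V → ι) : Prop :=
  ∀ v w w', G.Adj v w → G.Adj v w' → f w ≠ f v → f w' ≠ f v → w = w'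

/-- The edges joining vertices of different colours. -/
def colorCut (G : SimpleGraph V) (f : V → ι) : Set (Sym2 V) :=
  {e | e ∈ G.edgeSet ∧ ∃ u ∈ e, ∃ v ∈ e, f u ≠ f v}

theorem mk_mem_colorCut {G : SimpleGraph V} {f : V → ι} {u v : V} :
    s(u, v) ∈ colorCut G f ↔ G.Adj u v ∧ f u ≠ f v := by
  simp only [colorCut, Set.mem_ofPred_eq, SimpleGraph.mem_edgeSet, Sym2.mem_iff]
  constructor
  · rintro ⟨h, a, ha, b, hb, hab⟩
    refine ⟨h, ?_⟩
    rcases ha with rfl | rfl <;> rcases hb with rfl | rfl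
    · exact absurd rfl hab
    · exact hab
    · exact hab.symm
    · exact absurd rfl hab
  · rintro ⟨h, h'⟩
    exact ⟨h, u, Or.inl rfl, v, Or.inr rfl, h'⟩

theorem IsMulticutColoring.comp_hom {G : SimpleGraph V} {H : SimpleGraph W} {f : V → ι}
    (hf : IsMulticutColoring G f) {φ : W → V} (hφ : Function.Injective φ)
    (hadj : ∀ a b, H.Adj a b → G.Adj (φ a) (φ b)) : IsMulticutColoring H (f ∘ φ) :=
  fun _ _ _ h h' hn hn' => hφ (hf _ _ _ (hadj _ _ h) (hadj _ _ h') hn hn')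

/-- The parts are the colour classes, so they are as many as the colours in the range. -/
theorem colorCut_mem_matchingMulticuts [Finite V] {G : SimpleGraph V} {f : V → ι}
    (hf : IsMulticutColoring G f) {l : ℤ} (hl : l ≤ ((Set.range f).ncard : ℤ)) :
    colorCut G f ∈ matchingMulticuts G l := by
  refine ⟨(Setoid.ker f).classes, ⟨Setoid.isPartition_classes _, ?_⟩, ?_, ?_⟩
  · rintro A ⟨y, rfl⟩ v hv
    rw [Set.encard_le_one_iff]
    rintro w w' ⟨hw, hwy⟩ ⟨hw', hwy'⟩
    simp only [Set.mem_ofPred_eq, Setoid.ker_def] at hv hwy hwy'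
    exact hf v w w' hw hw' (by rwa [hv]) (by rwa [hv])
  · have h : (Setoid.ker f).classes = (fun c => f ⁻¹' {c}) '' Set.range f := by
      ext A
      simp only [Setoid.classes, Set.mem_ofPred_eq, Set.mem_image, Set.exists_range_iff]
      constructor
      · rintro ⟨y, rfl⟩
        exact ⟨y, by ext; simp [Setoid.ker_def]⟩
      · rintro ⟨y, rfl⟩
        exact ⟨y, by ext; simp [Setoid.ker_def]⟩
    rw [h, Set.InjOn.ncard_image]
    · exact hl
    · rintro _ ⟨a, rfl⟩ _ ⟨b, rfl⟩ hab
      have : a ∈ f ⁻¹' {f b} := by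
        rw [← show f ⁻¹' {f a} = f ⁻¹' {f b} from hab]; simp
      simpa using this
  · ext e
    induction e using Sym2.ind with
    | _ u v =>
      rw [mk_mem_colorCut]
      simp only [cutEdges, Set.mem_ofPred_eq, SimpleGraph.mem_edgeSet, Sym2.mem_iff, forall_eq_or_imp,
        forall_eq]
      refine and_congr_right fun _ => ?_
      constructor
      · rintro h A ⟨y, rfl⟩ ⟨h1, h2⟩
        simp only [Set.mem_ofPred_eq, Setoid.ker_def] at h1 h2
        exact h (h1.trans h2.symm)
      · intro h huv
        exact h _ ⟨v, rfl⟩ ⟨huv, rfl⟩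

/-- Each vertex is coloured by a chosen representative of its part, which makes the vertex set
itself the set of colours. -/
theorem exists_coloring_of_mem_matchingMulticuts [Finite V] {G : SimpleGraph V} {l : ℤ}
    {M : Set (Sym2 V)} (hM : M ∈ matchingMulticuts G l) :
    ∃ f : V → V, IsMulticutColoring G f ∧ l ≤ ((Set.range f).ncard : ℤ) ∧ M = colorCut G f := by
  obtain ⟨P, ⟨hP, hcut⟩, hl, rfl⟩ := hM
  choose p hp hp' using fun v => hP.2 v
  have hpP : ∀ v, p v ∈ P := fun v => (hp v).1
  have hpv : ∀ v, v ∈ p v := fun v => (hp v).2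
  have hpu : ∀ v, ∀ A ∈ P, v ∈ A → A = p v := fun v A hA hv => hp' v A ⟨hA, hv⟩
  have hne : ∀ A : P, ∃ v, v ∈ A.1 := fun A => Setoid.nonempty_of_mem_partition hP A.2
  choose r hr using hne
  let f : V → V := fun v => r ⟨p v, hpP v⟩
  have hff : ∀ u v, f u = f v ↔ p u = p v := by
    intro u v
    constructor
    · intro h
      rw [hpu (f u) (p u) (hpP u) (hr ⟨p u, hpP u⟩), hpu (f v) (p v) (hpP v) (hr ⟨p v, hpP v⟩), h]
    · intro h
      simp only [f, h]
  refine ⟨f, ?_, hl.trans ?_, ?_⟩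
  · intro v w w' h h' hn hn'
    have := Set.encard_le_one_iff.1 (hcut (p v) (hpP v) v (hpv v)) w w'
    refine this ⟨h, fun hw => hn ?_⟩ ⟨h', fun hw => hn' ?_⟩
    · exact (hff _ _).2 (hpu w _ (hpP v) hw).symm
    · exact (hff _ _).2 (hpu w' _ (hpP v) hw).symm
  · have : P ⊆ p '' Set.range f := by
      intro A hA
      refine ⟨f (r ⟨A, hA⟩), ⟨_, rfl⟩, ?_⟩
      have h1 : p (r ⟨A, hA⟩) = A := (hpu _ A hA (hr ⟨A, hA⟩)).symm
      have h2 : f (r ⟨A, hA⟩) = r ⟨A, hA⟩ := by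
        simp only [f]; congr 1; exact Subtype.ext h1
      rw [h2, h1]
    exact_mod_cast (Set.ncard_le_ncard this (Set.toFinite _)).trans (Set.ncard_image_le (Set.toFinite _))
  · ext e
    induction e using Sym2.ind with
    | _ u v =>
      rw [mk_mem_colorCut]
      simp only [cutEdges, Set.mem_ofPred_eq, SimpleGraph.mem_edgeSet, Sym2.mem_iff, forall_eq_or_imp,
        forall_eq]
      refine and_congr_right fun _ => ?_
      rw [Ne, hff]
      constructor
      · intro h huv
        exact h (p u) (hpP u) ⟨hpv u, huv ▸ hpv v⟩
      · rintro h A hA ⟨hu, hv⟩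
        exact h ((hpu u A hA hu).symm.trans (hpu v A hA hv))

/-- If the colours of `x` and `y` differed, every vertex of `S` would differ from one of them; each
of the two has at most one neighbour of another colour, whence `3 ≤ 1 + 1`. -/
theorem IsMulticutColoring.eq_of_three_le_encard {G : SimpleGraph V} {f : V → ι}
    (hf : IsMulticutColoring G f) {x y : V} {S : Set V} (hS : 3 ≤ S.encard)
    (hx : ∀ w ∈ S, G.Adj x w) (hy : ∀ w ∈ S, G.Adj y w) : f x = f y := by
  by_contra hne
  have hsub : S ⊆ {w | w ∈ S ∧ f w ≠ f x} ∪ {w | w ∈ S ∧ f w ≠ f y} := by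
    intro w hw
    by_cases h : f w = f x
    · exact Or.inr ⟨hw, by rwa [h]⟩
    · exact Or.inl ⟨hw, h⟩
  have h1 : {w | w ∈ S ∧ f w ≠ f x}.encard ≤ 1 :=
    Set.encard_le_one_iff.2 fun w w' h h' => hf x w w' (hx _ h.1) (hx _ h'.1) h.2 h'.2
  have h2 : {w | w ∈ S ∧ f w ≠ f y}.encard ≤ 1 :=
    Set.encard_le_one_iff.2 fun w w' h h' => hf y w w' (hy _ h.1) (hy _ h'.1) h.2 h'.2
  have h3 := hS.trans ((Set.encard_le_encard hsub).trans
    ((Set.encard_union_le _ _).trans (add_le_add h1 h2)))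
  exact absurd h3 (by decide)

/-- A cut contains at most one pendant edge at each centre, so comparing the counts in
`PendantEquiv` amounts to comparing nonemptiness. -/
theorem encard_eq_of_subsingleton_of_nonempty_iff {A : Set ι} {B : Set κ} (hA : A.Subsingleton)
    (hB : B.Subsingleton) (h : A.Nonempty ↔ B.Nonempty) : A.encard = B.encard := by
  rcases hA.eq_empty_or_singleton with rfl | ⟨a, rfl⟩ <;>
    rcases hB.eq_empty_or_singleton with rfl | ⟨b, rfl⟩ <;> simp_all

end Coloring

/-! ## Pendant vertices -/

section Pendant

variable {V W : Type*} {G : SimpleGraph V} {X : Set V} {x x' y y' : V}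

theorem eq_of_adj_of_mem_pendantNbrs (hy : y ∈ pendantNbrs G X x) (h : G.Adj y x') : x' = x := by
  obtain ⟨a, ha⟩ := Set.encard_eq_one.1 hy.2.2
  have h1 : x ∈ G.neighborSet y := hy.2.1.symm
  have h2 : x' ∈ G.neighborSet y := h
  rw [ha] at h1 h2
  exact h2.trans h1.symm

theorem eq_of_mem_pendantNbrs (hy : y ∈ pendantNbrs G X x) (h : y ∈ pendantNbrs G X x') : x' = x :=
  eq_of_adj_of_mem_pendantNbrs hy h.2.1.symm

theorem mk_mem_pendantEdges_iff (hx : x ∈ X) :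
    s(x', y) ∈ pendantEdges G X x ↔
      (x' = x ∧ y ∈ pendantNbrs G X x) ∨ (y = x ∧ x' ∈ pendantNbrs G X x) := by
  constructor
  · rintro ⟨z, hz, h⟩
    rcases Sym2.eq_iff.1 h with ⟨rfl, rfl⟩ | ⟨rfl, rfl⟩
    · exact Or.inl ⟨rfl, hz⟩
    · exact Or.inr ⟨rfl, hz⟩
  · rintro (⟨rfl, h⟩ | ⟨rfl, h⟩)
    · exact ⟨y, h, rfl⟩
    · exact ⟨x', h, Sym2.eq_swap⟩

theorem mk_mem_iUnion_pendantEdges_iff (hX : G.IsVertexCover X) :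
    s(x, y) ∈ ⋃ x ∈ X, pendantEdges G X x ↔ y ∈ pendantNbrs G X x ∨ x ∈ pendantNbrs G X y := by
  simp only [Set.mem_iUnion, exists_prop]
  constructor
  · rintro ⟨z, hz, h⟩
    rcases (mk_mem_pendantEdges_iff hz).1 h with ⟨rfl, h⟩ | ⟨rfl, h⟩
    · exact Or.inl h
    · exact Or.inr h
  · rintro (h | h)
    · exact ⟨x, (hX h.2.1).resolve_right h.1, y, h, rfl⟩
    · exact ⟨y, (hX h.2.1).resolve_right h.1, x, h, Sym2.eq_swap⟩

theorem mk_mem_image_map_iff {e : W → V} {M : Set (Sym2 W)} {u v : V} :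
    s(u, v) ∈ Sym2.map e '' M ↔ ∃ a b, e a = u ∧ e b = v ∧ s(a, b) ∈ M := by
  constructor
  · rintro ⟨p, hp, h⟩
    induction p using Sym2.ind with
    | _ a b =>
      rw [Sym2.map_mk] at h
      rcases Sym2.eq_iff.1 h with ⟨h1, h2⟩ | ⟨h1, h2⟩
      · exact ⟨a, b, h1, h2, hp⟩
      · exact ⟨b, a, h2, h1, by rwa [Sym2.eq_swap]⟩
  · rintro ⟨a, b, rfl, rfl, h⟩
    exact ⟨_, h, rfl⟩

theorem subsingleton_inter_pendantEdges_iff {M : Set (Sym2 V)} :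
    (M ∩ pendantEdges G X x).Subsingleton ↔
      ∀ y ∈ pendantNbrs G X x, ∀ y' ∈ pendantNbrs G X x, s(x, y) ∈ M → s(x, y') ∈ M → y = y' := by
  constructor
  · intro h y hy y' hy' h1 h2
    have := h ⟨h1, y, hy, rfl⟩ ⟨h2, y', hy', rfl⟩
    exact Sym2.congr_right.1 this
  · rintro h _ ⟨h1, y, hy, rfl⟩ _ ⟨h2, y', hy', rfl⟩
    rw [h y hy y' hy' h1 h2]

theorem nonempty_inter_pendantEdges_iff {M : Set (Sym2 V)} :
    (M ∩ pendantEdges G X x).Nonempty ↔ ∃ y ∈ pendantNbrs G X x, s(x, y) ∈ M :=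
  ⟨fun ⟨_, h, y, hy, hp⟩ => ⟨y, hy, hp ▸ h⟩, fun ⟨y, hy, h⟩ => ⟨_, h, y, hy, rfl⟩⟩

end Pendant

/-! ## Restriction to a marked set of vertices -/

section Restriction

variable {V W : Type*}

/-- The image of `e` contains the vertex cover `X`, and every vertex outside the image is isolated,
or pendant at a vertex of `X` with a pendant neighbour in the image, or of degree at least two and
such that any two of its neighbours have three common neighbours in the image. -/
structure IsMarkedEmbedding (G : SimpleGraph V) (H : SimpleGraph W) (e : W → V) (X : Set V) :
    Prop where
  inj : Function.Injective e
  adj : ∀ a b, H.Adj a b ↔ G.Adj (e a) (e b)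
  cover : G.IsVertexCover X
  subset : X ⊆ Set.range e
  unmarked : ∀ v, v ∉ Set.range e → (∀ w, ¬ G.Adj v w) ∨
    (∃ x, v ∈ pendantNbrs G X x ∧ ∃ b, e b ∈ pendantNbrs G X x) ∨
    ((∃ x y, x ≠ y ∧ G.Adj v x ∧ G.Adj v y) ∧ ∀ x y, G.Adj v x → G.Adj v y → x ≠ y →
      3 ≤ (commonNbrs G X x y ∩ Set.range e).encard)

variable {G : SimpleGraph V} {H : SimpleGraph W} {e : W → V} {X : Set V}

theorem IsMarkedEmbedding.exists_of_adj (h : IsMarkedEmbedding G H e X) {v x : V}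
    (hv : v ∉ Set.range e) (hx : G.Adj v x) : x ∈ X ∧ ∃ a, e a = x := by
  have : x ∈ X := (h.cover hx).resolve_left fun h' => hv (h.subset h')
  exact ⟨this, h.subset this⟩

/-- All neighbours of `v` share one colour by the three common neighbours. If `v` had another
colour, each of its at least two neighbours would be an exception at `v`. -/
theorem IsMulticutColoring.eq_of_heavy {ι : Type*} {f : V → ι}
    (hf : IsMulticutColoring G f) {v : V} (h1 : ∃ x y, x ≠ y ∧ G.Adj v x ∧ G.Adj v y)
    (h2 : ∀ x y, G.Adj v x → G.Adj v y → x ≠ y →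
      3 ≤ (commonNbrs G X x y ∩ Set.range e).encard) {x : V} (hx : G.Adj v x) : f x = f v := by
  by_contra hne
  have : ∃ y, y ≠ x ∧ G.Adj v y := by
    obtain ⟨a, b, hab, ha, hb⟩ := h1
    by_cases hax : a = x
    · exact ⟨b, fun h => hab (hax.trans h.symm), hb⟩
    · exact ⟨a, hax, ha⟩
  obtain ⟨y, hyx, hy⟩ := this
  have hxy : f x = f y := hf.eq_of_three_le_encard (h2 x y hx hy hyx.symm)
    (fun w hw => hw.1.2.1) (fun w hw => hw.1.2.2.1)
  exact hyx (hf v y x hy hx (hxy ▸ hne) hne)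

/-- The colouring is pulled back not along `e` but along a modification `φ`, which sends the
retained pendant vertex at `x` to the deleted pendant vertex whose edge at `x` is cut, if there is
one. Since `φ` is again injective and preserves adjacency, the pullback is a valid colouring, and it
keeps both the number of cut pendant edges and the colour of the exchanged vertex. -/
theorem IsMarkedEmbedding.exists_equiv_of_coloring [Finite V] [Finite W] {ι : Type*}
    (h : IsMarkedEmbedding G H e X) {f : V → ι} (hf : IsMulticutColoring G f) :
    ∃ g : W → ι, IsMulticutColoring H g ∧
      (Set.range f).ncard ≤ (Set.range g).ncard +
        {v | v ∉ Set.range e ∧ ∀ w, ¬ G.Adj v w}.ncard ∧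
      PendantEquiv G X (Sym2.map e '' colorCut H g) (colorCut G f) := by
  classical
  -- `z x` is a retained pendant vertex at `x`, meaningful only if some pendant vertex at `x` was
  -- deleted.
  have hz : ∀ x, ∃ z, (∃ y, y ∉ Set.range e ∧ y ∈ pendantNbrs G X x) →
      z ∈ Set.range e ∧ z ∈ pendantNbrs G X x := by
    intro x
    by_cases hx : ∃ y, y ∉ Set.range e ∧ y ∈ pendantNbrs G X x
    · obtain ⟨y, hy, hyx⟩ := hx
      rcases h.unmarked y hy with h1 | ⟨x', hx', b, hb⟩ | ⟨⟨a, b, hab, ha, hb⟩, -⟩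
      · exact absurd hyx.2.1.symm (h1 _)
      · obtain rfl := eq_of_mem_pendantNbrs hyx hx'
        exact ⟨e b, fun _ => ⟨⟨b, rfl⟩, hb⟩⟩
      · exact absurd ((eq_of_adj_of_mem_pendantNbrs hyx ha).trans
          (eq_of_adj_of_mem_pendantNbrs hyx hb).symm) hab
    · exact ⟨x, fun hx' => absurd hx' hx⟩
  choose z hz using hz
  -- `T u y`: the retained `u` must be exchanged for the deleted `y`, whose pendant edge is cut.
  let T : V → V → Prop := fun u y =>
    ∃ x, u = z x ∧ y ∉ Set.range e ∧ y ∈ pendantNbrs G X x ∧ f y ≠ f x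
  let φ : W → V := fun a => if hT : ∃ y, T (e a) y then hT.choose else e a
  have hφ : ∀ a, φ a = e a ∨ T (e a) (φ a) := by
    intro a
    by_cases hT : ∃ y, T (e a) y
    · right
      simp only [φ, dif_pos hT]
      exact hT.choose_spec
    · left
      simp only [φ, dif_neg hT]
  have hcov : ∀ {x y}, y ∈ pendantNbrs G X x → x ∈ X :=
    fun hy => (h.cover hy.2.1).resolve_right hy.1
  have hTpend : ∀ {u y}, T u y → ∃ x, u ∈ pendantNbrs G X x ∧ y ∈ pendantNbrs G X x ∧
      y ∉ Set.range e ∧ f y ≠ f x ∧ f u = f x := by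
    rintro u y ⟨x, rfl, hy, hyx, hfy⟩
    have h1 := hz x ⟨y, hy, hyx⟩
    refine ⟨x, h1.2, hyx, hy, hfy, ?_⟩
    -- The cut edge to `y` is the only one at `x`, so the edge to `z x` is not cut; hence the
    -- exchange does not lose the colour of `z x`, which is that of `x`.
    by_contra hne
    exact hy (hf x y (z x) hyx.2.1 h1.2.2.1 hfy hne ▸ h1.1)
  have hφX : ∀ a, e a ∈ X → φ a = e a := by
    intro a ha
    refine (hφ a).resolve_right fun hT => ?_
    obtain ⟨x, hx, -⟩ := hTpend hT
    exact hx.1 ha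
  have hTφ : ∀ x y, y ∉ Set.range e → y ∈ pendantNbrs G X x → f y ≠ f x →
      ∃ a, e a ∈ pendantNbrs G X x ∧ φ a = y := by
    intro x y hy hyx hfy
    obtain ⟨⟨a, ha⟩, hzp⟩ := hz x ⟨y, hy, hyx⟩
    have hT : ∃ y, T (e a) y := ⟨y, x, ha, hy, hyx, hfy⟩
    refine ⟨a, ha ▸ hzp, ?_⟩
    have h1 : φ a = hT.choose := by simp only [φ, dif_pos hT]
    have h2 : T (e a) (φ a) := h1 ▸ hT.choose_spec
    obtain ⟨x', h3, h4, -, h5, -⟩ := hTpend h2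
    obtain rfl := eq_of_mem_pendantNbrs h3 (ha ▸ hzp)
    exact hf x _ _ h4.2.1 hyx.2.1 h5 hfy
  have hinj : Function.Injective φ := by
    intro a b hab
    rcases hφ a with ha | ha <;> rcases hφ b with hb | hb
    · exact h.inj (ha.symm.trans (hab.trans hb))
    · obtain ⟨x, -, -, h1, -⟩ := hTpend hb
      exact absurd ⟨a, ha.symm.trans hab⟩ h1
    · obtain ⟨x, -, -, h1, -⟩ := hTpend ha
      exact absurd ⟨b, hb.symm.trans hab.symm⟩ h1
    · obtain ⟨x, h1, -, h3, -⟩ := ha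
      obtain ⟨x', h1', -, h3', -⟩ := hb
      obtain rfl := eq_of_mem_pendantNbrs h3 (hab ▸ h3')
      exact h.inj (h1.trans h1'.symm)
  have hhom : ∀ a b, H.Adj a b → G.Adj (φ a) (φ b) := by
    have key : ∀ a b, H.Adj a b → T (e a) (φ a) → G.Adj (φ a) (φ b) := by
      intro a b hab hT
      obtain ⟨x, h1, h2, -⟩ := hTpend hT
      have hb : e b = x := eq_of_adj_of_mem_pendantNbrs h1 ((h.adj a b).1 hab)
      rw [hφX b (hb ▸ hcov h1), hb]
      exact h2.2.1.symm
    intro a b hab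
    rcases hφ a with ha | ha
    · rcases hφ b with hb | hb
      · rw [ha, hb]
        exact (h.adj a b).1 hab
      · exact (key b a hab.symm hb).symm
    · exact key a b hab ha
  have hcolor : ∀ a, f (φ a) = f (e a) ∨ ∃ x, e a ∈ pendantNbrs G X x := by
    intro a
    rcases hφ a with ha | ha
    · exact Or.inl (ha ▸ rfl)
    · obtain ⟨x, hx, -⟩ := hTpend ha
      exact Or.inr ⟨x, hx⟩
  refine ⟨f ∘ φ, hf.comp_hom hinj hhom, ?_, ?_, ?_⟩
  · have hsub : Set.range f ⊆ Set.range (f ∘ φ) ∪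
        f '' {v | v ∉ Set.range e ∧ ∀ w, ¬ G.Adj v w} := by
      have hX : ∀ x ∈ X, f x ∈ Set.range (f ∘ φ) := by
        intro x hx
        obtain ⟨a, rfl⟩ := h.subset hx
        exact ⟨a, by rw [Function.comp_apply, hφX a hx]⟩
      rintro _ ⟨v, rfl⟩
      by_cases hv : v ∈ Set.range e
      · left
        obtain ⟨a, rfl⟩ := hv
        rcases hφ a with ha | ha
        · exact ⟨a, by rw [Function.comp_apply, ha]⟩
        · obtain ⟨x, h1, -, -, -, h5⟩ := hTpend ha
          exact h5 ▸ hX x (hcov h1)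
      · rcases h.unmarked v hv with h1 | ⟨x, hx, -⟩ | ⟨h1, h2⟩
        · exact Or.inr ⟨v, ⟨hv, h1⟩, rfl⟩
        · left
          by_cases hfv : f v = f x
          · exact hfv ▸ hX x (hcov hx)
          · obtain ⟨a, -, rfl⟩ := hTφ x v hv hx hfv
            exact ⟨a, rfl⟩
        · left
          obtain ⟨x, -, -, hx, -⟩ := id h1
          rw [← hf.eq_of_heavy h1 h2 hx]
          exact hX x (h.exists_of_adj hv hx).1
    exact (Set.ncard_le_ncard hsub (Set.toFinite _)).trans ((Set.ncard_union_le _ _).trans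
      (Nat.add_le_add_left (Set.ncard_image_le (Set.toFinite _)) _))
  · ext p
    induction p using Sym2.ind with
    | _ u v =>
      simp only [Set.mem_sdiff, mk_mem_iUnion_pendantEdges_iff h.cover, mk_mem_image_map_iff,
        mk_mem_colorCut]
      refine and_congr_left fun hL => ?_
      rw [not_or] at hL
      -- Away from the pendant edges no exchange takes place, and by `hU` below no cut edge has a
      -- deleted end.
      have key : ∀ a b, G.Adj (e a) (e b) → e a ∉ pendantNbrs G X (e b) → φ a = e a := by
        intro a b hab hp
        refine (hφ a).resolve_right fun hT => ?_
        obtain ⟨x, h1, -⟩ := hTpend hT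
        obtain rfl := eq_of_adj_of_mem_pendantNbrs h1 hab
        exact hp h1
      constructor
      · rintro ⟨a, b, rfl, rfl, hab, hne⟩
        rw [h.adj] at hab
        refine ⟨hab, ?_⟩
        rwa [Function.comp_apply, Function.comp_apply, key a b hab hL.2, key b a hab.symm hL.1]
          at hne
      · rintro ⟨huv, hne⟩
        have hU : ∀ u v, G.Adj u v → f u ≠ f v → u ∉ pendantNbrs G X v → u ∈ Set.range e := by
          intro u v huv hne hp
          by_contra hu
          rcases h.unmarked u hu with h1 | ⟨x, hx, -⟩ | ⟨h1, h2⟩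
          · exact h1 _ huv
          · obtain rfl := eq_of_adj_of_mem_pendantNbrs hx huv
            exact hp hx
          · exact hne (hf.eq_of_heavy h1 h2 huv).symm
        obtain ⟨a, rfl⟩ := hU u v huv hne hL.2
        obtain ⟨b, rfl⟩ := hU v _ huv.symm hne.symm hL.1
        refine ⟨a, b, rfl, rfl, (h.adj a b).2 huv, ?_⟩
        rwa [Function.comp_apply, Function.comp_apply, key a b huv hL.2, key b a huv.symm hL.1]
  · intro x hx
    obtain ⟨a, rfl⟩ := h.subset hx
    have hcut : ∀ y, s(e a, y) ∈ Sym2.map e '' colorCut H (f ∘ φ) ↔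
        ∃ b, e b = y ∧ H.Adj a b ∧ f (e a) ≠ f (φ b) := by
      intro y
      rw [mk_mem_image_map_iff]
      constructor
      · rintro ⟨a', b, ha, rfl, hab⟩
        obtain rfl := h.inj ha
        rw [mk_mem_colorCut, Function.comp_apply, Function.comp_apply, hφX _ hx] at hab
        exact ⟨b, rfl, hab⟩
      · rintro ⟨b, rfl, hab⟩
        refine ⟨a, b, rfl, rfl, ?_⟩
        rw [mk_mem_colorCut, Function.comp_apply, Function.comp_apply, hφX _ hx]
        exact hab
    refine encard_eq_of_subsingleton_of_nonempty_iff ?_ ?_ ?_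
    · rw [subsingleton_inter_pendantEdges_iff]
      rintro y - y' - h1 h2
      obtain ⟨b, rfl, hb, hb'⟩ := (hcut y).1 h1
      obtain ⟨c, rfl, hc, hc'⟩ := (hcut y').1 h2
      have h3 := hf.comp_hom hinj hhom a b c hb hc
      rw [Function.comp_apply, Function.comp_apply, Function.comp_apply, hφX _ hx] at h3
      rw [h3 hb'.symm hc'.symm]
    · rw [subsingleton_inter_pendantEdges_iff]
      intro y hy y' hy' h1 h2
      rw [mk_mem_colorCut] at h1 h2
      exact hf _ _ _ h1.1 h2.1 h1.2.symm h2.2.symm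
    · rw [nonempty_inter_pendantEdges_iff, nonempty_inter_pendantEdges_iff]
      constructor
      · rintro ⟨y, hy, h1⟩
        obtain ⟨b, rfl, hb, hb'⟩ := (hcut y).1 h1
        rcases hφ b with h2 | h2
        · exact ⟨e b, hy, mk_mem_colorCut.2 ⟨hy.2.1, h2 ▸ hb'⟩⟩
        · obtain ⟨x', h3, h4, -⟩ := hTpend h2
          obtain rfl := eq_of_mem_pendantNbrs h3 hy
          exact ⟨φ b, h4, mk_mem_colorCut.2 ⟨h4.2.1, hb'⟩⟩
      · rintro ⟨y, hy, h1⟩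
        rw [mk_mem_colorCut] at h1
        by_cases hyU : y ∈ Set.range e
        · obtain ⟨b, rfl⟩ := hyU
          refine ⟨e b, hy, (hcut _).2 ⟨b, rfl, (h.adj a b).2 h1.1, ?_⟩⟩
          rcases hφ b with h2 | h2
          · exact h2.symm ▸ h1.2
          · obtain ⟨x', h3, -, -, -, h4⟩ := hTpend h2
            obtain rfl := eq_of_mem_pendantNbrs hy h3
            exact absurd h4.symm h1.2
        · obtain ⟨b, hb, hby⟩ := hTφ _ y hyU hy h1.2.symm
          exact ⟨e b, hb, (hcut _).2 ⟨b, rfl, (h.adj a b).2 hb.2.1, hby.symm ▸ h1.2⟩⟩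

end Restriction

/-! ### Extending colourings of the restricted graph -/

section Extension

variable {V W : Type*} {G : SimpleGraph V} {H : SimpleGraph W} {e : W → V} {X : Set V}

theorem IsMarkedEmbedding.color_eq_of_heavy {κ : Type*} (h : IsMarkedEmbedding G H e X)
    {g : W → κ} (hg : IsMulticutColoring H g) {v : V}
    (h2 : ∀ x y, G.Adj v x → G.Adj v y → x ≠ y →
      3 ≤ (commonNbrs G X x y ∩ Set.range e).encard)
    {a b : W} (ha : G.Adj v (e a)) (hb : G.Adj v (e b)) : g a = g b := by
  by_cases hab : a = b
  · rw [hab]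
  · refine hg.eq_of_three_le_encard (S := e ⁻¹' commonNbrs G X (e a) (e b)) ?_ ?_ ?_
    · rw [← h.inj.encard_image, Set.image_preimage_eq_inter_range]
      exact h2 _ _ ha hb (h.inj.ne hab)
    · exact fun w hw => (h.adj _ _).2 hw.2.1
    · exact fun w hw => (h.adj _ _).2 hw.2.2.1

/-- The colour of a vertex of `G` is dictated by `M`. A cut pendant vertex receives the colour of
the retained pendant vertex cut in `H` at the same centre, an uncut one that of its centre, a
deleted vertex of degree at least two that of its neighbours. The summand `V` of `κ ⊕ V` supplies a
private colour for every deleted isolated vertex. -/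
theorem IsMarkedEmbedding.exists_coloring_of_equiv [Finite V] {κ : Type*} [Finite κ]
    (h : IsMarkedEmbedding G H e X) {g : W → κ} (hg : IsMulticutColoring H g) {M : Set (Sym2 V)}
    (hM : M ⊆ G.edgeSet) (hequiv : PendantEquiv G X (Sym2.map e '' colorCut H g) M) :
    ∃ c : V → κ ⊕ V, IsMulticutColoring G c ∧
      (Set.range g).ncard + {v | v ∉ Set.range e ∧ ∀ w, ¬ G.Adj v w}.ncard ≤
        (Set.range c).ncard ∧ M = colorCut G c := by
  classical
  have hcov : ∀ {x y}, y ∈ pendantNbrs G X x → x ∈ X :=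
    fun hy => (h.cover hy.2.1).resolve_right hy.1
  have hcut : ∀ a y, s(e a, y) ∈ Sym2.map e '' colorCut H g ↔
      ∃ b, e b = y ∧ H.Adj a b ∧ g a ≠ g b := by
    intro a y
    rw [mk_mem_image_map_iff]
    constructor
    · rintro ⟨a', b, ha, rfl, hab⟩
      obtain rfl := h.inj ha
      exact ⟨b, rfl, mk_mem_colorCut.1 hab⟩
    · rintro ⟨b, rfl, hab⟩
      exact ⟨a, b, rfl, rfl, mk_mem_colorCut.2 hab⟩
  have hsub' : ∀ a, (Sym2.map e '' colorCut H g ∩ pendantEdges G X (e a)).Subsingleton := by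
    intro a
    rw [subsingleton_inter_pendantEdges_iff]
    rintro y - y' - h1 h2
    obtain ⟨b, rfl, hb, hb'⟩ := (hcut a y).1 h1
    obtain ⟨c, rfl, hc, hc'⟩ := (hcut a y').1 h2
    rw [hg a b c hb hc hb'.symm hc'.symm]
  -- `M` is not yet known to be a cut; that it has at most one pendant edge at `x` is inherited from
  -- `H` through the equality of counts.
  have huniq : ∀ x y y', y ∈ pendantNbrs G X x → y' ∈ pendantNbrs G X x → s(x, y) ∈ M →
      s(x, y') ∈ M → y = y' := by
    intro x y y' hy hy'
    obtain ⟨a, rfl⟩ := h.subset (hcov hy)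
    have h1 := hequiv.2 _ (hcov hy)
    have h2 : (M ∩ pendantEdges G X (e a)).Subsingleton := by
      rw [← Set.encard_le_one_iff_subsingleton] at *
      rw [← h1]
      exact Set.encard_le_one_iff_subsingleton.2 (hsub' a)
    exact subsingleton_inter_pendantEdges_iff.1 h2 y hy y' hy'
  have hne : ∀ a, e a ∈ X → ((∃ y ∈ pendantNbrs G X (e a), s(e a, y) ∈ M) ↔
      ∃ b, e b ∈ pendantNbrs G X (e a) ∧ H.Adj a b ∧ g a ≠ g b) := by
    intro a ha
    rw [← nonempty_inter_pendantEdges_iff, ← Set.encard_ne_zero, ← hequiv.2 _ ha,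
      Set.encard_ne_zero, nonempty_inter_pendantEdges_iff]
    constructor
    · rintro ⟨y, hy, h1⟩
      obtain ⟨b, rfl, hb⟩ := (hcut a y).1 h1
      exact ⟨b, hy, hb⟩
    · rintro ⟨b, hy, hb⟩
      exact ⟨e b, hy, (hcut a _).2 ⟨b, rfl, hb⟩⟩
  have hout : ∀ a v, e a ∉ pendantNbrs G X v → v ∉ pendantNbrs G X (e a) →
      (s(e a, v) ∈ M ↔ ∃ b, e b = v ∧ H.Adj a b ∧ g a ≠ g b) := by
    intro a v h1 h2
    have h3 : s(e a, v) ∉ ⋃ x ∈ X, pendantEdges G X x := by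
      rw [mk_mem_iUnion_pendantEdges_iff h.cover]
      tauto
    rw [← hcut]
    have := Set.ext_iff.1 hequiv.1 s(e a, v)
    simp only [Set.mem_sdiff, h3, not_false_eq_true, and_true] at this
    exact this.symm
  -- The five clauses prescribe the colour of a deleted isolated vertex, a cut pendant vertex, an
  -- uncut pendant vertex, a retained vertex that is not pendant, and a deleted vertex of degree at
  -- least two.
  have hexists : ∀ v, ∃ k : κ ⊕ V,
      (v ∉ Set.range e → (∀ w, ¬ G.Adj v w) → k = Sum.inr v) ∧
      (∀ x, v ∈ pendantNbrs G X x → s(x, v) ∈ M → ∃ a b, e a = x ∧ e b ∈ pendantNbrs G X x ∧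
        H.Adj a b ∧ g a ≠ g b ∧ k = Sum.inl (g b)) ∧
      (∀ a, v ∈ pendantNbrs G X (e a) → s(e a, v) ∉ M → k = Sum.inl (g a)) ∧
      (∀ a, e a = v → (∀ x, v ∉ pendantNbrs G X x) → k = Sum.inl (g a)) ∧
      (v ∉ Set.range e → (∃ x y, x ≠ y ∧ G.Adj v x ∧ G.Adj v y) →
        ∀ a, G.Adj v (e a) → k = Sum.inl (g a)) := by
    intro v
    by_cases hp : ∃ x, v ∈ pendantNbrs G X x
    · obtain ⟨x, hx⟩ := hp
      obtain ⟨a, rfl⟩ := h.subset (hcov hx)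
      have hheavy : ¬ ∃ x y, x ≠ y ∧ G.Adj v x ∧ G.Adj v y := by
        rintro ⟨x, y, hxy, h1, h2⟩
        exact hxy ((eq_of_adj_of_mem_pendantNbrs hx h1).trans
          (eq_of_adj_of_mem_pendantNbrs hx h2).symm)
      by_cases hvM : s(e a, v) ∈ M
      · obtain ⟨b, hb, hab, hne'⟩ := (hne a (hcov hx)).1 ⟨v, hx, hvM⟩
        refine ⟨Sum.inl (g b), fun _ h1 => absurd hx.2.1.symm (h1 _), ?_, ?_,
          fun _ _ h1 => absurd hx (h1 _), fun _ h1 => absurd h1 hheavy⟩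
        · intro x' hx' _
          obtain rfl := eq_of_mem_pendantNbrs hx hx'
          exact ⟨a, b, rfl, hb, hab, hne', rfl⟩
        · intro a' ha' h1
          obtain rfl := h.inj (eq_of_mem_pendantNbrs hx ha')
          exact absurd hvM h1
      · refine ⟨Sum.inl (g a), fun _ h1 => absurd hx.2.1.symm (h1 _), ?_, ?_,
          fun _ _ h1 => absurd hx (h1 _), fun _ h1 => absurd h1 hheavy⟩
        · intro x' hx' h1
          obtain rfl := eq_of_mem_pendantNbrs hx hx'
          exact absurd h1 hvM
        · intro a' ha' _
          obtain rfl := h.inj (eq_of_mem_pendantNbrs hx ha')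
          rfl
    · rw [not_exists] at hp
      by_cases hv : v ∈ Set.range e
      · obtain ⟨a, rfl⟩ := hv
        exact ⟨Sum.inl (g a), fun h1 => absurd ⟨a, rfl⟩ h1, fun x hx => absurd hx (hp x),
          fun x hx => absurd hx (hp _), fun a' ha' _ => by rw [h.inj ha'],
          fun h1 => absurd ⟨a, rfl⟩ h1⟩
      · rcases h.unmarked v hv with h1 | ⟨x, hx, -⟩ | ⟨h1, h2⟩
        · exact ⟨Sum.inr v, fun _ _ => rfl, fun x hx => absurd hx (hp x),
            fun x hx => absurd hx (hp _), fun a ha => absurd ⟨a, ha⟩ hv,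
            fun _ _ a ha => absurd ha (h1 _)⟩
        · exact absurd hx (hp x)
        · obtain ⟨x, -, -, hx, -⟩ := id h1
          obtain ⟨-, a, rfl⟩ := h.exists_of_adj hv hx
          exact ⟨Sum.inl (g a), fun _ h1 => absurd hx (h1 _), fun x hx => absurd hx (hp x),
            fun x hx => absurd hx (hp _), fun a ha => absurd ⟨a, ha⟩ hv,
            fun _ _ b hb => by rw [h.color_eq_of_heavy hg h2 hx hb]⟩
  choose c hiso hpin hpout hkept hheavy using hexists
  have hX : ∀ a, e a ∈ X → c (e a) = Sum.inl (g a) :=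
    fun a ha => hkept _ a rfl fun x hx => hx.1 ha
  have hinl : ∀ a b, (Sum.inl (g a) : κ ⊕ V) ≠ Sum.inl (g b) ↔ g a ≠ g b :=
    fun a b => Sum.inl_injective.ne_iff
  -- Every exception `w` at `e a` in `G` is traced back to an exception `b` at `a` in `H`: either
  -- `w` itself, or the retained pendant vertex that stands for `w`. Uniqueness in `H` then yields
  -- uniqueness in `G`.
  have hrep : ∀ a w, e a ∈ X → G.Adj (e a) w → c w ≠ c (e a) →
      ∃ b, H.Adj a b ∧ g b ≠ g a ∧ ((e b = w ∧ ∀ x, w ∉ pendantNbrs G X x) ∨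
        (w ∈ pendantNbrs G X (e a) ∧ e b ∈ pendantNbrs G X (e a) ∧ s(e a, w) ∈ M)) := by
    intro a w ha haw hcw
    rw [hX a ha] at hcw
    by_cases hp : ∃ x, w ∈ pendantNbrs G X x
    · obtain ⟨x, hx⟩ := hp
      obtain rfl := eq_of_adj_of_mem_pendantNbrs hx haw.symm
      by_cases hwM : s(e a, w) ∈ M
      · obtain ⟨a', b, h1, h2, h3, h4, h5⟩ := hpin w _ hx hwM
        obtain rfl := h.inj h1
        exact ⟨b, h3, h4.symm, Or.inr ⟨hx, h2, hwM⟩⟩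
      · exact absurd (hpout w a hx hwM) hcw
    · rw [not_exists] at hp
      by_cases hw : w ∈ Set.range e
      · obtain ⟨b, rfl⟩ := hw
        rw [hkept _ b rfl hp] at hcw
        exact ⟨b, (h.adj _ _).2 haw, (hinl _ _).1 hcw, Or.inl ⟨rfl, hp⟩⟩
      · rcases h.unmarked w hw with h1 | ⟨x, hx, -⟩ | ⟨h1, h2⟩
        · exact absurd haw.symm (h1 _)
        · exact absurd hx (hp x)
        · exact absurd (hheavy w hw h1 a haw.symm) hcw
  refine ⟨c, ?_, ?_, ?_⟩
  · intro v w w' hw hw' hcw hcw'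
    by_cases hv : v ∈ X
    · obtain ⟨a, rfl⟩ := h.subset hv
      obtain ⟨b, h1, h2, h3⟩ := hrep a w hv hw hcw
      obtain ⟨b', h1', h2', h3'⟩ := hrep a w' hv hw' hcw'
      obtain rfl := hg a b b' h1 h1' h2 h2'
      rcases h3 with ⟨h3, h4⟩ | ⟨h3, h4, h5⟩ <;> rcases h3' with ⟨h3', h4'⟩ | ⟨h3', h4', h5'⟩
      · exact h3.symm.trans h3'
      · exact absurd (h3 ▸ h4') (h4 _)
      · exact absurd (h3' ▸ h4) (h4' _)
      · exact huniq _ _ _ h3 h3' h5 h5'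
    · have hwX := (h.cover hw).resolve_left hv
      have hwX' := (h.cover hw').resolve_left hv
      by_cases hp : ∃ x, v ∈ pendantNbrs G X x
      · obtain ⟨x, hx⟩ := hp
        exact (eq_of_adj_of_mem_pendantNbrs hx hw).trans
          (eq_of_adj_of_mem_pendantNbrs hx hw').symm
      · rw [not_exists] at hp
        obtain ⟨b, rfl⟩ := h.subset hwX
        obtain ⟨b', rfl⟩ := h.subset hwX'
        by_cases hvU : v ∈ Set.range e
        · obtain ⟨a, rfl⟩ := hvU
          rw [hX b hwX, hkept _ a rfl hp, hinl] at hcw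
          rw [hX b' hwX', hkept _ a rfl hp, hinl] at hcw'
          rw [hg a b b' ((h.adj _ _).2 hw) ((h.adj _ _).2 hw') hcw hcw']
        · rcases h.unmarked v hvU with h1 | ⟨x, hx, -⟩ | ⟨h1, h2⟩
          · exact absurd hw (h1 _)
          · exact absurd hx (hp x)
          · rw [hX b hwX, hheavy v hvU h1 b hw] at hcw
            exact absurd rfl hcw
  · have hsub : Sum.inl '' Set.range g ∪ Sum.inr '' {v | v ∉ Set.range e ∧ ∀ w, ¬ G.Adj v w} ⊆
        Set.range c := by
      rintro _ (⟨_, ⟨a, rfl⟩, rfl⟩ | ⟨v, ⟨hv, hv'⟩, rfl⟩)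
      · by_cases hp : ∃ x, e a ∈ pendantNbrs G X x
        · obtain ⟨x, hx⟩ := hp
          obtain ⟨b, rfl⟩ := h.subset (hcov hx)
          by_cases hgab : g a = g b
          · exact ⟨e b, by rw [hX b (hcov hx), hgab]⟩
          · have hba : H.Adj b a := (h.adj _ _).2 hx.2.1
            -- The colour of a cut retained pendant vertex may disappear from that vertex, but it
            -- reappears at the pendant vertex `y` cut by `M` at the same centre.
            obtain ⟨y, hy, hyM⟩ := (hne b (hcov hx)).2 ⟨a, hx, hba, Ne.symm hgab⟩
            obtain ⟨b', a', h1, h2, h3, h4, h5⟩ := hpin y _ hy hyM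
            obtain rfl := h.inj h1
            exact ⟨y, by rw [h5, hg b' a' a h3 hba h4.symm hgab]⟩
        · rw [not_exists] at hp
          exact ⟨e a, hkept _ a rfl hp⟩
      · exact ⟨v, hiso v hv hv'⟩
    have hdisj : Disjoint ((Sum.inl : κ → κ ⊕ V) '' Set.range g)
        (Sum.inr '' {v | v ∉ Set.range e ∧ ∀ w, ¬ G.Adj v w}) := by
      rw [Set.disjoint_left]
      rintro _ ⟨k, -, rfl⟩ ⟨v, -, h1⟩
      exact Sum.inr_ne_inl h1
    have := Set.ncard_le_ncard hsub (Set.toFinite _)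
    rwa [Set.ncard_union_eq hdisj (Set.toFinite _) (Set.toFinite _),
      Set.ncard_image_of_injective _ Sum.inl_injective,
      Set.ncard_image_of_injective _ Sum.inr_injective] at this
  · have key : ∀ a v, e a ∈ X → G.Adj (e a) v → (s(e a, v) ∈ M ↔ c (e a) ≠ c v) := by
      intro a v ha hav
      by_cases hp : ∃ x, v ∈ pendantNbrs G X x
      · obtain ⟨x, hx⟩ := hp
        obtain rfl := eq_of_adj_of_mem_pendantNbrs hx hav.symm
        by_cases hvM : s(e a, v) ∈ M
        · obtain ⟨a', b, h1, h2, h3, h4, h5⟩ := hpin v _ hx hvM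
          obtain rfl := h.inj h1
          simp only [hvM, true_iff]
          rw [hX a' ha, h5, hinl]
          exact h4
        · simp only [hvM, false_iff, not_not]
          rw [hX a ha, hpout v a hx hvM]
      · rw [not_exists] at hp
        rw [hout a v (fun h' => h'.1 ha) (hp _)]
        by_cases hv : v ∈ Set.range e
        · obtain ⟨b, rfl⟩ := hv
          rw [hX a ha, hkept _ b rfl hp, hinl]
          constructor
          · rintro ⟨b', h1, -, h2⟩
            exact h.inj h1 ▸ h2
          · intro h2
            exact ⟨b, rfl, (h.adj _ _).2 hav, h2⟩
        · rcases h.unmarked v hv with h1 | ⟨x, hx, -⟩ | ⟨h1, h2⟩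
          · exact absurd hav.symm (h1 _)
          · exact absurd hx (hp x)
          · rw [hX a ha, hheavy v hv h1 a hav.symm]
            simp only [ne_eq, not_true_eq_false, iff_false]
            rintro ⟨b, rfl, -⟩
            exact hv ⟨b, rfl⟩
    ext p
    induction p using Sym2.ind with
    | _ u v =>
      rw [mk_mem_colorCut]
      by_cases huv : G.Adj u v
      · simp only [huv, true_and]
        rcases h.cover huv with hu | hv
        · obtain ⟨a, rfl⟩ := h.subset hu
          exact key a v hu huv
        · obtain ⟨a, rfl⟩ := h.subset hv
          rw [Sym2.eq_swap, key a u hv huv.symm]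
          exact ne_comm
      · simp only [huv, false_and, iff_false]
        exact fun h' => huv (hM h')

/-- The matching multicuts of `G` on at least `l` parts are the sets of edges equivalent to a
matching multicut of the restricted graph `H`, on a number of parts that is smaller by the number
of isolated vertices left out. -/
theorem IsMarkedEmbedding.mem_matchingMulticuts_iff [Finite V] [Finite W]
    (h : IsMarkedEmbedding G H e X) {l : ℤ} {M : Set (Sym2 V)} (hM : M ⊆ G.edgeSet) :
    M ∈ matchingMulticuts G l ↔
      ∃ M' ∈ matchingMulticuts H (l - {v | v ∉ Set.range e ∧ ∀ w, ¬ G.Adj v w}.ncard),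
        PendantEquiv G X (Sym2.map e '' M') M := by
  constructor
  · intro hMl
    obtain ⟨f, hf, hl, rfl⟩ := exists_coloring_of_mem_matchingMulticuts hMl
    obtain ⟨g, hg, hcard, hequiv⟩ := h.exists_equiv_of_coloring hf
    exact ⟨_, colorCut_mem_matchingMulticuts hg (by omega), hequiv⟩
  · rintro ⟨M', hM', hequiv⟩
    obtain ⟨g, hg, hl, rfl⟩ := exists_coloring_of_mem_matchingMulticuts hM'
    obtain ⟨c, hc, hcard, rfl⟩ := h.exists_coloring_of_equiv hg hM hequiv
    exact colorCut_mem_matchingMulticuts hc (by omega)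

end Extension

/-! ### The marking procedure with a given vertex cover -/

section MarkingBound

variable {V : Type*} {G : SimpleGraph V} {X Z : Set V}

/-- If a candidate was left unmarked, the candidates were not exhausted, so the full quota of one
pendant vertex or of three common neighbours was marked. -/
theorem IsMarking.isMarkedEmbedding [Finite V] (hiso : ∀ v, ∃ w, G.Adj v w)
    (hX : G.IsVertexCover X) (hZ : IsMarking G X Z) :
    IsMarkedEmbedding G (G.induce (X ∪ Z)) Subtype.val X where
  inj := Subtype.val_injective
  adj _ _ := Iff.rfl
  cover := hX
  subset x hx := ⟨⟨x, Or.inl hx⟩, rfl⟩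
  unmarked := by
    obtain ⟨m₁, m₂, h₁, h₂, rfl⟩ := hZ
    intro v hv
    rw [Subtype.range_coe] at *
    have hvX : v ∉ X := fun h => hv (Or.inl h)
    have hadjX : ∀ {w}, G.Adj v w → w ∈ X := fun h => (hX h).resolve_left hvX
    right
    obtain ⟨x, hx⟩ := hiso v
    by_cases hd : ∃ x y, x ≠ y ∧ G.Adj v x ∧ G.Adj v y
    · refine Or.inr ⟨hd, fun x y hvx hvy hxy => ?_⟩
      have hd2 : 2 ≤ (G.neighborSet v).encard := by
        rw [← Set.encard_pair hxy]
        exact Set.encard_le_encard (Set.insert_subset hvx (Set.singleton_subset_iff.2 hvy))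
      have hvc : v ∈ commonNbrs G X x y := ⟨hvX, hvx.symm, hvy.symm, hd2⟩
      obtain ⟨hsub, hcard⟩ := h₂ x (hadjX hvx) y (hadjX hvy) hxy
      have hvm : v ∉ m₂ s(x, y) := fun h =>
        hv (Or.inr (Or.inr ⟨x, hadjX hvx, y, hadjX hvy, hxy, h⟩))
      have h3 : (m₂ s(x, y)).encard = 3 := by
        -- With fewer than three common neighbours all of them are marked, among them `v`.
        by_contra hne
        have hlt : ¬ (3 : ℕ∞) ≤ (commonNbrs G X x y).encard := fun h => hne (by
          rw [hcard, min_eq_left h])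
        have heq := (Set.toFinite _).eq_of_subset_of_encard_le hsub
          (by rw [hcard, min_eq_right (not_le.1 hlt).le])
        exact hvm (heq ▸ hvc)
      rw [← h3]
      refine Set.encard_le_encard fun w hw => ⟨hsub hw, ?_⟩
      exact Or.inr (Or.inr ⟨x, hadjX hvx, y, hadjX hvy, hxy, hw⟩)
    · left
      have hN : G.neighborSet v = {x} := by
        ext y
        constructor
        · intro hy
          by_contra hyx
          exact hd ⟨y, x, hyx, hy, hx⟩
        · rintro rfl
          exact hx
      have hvp : v ∈ pendantNbrs G X x := ⟨hvX, hx.symm, by rw [hN, Set.encard_singleton]⟩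
      obtain ⟨hsub, hcard⟩ := h₁ x (hadjX hx)
      have : (m₁ x).Nonempty := by
        rw [← Set.one_le_encard_iff_nonempty, hcard]
        exact le_min le_rfl (Set.one_le_encard_iff_nonempty.2 ⟨v, hvp⟩)
      obtain ⟨z, hz⟩ := this
      exact ⟨x, hvp, ⟨z, Or.inr (Or.inl ⟨x, hadjX hx, hz⟩)⟩, hsub hz⟩

/-- The summands are `X` itself, one pendant vertex for each `x ∈ X`, and three vertices for each
unordered pair; `D` lists the unordered pairs. -/
theorem IsMarking.ncard_le [Finite V] (hZ : IsMarking G X Z) :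
    (X ∪ Z).ncard ≤ 2 * X.ncard + 3 * X.ncard.choose 2 := by
  classical
  obtain ⟨m₁, m₂, h₁, h₂, rfl⟩ := hZ
  have hfin := Fintype.ofFinite V
  set F : Finset V := X.toFinset with hF
  set D : Finset (Sym2 V) := F.offDiag.image fun p => s(p.1, p.2) with hD
  have hXF : X.ncard = F.card := Set.ncard_eq_toFinset_card' X
  have hsub : X ∪ {v | (∃ x ∈ X, v ∈ m₁ x) ∨ ∃ x ∈ X, ∃ y ∈ X, x ≠ y ∧ v ∈ m₂ s(x, y)} ⊆
      ((F ∪ F.biUnion fun x => (m₁ x).toFinset) ∪ D.biUnion fun p => (m₂ p).toFinset :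
        Finset V) := by
    rintro v (hv | ⟨x, hx, hv⟩ | ⟨x, hx, y, hy, hxy, hv⟩)
    · simp [hF, hv]
    · simp only [Finset.coe_union, Set.mem_union, Finset.mem_coe, Finset.mem_biUnion,
        Set.mem_toFinset]
      exact Or.inl (Or.inr ⟨x, by simpa [hF] using hx, hv⟩)
    · simp only [Finset.coe_union, Set.mem_union, Finset.mem_coe, Finset.mem_biUnion,
        Set.mem_toFinset]
      refine Or.inr ⟨s(x, y), ?_, hv⟩
      rw [hD, Finset.mem_image]
      exact ⟨(x, y), by simp [hF, hx, hy, hxy], rfl⟩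
  have hm₁ : ∀ x ∈ F, (m₁ x).toFinset.card ≤ 1 := by
    intro x hx
    have h := (h₁ x (by simpa [hF] using hx)).2
    rw [← Set.ncard_eq_toFinset_card', Set.ncard, h]
    exact ENat.toNat_le_of_le_natCast (min_le_left _ _)
  have hm₂ : ∀ p ∈ D, (m₂ p).toFinset.card ≤ 3 := by
    intro p hp
    rw [hD, Finset.mem_image] at hp
    obtain ⟨⟨x, y⟩, hxy, rfl⟩ := hp
    simp only [Finset.mem_offDiag, hF, Set.mem_toFinset] at hxy
    have h := (h₂ x hxy.1 y hxy.2.1 hxy.2.2).2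
    rw [← Set.ncard_eq_toFinset_card', Set.ncard, h]
    exact ENat.toNat_le_of_le_natCast (min_le_left _ _)
  have hDcard : D.card = F.card.choose 2 := by
    rw [hD]
    exact Sym2.card_image_offDiag F
  calc _ ≤ _ := Set.ncard_le_ncard hsub (Finset.finite_toSet _)
    _ = _ := Set.ncard_coe_finset _
    _ ≤ (F.card + F.card * 1) + D.card * 3 :=
      (Finset.card_union_le _ _).trans (add_le_add ((Finset.card_union_le _ _).trans
        (add_le_add le_rfl (Finset.card_biUnion_le_card_mul _ _ _ hm₁)))
        (Finset.card_biUnion_le_card_mul _ _ _ hm₂))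
    _ = _ := by rw [hDcard, hXF]; ring

end MarkingBound

/-! ## The kernel for the parameter vertex cover number -/

/-! ### Ranks in a finite linear order -/

section Rank

variable {α : Type*} [LinearOrder α] [Finite α]

theorem ncard_lt_lt_ncard_lt {S : Set α} {u v : α} (hu : u ∈ S) (h : u < v) :
    {w | w ∈ S ∧ w < u}.ncard < {w | w ∈ S ∧ w < v}.ncard := by
  refine Set.ncard_lt_ncard ⟨fun w hw => ⟨hw.1, hw.2.trans h⟩, fun hsub => ?_⟩ (Set.toFinite _)
  exact lt_irrefl u (hsub ⟨hu, h⟩).2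

theorem injOn_ncard_lt (S : Set α) : Set.InjOn (fun u => {w | w ∈ S ∧ w < u}.ncard) S := by
  intro u hu v hv huv
  rcases lt_trichotomy u v with h | h | h
  · exact absurd huv (ncard_lt_lt_ncard_lt hu h).ne
  · exact h
  · exact absurd huv (ncard_lt_lt_ncard_lt hv h).ne'

/-- With the injectivity above, ranks number the elements of `S` from `0`. This describes both "the
first few elements" in the marking and the choice of a pendant edge by a digit of a counter. -/
theorem image_ncard_lt (S : Set α) :
    (fun u => {w | w ∈ S ∧ w < u}.ncard) '' S = Set.Iio S.ncard := by
  refine Set.eq_of_subset_of_ncard_le ?_ ?_ (Set.toFinite _)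
  · rintro _ ⟨u, hu, rfl⟩
    refine Set.ncard_lt_ncard ⟨fun w hw => hw.1, fun hsub => ?_⟩ (Set.toFinite _)
    exact lt_irrefl u (hsub hu).2
  · rw [(injOn_ncard_lt S).ncard_image, Set.ncard_eq_toFinset_card']
    simp

/-- The number of elements of rank at most `t` in a finite set. -/
theorem ncard_rank_le (S : Set α) (t : ℕ) :
    {u | u ∈ S ∧ {w | w ∈ S ∧ w < u}.ncard ≤ t}.ncard = min S.ncard (t + 1) := by
  rw [← ((injOn_ncard_lt S).mono (fun u hu => hu.1)).ncard_image]
  have : (fun u => {w | w ∈ S ∧ w < u}.ncard) '' {u | u ∈ S ∧ {w | w ∈ S ∧ w < u}.ncard ≤ t} =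
      Set.Iio (min S.ncard (t + 1)) := by
    ext i
    simp only [Set.mem_image, Set.mem_ofPred_eq, Set.mem_Iio, lt_min_iff, Nat.lt_succ_iff]
    constructor
    · rintro ⟨u, ⟨hu, hut⟩, rfl⟩
      have : {w | w ∈ S ∧ w < u}.ncard ∈ Set.Iio S.ncard := image_ncard_lt S ▸ ⟨u, hu, rfl⟩
      exact ⟨this, hut⟩
    · rintro ⟨hi, hit⟩
      have : i ∈ (fun u => {w | w ∈ S ∧ w < u}.ncard) '' S := (image_ncard_lt S).symm ▸ hi
      obtain ⟨u, hu, rfl⟩ := this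
      exact ⟨u, ⟨hu, hit⟩, rfl⟩
  rw [this, Set.ncard_eq_toFinset_card']
  simp

end Rank

/-! ### The retained vertices: equivalence, parameter and size -/

section Kernel

variable {V W : Type*} (G : SimpleGraph V) (k : ℕ)

/-- The vertices of degree more than `k`. -/
def highDegree : Set V := {v | k < (G.neighborSet v).ncard}

/-- The vertices of degree at most `k` all of whose neighbours have degree more than `k`. -/
def lowRest : Set V := {v | v ∉ highDegree G k ∧ ∀ u, G.Adj v u → u ∈ highDegree G k}

/-- The vertices outside `lowRest G k` and the marked vertices of `lowRest G k`: the first pendant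
neighbour of every vertex, the first `k + 1` neighbours of every vertex and the first three common
neighbours of every two vertices, the latter two subject to having degree at least two. -/
def keptVertices [LinearOrder V] : Set V :=
  {v | v ∈ lowRest G k →
    ((G.neighborSet v).ncard = 1 ∧ ∃ x, G.Adj v x ∧
      ∀ u, u ∈ lowRest G k → (G.neighborSet u).ncard = 1 → G.Adj u x → ¬ u < v) ∨
    ((G.neighborSet v).ncard ≠ 1 ∧ ∃ x y, G.Adj v x ∧ G.Adj v y ∧
      ((x = y ∧ {u | (u ∈ lowRest G k ∧ G.Adj u x ∧ G.Adj u y) ∧ u < v}.ncard ≤ k) ∨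
       (x ≠ y ∧ {u | (u ∈ lowRest G k ∧ G.Adj u x ∧ G.Adj u y) ∧ u < v}.ncard ≤ 2)))}

variable {G k}

/-- Members of `lowRest` have small degree and only neighbours of large degree, so no two of them
are adjacent. -/
theorem isVertexCover_compl_lowRest : G.IsVertexCover (lowRest G k)ᶜ := by
  intro u v huv
  by_contra! h
  simp only [Set.mem_compl_iff, not_not] at h
  exact h.1.1 (h.2.2 u huv.symm)

theorem exists_kept_pendant [LinearOrder V] [Finite V] {x v : V}
    (hv : v ∈ pendantNbrs G (lowRest G k)ᶜ x) :
    ∃ z ∈ keptVertices G k, z ∈ pendantNbrs G (lowRest G k)ᶜ x := by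
  obtain ⟨z, hz⟩ := (Set.toFinite (pendantNbrs G (lowRest G k)ᶜ x)).exists_minimal ⟨v, hv⟩
  refine ⟨z, fun _ => Or.inl ⟨?_, x, hz.1.2.1.symm, ?_⟩, hz.1⟩
  · rw [Set.ncard, hz.1.2.2]; rfl
  · intro u hu hu1 hux huz
    have : (G.neighborSet u).encard = 1 := by
      rw [← (Set.toFinite _).cast_ncard_eq, hu1]; rfl
    exact absurd (hz.2 ⟨fun h => h hu, hux.symm, this⟩ huz.le) (not_le.2 huz)

/-- An isolated vertex belongs to `lowRest` vacuously, while every kind of mark demands a neighbour.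
So the number of deleted isolated vertices is the number of all isolated vertices, which is what the
compressor subtracts. -/
theorem not_adj_of_mem_keptVertices_compl [LinearOrder V] {v : V} (hv : ∀ w, ¬ G.Adj v w) :
    v ∉ keptVertices G k := by
  intro h
  have hN : G.neighborSet v = ∅ := Set.eq_empty_of_forall_notMem hv
  have hlow : v ∈ lowRest G k := ⟨by simp [highDegree, hN], fun u hu => absurd hu (hv u)⟩
  rcases h hlow with ⟨-, x, hx, -⟩ | ⟨-, x, -, hx, -⟩ <;> exact hv x hx

theorem isMarkedEmbedding_keptVertices [LinearOrder V] [Finite V] {e : W → V}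
    (he : Function.Injective e) (hrange : Set.range e = keptVertices G k) :
    IsMarkedEmbedding G (G.comap e) e (lowRest G k)ᶜ where
  inj := he
  adj _ _ := Iff.rfl
  cover := isVertexCover_compl_lowRest
  subset v hv := hrange ▸ fun h => absurd h hv
  unmarked := by
    intro v hv
    rw [hrange] at hv ⊢
    have hlow : v ∈ lowRest G k := by
      by_contra h
      exact hv fun h' => absurd h' h
    by_cases hx : ∃ x, G.Adj v x
    swap
    · exact Or.inl (not_exists.1 hx)
    obtain ⟨x, hx⟩ := hx
    right
    by_cases h1 : (G.neighborSet v).ncard = 1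
    · have hvp : v ∈ pendantNbrs G (lowRest G k)ᶜ x :=
        ⟨fun h => h hlow, hx.symm, by rw [← (Set.toFinite _).cast_ncard_eq, h1]; rfl⟩
      obtain ⟨z, hz, hzp⟩ := exists_kept_pendant hvp
      obtain ⟨b, rfl⟩ : z ∈ Set.range e := hrange.symm ▸ hz
      exact Or.inl ⟨x, hvp, b, hzp⟩
    · right
      constructor
      · have hpos : 0 < (G.neighborSet v).ncard := (Set.ncard_pos (Set.toFinite _)).2 ⟨x, hx⟩
        obtain ⟨a, ha, b, hb, hab⟩ := (Set.one_lt_ncard (Set.toFinite _)).1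
          (show 1 < (G.neighborSet v).ncard by omega)
        exact ⟨a, b, hab, ha, hb⟩
      · intro a b ha hb hab
        set S : Set V := {u | u ∈ lowRest G k ∧ G.Adj u a ∧ G.Adj u b} with hS
        have hdeg : ∀ u ∈ S, 1 < (G.neighborSet u).ncard := fun u hu =>
          (Set.one_lt_ncard (Set.toFinite _)).2 ⟨a, hu.2.1, b, hu.2.2, hab⟩
        -- As `v` is not retained, it is not among the first three of the common neighbours of `a`
        -- and `b` in `lowRest`; the first three are retained.
        have hlt : 2 < {u | u ∈ S ∧ u < v}.ncard := by
          by_contra hle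
          exact hv fun _ => Or.inr ⟨h1, a, b, ha, hb, Or.inr ⟨hab, not_lt.1 hle⟩⟩
        have hScard : 2 < S.ncard :=
          hlt.trans_le (Set.ncard_le_ncard (fun u hu => hu.1) (Set.toFinite _))
        have h3 := ncard_rank_le S 2
        rw [min_eq_right (by omega)] at h3
        have hsub : {u | u ∈ S ∧ {w | w ∈ S ∧ w < u}.ncard ≤ 2} ⊆
            commonNbrs G (lowRest G k)ᶜ a b ∩ keptVertices G k := by
          rintro u ⟨hu, hur⟩
          refine ⟨⟨fun h => h hu.1, hu.2.1.symm, hu.2.2.symm, ?_⟩, fun _ => Or.inr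
            ⟨(hdeg u hu).ne', a, b, hu.2.1, hu.2.2, Or.inr ⟨hab, hur⟩⟩⟩
          rw [← (Set.toFinite _).cast_ncard_eq]
          exact_mod_cast hdeg u hu
        refine le_trans ?_ (Set.encard_le_encard hsub)
        rw [← (Set.toFinite _).cast_ncard_eq, h3]
        rfl

/-- A vertex outside a cover has its whole neighbourhood in the cover. -/
theorem highDegree_subset_of_isVertexCover [Finite V] {C : Set V} (hC : G.IsVertexCover C)
    (hCk : C.ncard ≤ k) : highDegree G k ⊆ C := by
  intro v hv
  by_contra hvC
  have : G.neighborSet v ⊆ C := fun w hw => (hC hw).resolve_left hvC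
  exact absurd ((Set.ncard_le_ncard this (Set.toFinite _)).trans hCk) (not_le.2 hv)

/-- This is the purpose of the marks with `x = y` in `keptVertices`. All neighbours of `x` outside
`lowRest` are retained, and so are the first `k + 1` inside it, none of which is pendant. A cover of
the kernel of size at most `k` that avoids `x` would have to contain all of them. -/
theorem lt_ncard_kept_neighbors [LinearOrder V] [Finite V] {x : V} (hx : x ∈ highDegree G k)
    (hp : ∀ u, u ∉ pendantNbrs G (lowRest G k)ᶜ x) :
    k < (G.neighborSet x ∩ keptVertices G k).ncard := by
  set S : Set V := {u | u ∈ lowRest G k ∧ G.Adj u x ∧ G.Adj u x} with hS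
  have h1 : G.neighborSet x ⊆ S ∪ (G.neighborSet x \ lowRest G k) := by
    intro u hu
    by_cases h : u ∈ lowRest G k
    · exact Or.inl ⟨h, hu.symm, hu.symm⟩
    · exact Or.inr ⟨hu, h⟩
  have h2 := (Set.ncard_le_ncard h1 (Set.toFinite _)).trans (Set.ncard_union_le _ _)
  have h3 := ncard_rank_le S k
  have h4 : {u | u ∈ S ∧ {w | w ∈ S ∧ w < u}.ncard ≤ k} ∪ (G.neighborSet x \ lowRest G k) ⊆
      G.neighborSet x ∩ keptVertices G k := by
    rintro u (⟨hu, hur⟩ | ⟨hu, hul⟩)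
    · refine ⟨hu.2.1.symm, fun _ => Or.inr ⟨fun hu1 => ?_, x, x, hu.2.1, hu.2.1,
        Or.inl ⟨rfl, hur⟩⟩⟩
      refine hp u ⟨fun h => h hu.1, hu.2.1.symm, ?_⟩
      rw [← (Set.toFinite _).cast_ncard_eq, hu1]; rfl
    · exact ⟨hu, fun h => absurd h hul⟩
  have h5 : Disjoint {u | u ∈ S ∧ {w | w ∈ S ∧ w < u}.ncard ≤ k}
      (G.neighborSet x \ lowRest G k) :=
    Set.disjoint_left.2 fun u hu hu' => hu'.2 hu.1.1
  have h6 := Set.ncard_le_ncard h4 (Set.toFinite _)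
  rw [Set.ncard_union_eq h5 (Set.toFinite _) (Set.toFinite _), h3] at h6
  have h7 : k < (G.neighborSet x).ncard := hx
  omega

/-- A minimum cover `C` of the kernel becomes a cover of `G` of no larger size when its pendant
vertices are replaced by their centres. It then contains every vertex of large degree: one with a
retained pendant neighbour because that edge is covered, any other because it has more than `k`
retained neighbours. An edge without an end of large degree has both ends outside `lowRest`, so it
is an edge of the kernel already covered by `C`. -/
theorem vertexCoverNum_comap_keptVertices [LinearOrder V] [Finite V] [Finite W] {e : W → V}
    (he : Function.Injective e) (hrange : Set.range e = keptVertices G k)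
    (hk : G.vertexCoverNum = k) : (G.comap e).vertexCoverNum = k := by
  classical
  have hle : (G.comap e).vertexCoverNum ≤ k :=
    hk ▸ SimpleGraph.IsContained.vertexCoverNum_le_vertexCoverNum
      ⟨⟨⟨e, fun {a b} h => h⟩, he⟩⟩
  refine le_antisymm hle ?_
  obtain ⟨C, hC, hCcover⟩ := (G.comap e).vertexCoverNum_exists
  have hCk : C.ncard ≤ k := by
    have : C.encard ≤ k := hC ▸ hle
    exact ENat.toNat_le_of_le_natCast this
  -- `f` moves pendant vertices of `lowRest` to their centres and fixes all other vertices.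
  let f : V → V := fun v => if h : ∃ x, v ∈ pendantNbrs G (lowRest G k)ᶜ x then h.choose else v
  have hfp : ∀ {v x}, v ∈ pendantNbrs G (lowRest G k)ᶜ x → f v = x := by
    intro v x hv
    have h : ∃ x, v ∈ pendantNbrs G (lowRest G k)ᶜ x := ⟨x, hv⟩
    simp only [f, dif_pos h]
    exact eq_of_mem_pendantNbrs hv h.choose_spec
  have hfid : ∀ {v}, v ∉ lowRest G k → f v = v := by
    intro v hv
    have h : ¬ ∃ x, v ∈ pendantNbrs G (lowRest G k)ᶜ x := fun ⟨x, hx⟩ => hx.1 hv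
    simp only [f, dif_neg h]
  have hhl : ∀ {v}, v ∈ highDegree G k → v ∉ lowRest G k := fun hv h => h.1 hv
  have hkept : ∀ {v}, v ∉ lowRest G k → v ∈ Set.range e := by
    intro v hv
    rw [hrange]
    exact fun h => absurd h hv
  have hedge : ∀ {a b}, G.Adj (e a) (e b) → a ∈ C ∨ b ∈ C := fun {a b} h => hCcover h
  have hhigh : ∀ x ∈ highDegree G k, x ∈ f '' (e '' C) := by
    intro x hx
    by_contra hxC
    obtain ⟨a, rfl⟩ := hkept (hhl hx)
    have ha : a ∉ C := fun h => hxC ⟨e a, ⟨a, h, rfl⟩, hfid (hhl hx)⟩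
    by_cases hp : ∃ u, u ∈ pendantNbrs G (lowRest G k)ᶜ (e a)
    · obtain ⟨u, hu⟩ := hp
      obtain ⟨z, hz, hzp⟩ := exists_kept_pendant hu
      obtain ⟨b, rfl⟩ : z ∈ Set.range e := hrange.symm ▸ hz
      exact hxC ⟨e b, ⟨b, (hedge hzp.2.1).resolve_left ha, rfl⟩, hfp hzp⟩
    · have h1 := lt_ncard_kept_neighbors hx (not_exists.1 hp)
      have h2 : G.neighborSet (e a) ∩ keptVertices G k ⊆ e '' C := by
        rintro u ⟨hu, hu'⟩
        obtain ⟨b, rfl⟩ : u ∈ Set.range e := hrange.symm ▸ hu'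
        exact ⟨b, (hedge hu).resolve_left ha, rfl⟩
      have h3 := Set.ncard_le_ncard h2 (Set.toFinite _)
      rw [Set.ncard_image_of_injective _ he] at h3
      omega
  have hcover : G.IsVertexCover (f '' (e '' C)) := by
    intro u v huv
    by_contra! hno
    have hu : u ∉ highDegree G k := fun h => hno.1 (hhigh u h)
    have hv : v ∉ highDegree G k := fun h => hno.2 (hhigh v h)
    have hul : u ∉ lowRest G k := fun h => hv (h.2 v huv)
    have hvl : v ∉ lowRest G k := fun h => hu (h.2 u huv.symm)
    obtain ⟨a, rfl⟩ := hkept hul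
    obtain ⟨b, rfl⟩ := hkept hvl
    rcases hedge huv with h | h
    · exact hno.1 ⟨e a, ⟨a, h, rfl⟩, hfid hul⟩
    · exact hno.2 ⟨e b, ⟨b, h, rfl⟩, hfid hvl⟩
  calc (k : ℕ∞) = G.vertexCoverNum := hk.symm
    _ ≤ (f '' (e '' C)).encard := hcover.vertexCoverNum_le
    _ ≤ C.encard := (Set.encard_image_le _ _).trans (Set.encard_image_le _ _)
    _ = _ := hC

theorem ncard_biUnion_le_mul {ι α : Type*} [Finite ι] [Finite α] {s : Set ι} {f : ι → Set α}
    {a b : ℕ} (hs : s.ncard ≤ a) (hf : ∀ i ∈ s, (f i).ncard ≤ b) : (⋃ i ∈ s, f i).ncard ≤ a * b := by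
  classical
  have := Fintype.ofFinite ι
  have := Fintype.ofFinite α
  have h1 : (⋃ i ∈ s, f i) = ((s.toFinset.biUnion fun i => (f i).toFinset : Finset α) : Set α) := by
    ext; simp
  rw [h1, Set.ncard_coe_finset]
  refine (Finset.card_biUnion_le_card_mul _ _ b fun i hi => ?_).trans (Nat.mul_le_mul_right _ ?_)
  · rw [← Set.ncard_eq_toFinset_card']
    exact hf i (Set.mem_toFinset.1 hi)
  · rwa [← Set.ncard_eq_toFinset_card']

theorem eq_of_mem_pendantNbrs_of_mem_keptVertices [LinearOrder V] [Finite V] {u v x : V}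
    (hu : u ∈ pendantNbrs G (lowRest G k)ᶜ x) (hv : v ∈ pendantNbrs G (lowRest G k)ᶜ x)
    (huk : u ∈ keptVertices G k) (hvk : v ∈ keptVertices G k) : u = v := by
  have key : ∀ u v, u ∈ pendantNbrs G (lowRest G k)ᶜ x → v ∈ pendantNbrs G (lowRest G k)ᶜ x →
      v ∈ keptVertices G k → ¬ u < v := by
    intro u v hu hv hvk
    have hu1 : (G.neighborSet u).ncard = 1 := by rw [Set.ncard, hu.2.2]; rfl
    have hv1 : (G.neighborSet v).ncard = 1 := by rw [Set.ncard, hv.2.2]; rfl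
    rcases hvk (not_not.1 hv.1) with ⟨-, x', hx', h⟩ | ⟨h, -⟩
    · obtain rfl := eq_of_adj_of_mem_pendantNbrs hv hx'
      exact h u (not_not.1 hu.1) hu1 hu.2.1.symm
    · exact absurd hv1 h
  exact le_antisymm (not_lt.1 (key v u hv hu huk)) (not_lt.1 (key u v hu hv hvk))

/-- With `C` a minimum cover and `B ⊆ C` the vertices of large degree, a vertex outside `lowRest`
lies in `C` or is adjacent to some vertex of `C \ B`, which has degree at most `k`. The marked
vertices are charged to elements or ordered pairs of `B`. The sum is `k + k² + k + k(k + 1) + 3k²`.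
-/
theorem ncard_keptVertices_le [LinearOrder V] [Finite V] (hk : G.vertexCoverNum = k) :
    (keptVertices G k).ncard ≤ 9 * k ^ 2 := by
  obtain ⟨C, hC, hCcover⟩ := G.vertexCoverNum_exists
  have hCk : C.ncard ≤ k := by
    have : C.encard ≤ k := (hC.trans hk).le
    exact ENat.toNat_le_of_le_natCast this
  set B := highDegree G k with hB
  have hBC : B ⊆ C := highDegree_subset_of_isVertexCover hCcover hCk
  have hBk : B.ncard ≤ k := (Set.ncard_le_ncard hBC (Set.toFinite _)).trans hCk
  have hCBk : (C \ B).ncard ≤ k := (Set.ncard_le_ncard Set.sdiff_subset (Set.toFinite _)).trans hCk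
  have hlow : ∀ {v x}, v ∈ lowRest G k → G.Adj v x → x ∈ B := fun h h' => h.2 _ h'
  have hsub : keptVertices G k ⊆ (C ∪ ⋃ c ∈ C \ B, G.neighborSet c) ∪
      ((⋃ x ∈ B, {v | v ∈ pendantNbrs G (lowRest G k)ᶜ x ∧ v ∈ keptVertices G k}) ∪
      ((⋃ x ∈ B, {v | v ∈ {u | u ∈ lowRest G k ∧ G.Adj u x ∧ G.Adj u x} ∧
        {w | w ∈ {u | u ∈ lowRest G k ∧ G.Adj u x ∧ G.Adj u x} ∧ w < v}.ncard ≤ k}) ∪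
      (⋃ p ∈ B ×ˢ B, {v | v ∈ {u | u ∈ lowRest G k ∧ G.Adj u p.1 ∧ G.Adj u p.2} ∧
        {w | w ∈ {u | u ∈ lowRest G k ∧ G.Adj u p.1 ∧ G.Adj u p.2} ∧ w < v}.ncard ≤ 2}))) := by
    intro v hv
    by_cases hvl : v ∈ lowRest G k
    · right
      rcases hv hvl with ⟨h1, x, hx, -⟩ | ⟨-, x, y, hx, hy, ⟨rfl, h2⟩ | ⟨-, h2⟩⟩
      · left
        simp only [Set.mem_iUnion, exists_prop]
        refine ⟨x, hlow hvl hx, ⟨fun h => h hvl, hx.symm, ?_⟩, hv⟩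
        rw [← (Set.toFinite _).cast_ncard_eq, h1]; rfl
      · right; left
        simp only [Set.mem_iUnion, exists_prop]
        exact ⟨x, hlow hvl hx, ⟨hvl, hx, hx⟩, h2⟩
      · right; right
        simp only [Set.mem_iUnion, exists_prop]
        exact ⟨(x, y), ⟨hlow hvl hx, hlow hvl hy⟩, ⟨hvl, hx, hy⟩, h2⟩
    · left
      by_cases hvC : v ∈ C
      · exact Or.inl hvC
      · right
        have hvB : v ∉ B := fun h => hvC (hBC h)
        have : ∃ w, G.Adj v w ∧ w ∉ B := by
          by_contra! h
          exact hvl ⟨hvB, h⟩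
        obtain ⟨w, hvw, hw⟩ := this
        simp only [Set.mem_iUnion, exists_prop]
        exact ⟨w, ⟨(hCcover hvw).resolve_left hvC, hw⟩, hvw.symm⟩
  have h1 : (⋃ c ∈ C \ B, G.neighborSet c).ncard ≤ k * k :=
    ncard_biUnion_le_mul hCBk fun c hc => not_lt.1 hc.2
  have h2 : (⋃ x ∈ B, {v | v ∈ pendantNbrs G (lowRest G k)ᶜ x ∧ v ∈ keptVertices G k}).ncard
      ≤ k * 1 := by
    refine ncard_biUnion_le_mul hBk fun x _ => Set.ncard_le_one_iff_subsingleton.2 ?_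
    exact fun u hu v hv => eq_of_mem_pendantNbrs_of_mem_keptVertices hu.1 hv.1 hu.2 hv.2
  have h3 : (⋃ x ∈ B, {v | v ∈ {u | u ∈ lowRest G k ∧ G.Adj u x ∧ G.Adj u x} ∧
        {w | w ∈ {u | u ∈ lowRest G k ∧ G.Adj u x ∧ G.Adj u x} ∧ w < v}.ncard ≤ k}).ncard
      ≤ k * (k + 1) :=
    ncard_biUnion_le_mul hBk fun x _ => (ncard_rank_le _ k).trans_le (min_le_right _ _)
  have h4 : (⋃ p ∈ B ×ˢ B, {v | v ∈ {u | u ∈ lowRest G k ∧ G.Adj u p.1 ∧ G.Adj u p.2} ∧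
        {w | w ∈ {u | u ∈ lowRest G k ∧ G.Adj u p.1 ∧ G.Adj u p.2} ∧ w < v}.ncard ≤ 2}).ncard
      ≤ (k * k) * 3 :=
    ncard_biUnion_le_mul ((Set.ncard_prod).trans_le (Nat.mul_le_mul hBk hBk))
      fun p _ => (ncard_rank_le _ 2).trans_le (min_le_right _ _)
  have h5 := (Set.ncard_le_ncard hsub (Set.toFinite _)).trans
    ((Set.ncard_union_le _ _).trans (add_le_add ((Set.ncard_union_le _ _).trans
      (add_le_add hCk h1)) ((Set.ncard_union_le _ _).trans (add_le_add h2
        ((Set.ncard_union_le _ _).trans (add_le_add h3 h4))))))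
  refine h5.trans ?_
  have : k ≤ k * k := Nat.le_mul_self k
  nlinarith

/-- The number of colours lies between `0` and the number of vertices, so all negative thresholds
act like `0` and all unattainable ones like the least unattainable one. -/
theorem matchingMulticuts_clamp [Finite V] (l : ℤ) :
    matchingMulticuts G (min (max 0 l) (Nat.card V + 1)) = matchingMulticuts G l := by
  have key : ∀ (f : V → V), min (max 0 l) (Nat.card V + 1) ≤ ((Set.range f).ncard : ℤ) ↔
      l ≤ ((Set.range f).ncard : ℤ) := by
    intro f
    have h : (Set.range f).ncard ≤ Nat.card V := by
      rw [← Set.ncard_univ]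
      exact Set.ncard_le_ncard (Set.subset_univ _) (Set.toFinite _)
    omega
  ext M
  constructor
  · intro h
    obtain ⟨f, hf, hl, rfl⟩ := exists_coloring_of_mem_matchingMulticuts h
    exact colorCut_mem_matchingMulticuts hf ((key f).1 hl)
  · intro h
    obtain ⟨f, hf, hl, rfl⟩ := exists_coloring_of_mem_matchingMulticuts h
    exact colorCut_mem_matchingMulticuts hf ((key f).2 hl)

end Kernel

/-! ## Programs that evaluate terms with bounded sums -/

namespace RAM

theorem written_append (τ₁ τ₂ : List Event) : written (τ₁ ++ τ₂) = written τ₁ ++ written τ₂ :=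
  List.filterMap_append

theorem written_ticks (e : Expr) : written e.ticks = [] := by
  simp [written, Expr.ticks]

@[simp]
theorem written_nil : written [] = [] := rfl

@[simp]
theorem written_cons_tick (τ : List Event) : written (Event.tick :: τ) = written τ := rfl

@[simp]
theorem written_cons_write (n : ℕ) (τ : List Event) :
    written (Event.write n :: τ) = n :: written τ := rfl

theorem yield_notMem_ticks (e : Expr) : Event.yield ∉ e.ticks := by
  simp [Expr.ticks, List.mem_replicate]

/-- `c` runs from `σ` to `σ'` in at most `t` steps, writing `out` and completing no item. -/
def Block (c : Cmd) (σ σ' : Store) (out : List ℕ) (t : ℕ) : Prop :=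
  ∃ τ, Exec c σ τ σ' ∧ written τ = out ∧ Event.yield ∉ τ ∧ τ.length ≤ t

theorem Block.mono {c : Cmd} {σ σ' : Store} {out : List ℕ} {t t' : ℕ} (h : Block c σ σ' out t)
    (ht : t ≤ t') : Block c σ σ' out t' := by
  obtain ⟨τ, h1, h2, h3, h4⟩ := h
  exact ⟨τ, h1, h2, h3, h4.trans ht⟩

theorem Block.assign (i : ℕ) (e : Expr) (σ : Store) :
    Block (Cmd.assign i e) σ ⟨Function.update σ.var i (e.eval σ), σ.arr⟩ [] (e.cost + 1) := by
  refine ⟨_, Exec.assign i e σ, ?_, ?_, ?_⟩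
  · simp [written_append, written_ticks]
  · simp [yield_notMem_ticks]
  · simp [Expr.ticks]

theorem Block.store (a : ℕ) (idx e : Expr) (σ : Store) :
    Block (Cmd.store a idx e) σ ⟨σ.var, Function.update σ.arr a
      (Function.update (σ.arr a) (idx.eval σ) (e.eval σ))⟩ [] (idx.cost + e.cost + 1) := by
  refine ⟨_, Exec.store a idx e σ, ?_, ?_, ?_⟩
  · simp [written_append, written_ticks]
  · simp [yield_notMem_ticks]
  · simp [Expr.ticks]

theorem Block.write (e : Expr) (σ : Store) :
    Block (Cmd.write e) σ σ [e.eval σ] (e.cost + 1) := by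
  refine ⟨_, Exec.write e σ, ?_, ?_, ?_⟩
  · simp [written_append, written_ticks]
  · simp [yield_notMem_ticks]
  · simp [Expr.ticks]

theorem Block.seq {c₁ c₂ : Cmd} {σ₁ σ₂ σ₃ : Store} {o₁ o₂ : List ℕ} {t₁ t₂ : ℕ}
    (h₁ : Block c₁ σ₁ σ₂ o₁ t₁) (h₂ : Block c₂ σ₂ σ₃ o₂ t₂) :
    Block (Cmd.seq c₁ c₂) σ₁ σ₃ (o₁ ++ o₂) (t₁ + t₂) := by
  obtain ⟨τ₁, h1, h2, h3, h4⟩ := h₁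
  obtain ⟨τ₂, h1', h2', h3', h4'⟩ := h₂
  refine ⟨_, Exec.seq h1 h1', ?_, ?_, ?_⟩
  · rw [written_append, h2, h2']
  · simp [h3, h3']
  · simp only [List.length_append]; omega

theorem Block.ite {e : Expr} {c₁ c₂ : Cmd} {σ σ' : Store} {o : List ℕ} {t : ℕ}
    (h₁ : e.eval σ ≠ 0 → Block c₁ σ σ' o t) (h₂ : e.eval σ = 0 → Block c₂ σ σ' o t) :
    Block (Cmd.ite e c₁ c₂) σ σ' o (e.cost + 1 + t) := by
  by_cases he : e.eval σ = 0
  · obtain ⟨τ, h1, h2, h3, h4⟩ := h₂ he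
    refine ⟨_, Exec.ite_false he h1, ?_, ?_, ?_⟩
    · rw [written_append, h2]; simp [written_append, written_ticks]
    · simp [yield_notMem_ticks, h3]
    · simp [Expr.ticks]; omega
  · obtain ⟨τ, h1, h2, h3, h4⟩ := h₁ he
    refine ⟨_, Exec.ite_true he h1, ?_, ?_, ?_⟩
    · rw [written_append, h2]; simp [written_append, written_ticks]
    · simp [yield_notMem_ticks, h3]
    · simp [Expr.ticks]; omega

theorem Block.while_false {e : Expr} {c : Cmd} {σ : Store} (he : e.eval σ = 0) :
    Block (Cmd.while e c) σ σ [] (e.cost + 1) := by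
  refine ⟨_, Exec.while_false he, ?_, ?_, ?_⟩
  · simp [written_append, written_ticks]
  · simp [yield_notMem_ticks]
  · simp [Expr.ticks]

theorem Block.while_true {e : Expr} {c : Cmd} {σ₁ σ₂ σ₃ : Store} {o₁ o₂ : List ℕ} {t₁ t₂ : ℕ}
    (he : e.eval σ₁ ≠ 0) (h₁ : Block c σ₁ σ₂ o₁ t₁) (h₂ : Block (Cmd.while e c) σ₂ σ₃ o₂ t₂) :
    Block (Cmd.while e c) σ₁ σ₃ (o₁ ++ o₂) (e.cost + 1 + t₁ + t₂) := by
  obtain ⟨τ₁, h1, h2, h3, h4⟩ := h₁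
  obtain ⟨τ₂, h1', h2', h3', h4'⟩ := h₂
  refine ⟨_, Exec.while_true he h1 h1', ?_, ?_, ?_⟩
  · simp [written_append, h2, h2', written_ticks]
  · simp [yield_notMem_ticks, h3, h3']
  · simp [Expr.ticks]; omega

/-- The loop over all values of register `i` below the number in the first cell of array `0`. -/
def forCmd (i : ℕ) (c : Cmd) : Cmd :=
  Cmd.seq (Cmd.assign i (Expr.const 0))
    (Cmd.while (Expr.sub (Expr.get 0 (Expr.const 0)) (Expr.var i))
      (Cmd.seq c (Cmd.assign i (Expr.add (Expr.var i) (Expr.const 1)))))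

/-- The rule of the loop invariant `P`. Each round costs `5` for the test and `4` for the increment
besides the body; the `7` is the initialization together with the last test. -/
theorem Block.forCmd {i n t : ℕ} {c : Cmd} {P : ℕ → Store → Prop} {out : ℕ → List ℕ}
    (hP : ∀ j σ, P j σ → σ.var i = j ∧ σ.arr 0 0 = n)
    (hstep : ∀ j < n, ∀ σ, P j σ → ∃ σ', Block c σ σ' (out j) t ∧
      P (j + 1) ⟨Function.update σ'.var i (σ'.var i + 1), σ'.arr⟩)
    {σ : Store} (h0 : P 0 ⟨Function.update σ.var i 0, σ.arr⟩) :
    ∃ σ', Block (forCmd i c) σ σ' ((List.range n).flatMap out) (n * (t + 9) + 7) ∧ P n σ' := by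
  have key : ∀ m j σ, j + m = n → P j σ → ∃ σ',
      Block (Cmd.while (Expr.sub (Expr.get 0 (Expr.const 0)) (Expr.var i))
        (Cmd.seq c (Cmd.assign i (Expr.add (Expr.var i) (Expr.const 1))))) σ σ'
        ((List.range' j m).flatMap out) (m * (t + 9) + 5) ∧ P n σ' := by
    intro m
    induction m with
    | zero =>
      intro j σ hj hPj
      obtain rfl : j = n := by omega
      refine ⟨σ, ?_, hPj⟩
      refine (Block.while_false ?_).mono (by simp [Expr.cost])
      simp [Expr.eval, hP _ _ hPj]
    | succ m ih =>
      intro j σ hj hPj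
      obtain ⟨σ₁, h1, h2⟩ := hstep j (by omega) σ hPj
      obtain ⟨σ₂, h3, h4⟩ := ih (j + 1) _ (by omega) h2
      refine ⟨σ₂, ?_, h4⟩
      have h5 := Block.while_true (e := Expr.sub (Expr.get 0 (Expr.const 0)) (Expr.var i))
        (by simp only [Expr.eval, hP _ _ hPj]; omega)
        (h1.seq (Block.assign i (Expr.add (Expr.var i) (Expr.const 1)) σ₁)) h3
      simp only [List.append_nil] at h5
      rw [List.range'_succ, List.flatMap_cons]
      refine h5.mono ?_
      simp only [Expr.cost]
      ring_nf
      omega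
  obtain ⟨σ', h1, h2⟩ := key n 0 _ (by omega) h0
  refine ⟨σ', ?_, h2⟩
  have h3 := (Block.assign i (Expr.const 0) σ).seq h1
  rw [List.nil_append, ← List.range_eq_range'] at h3
  exact h3.mono (by simp [Expr.cost]; omega)

/-- Terms with bounded sums; `sum i t` is the sum of `t` over all values of the variable `i` below
the number in the first cell of array `0`, and a nonzero condition of `ite` means "true". -/
inductive Term : Type where
  | const (n : ℕ)
  | var (i : ℕ)
  | get (a : ℕ) (t : Term)
  | add (t u : Term)
  | sub (t u : Term)
  | ite (t u v : Term)
  | sum (i : ℕ) (t : Term)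

namespace Term

/-- Value of a term. -/
def eval (A : ℕ → ℕ → ℕ) : Term → (ℕ → ℕ) → ℕ
  | const n, _ => n
  | var i, ρ => ρ i
  | get a t, ρ => A a (t.eval A ρ)
  | add t u, ρ => t.eval A ρ + u.eval A ρ
  | sub t u, ρ => t.eval A ρ - u.eval A ρ
  | ite t u v, ρ => if t.eval A ρ = 0 then v.eval A ρ else u.eval A ρ
  | sum i t, ρ => ∑ j ∈ Finset.range (A 0 0), t.eval A (Function.update ρ i j)

/-- A bound for the variables of a term. -/
def bound : Term → ℕ
  | const _ => 0
  | var i => i + 1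
  | get _ t => t.bound
  | add t u => max t.bound u.bound
  | sub t u => max t.bound u.bound
  | ite t u v => max t.bound (max u.bound v.bound)
  | sum i t => max (i + 1) t.bound

/-- The free variables of the term belong to `S`. -/
def closed : Term → List ℕ → Bool
  | const _, _ => true
  | var i, S => S.contains i
  | get _ t, S => t.closed S
  | add t u, S => t.closed S && u.closed S
  | sub t u, S => t.closed S && u.closed S
  | ite t u v, S => t.closed S && (u.closed S && v.closed S)
  | sum i t, S => t.closed (i :: S)

/-- The term does not refer to array `a`, and `a ≠ 0`. -/
def avoids (a : ℕ) : Term → Bool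
  | const _ => a != 0
  | var _ => a != 0
  | get b t => a != b && t.avoids a
  | add t u => t.avoids a && u.avoids a
  | sub t u => t.avoids a && u.avoids a
  | ite t u v => t.avoids a && (u.avoids a && v.avoids a)
  | sum _ t => t.avoids a

/-- Because of this, whatever earlier programs left in the registers has no influence on a closed
term. The variant with `bound` below serves inside the compiler, where only the registers below the
scratch area are known to be preserved. -/
theorem eval_congr {A : ℕ → ℕ → ℕ} : ∀ {t : Term} {S : List ℕ} {ρ ρ' : ℕ → ℕ},
    t.closed S = true → (∀ i ∈ S, ρ i = ρ' i) → t.eval A ρ = t.eval A ρ'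
  | const n, _, _, _, _, _ => rfl
  | var i, S, ρ, ρ', h, hρ => hρ i (by simpa [closed] using h)
  | get a t, S, ρ, ρ', h, hρ => by
    simp only [eval, eval_congr (t := t) h hρ]
  | add t u, S, ρ, ρ', h, hρ => by
    simp only [closed, Bool.and_eq_true] at h
    simp only [eval, eval_congr h.1 hρ, eval_congr h.2 hρ]
  | sub t u, S, ρ, ρ', h, hρ => by
    simp only [closed, Bool.and_eq_true] at h
    simp only [eval, eval_congr h.1 hρ, eval_congr h.2 hρ]
  | ite t u v, S, ρ, ρ', h, hρ => by
    simp only [closed, Bool.and_eq_true] at h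
    simp only [eval, eval_congr h.1 hρ, eval_congr h.2.1 hρ, eval_congr h.2.2 hρ]
  | sum i t, S, ρ, ρ', h, hρ => by
    simp only [eval]
    refine Finset.sum_congr rfl fun j _ => eval_congr (S := i :: S) h fun k hk => ?_
    by_cases hki : k = i
    · subst hki; simp
    · simp only [Function.update_of_ne hki]
      exact hρ k ((List.mem_cons.1 hk).resolve_left hki)

theorem eval_congr_bound {A : ℕ → ℕ → ℕ} : ∀ {t : Term} {ρ ρ' : ℕ → ℕ},
    (∀ i < t.bound, ρ i = ρ' i) → t.eval A ρ = t.eval A ρ'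
  | const n, _, _, _ => rfl
  | var i, ρ, ρ', hρ => hρ i (by simp [bound])
  | get a t, ρ, ρ', hρ => by
    simp only [eval, eval_congr_bound (t := t) hρ]
  | add t u, ρ, ρ', hρ => by
    simp only [bound, lt_max_iff] at hρ
    simp only [eval, eval_congr_bound fun i hi => hρ i (Or.inl hi),
      eval_congr_bound fun i hi => hρ i (Or.inr hi)]
  | sub t u, ρ, ρ', hρ => by
    simp only [bound, lt_max_iff] at hρ
    simp only [eval, eval_congr_bound fun i hi => hρ i (Or.inl hi),
      eval_congr_bound fun i hi => hρ i (Or.inr hi)]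
  | ite t u v, ρ, ρ', hρ => by
    simp only [bound, lt_max_iff] at hρ
    simp only [eval, eval_congr_bound fun i hi => hρ i (Or.inl hi),
      eval_congr_bound fun i hi => hρ i (Or.inr (Or.inl hi)),
      eval_congr_bound fun i hi => hρ i (Or.inr (Or.inr hi))]
  | sum i t, ρ, ρ', hρ => by
    simp only [eval]
    refine Finset.sum_congr rfl fun j _ => eval_congr_bound fun k hk => ?_
    by_cases hki : k = i
    · subst hki; simp
    · simp only [Function.update_of_ne hki]
      exact hρ k (by simp [bound, hk])

theorem ne_zero_of_avoids {a : ℕ} : ∀ {t : Term}, t.avoids a = true → a ≠ 0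
  | const n, h => by simpa [avoids] using h
  | var i, h => by simpa [avoids] using h
  | get b t, h => by
    simp only [avoids, Bool.and_eq_true] at h
    exact ne_zero_of_avoids h.2
  | add t u, h => by
    simp only [avoids, Bool.and_eq_true] at h
    exact ne_zero_of_avoids h.1
  | sub t u, h => by
    simp only [avoids, Bool.and_eq_true] at h
    exact ne_zero_of_avoids h.1
  | ite t u v, h => by
    simp only [avoids, Bool.and_eq_true] at h
    exact ne_zero_of_avoids h.1
  | sum i t, h => ne_zero_of_avoids (t := t) h

/-- Array `0` is excluded even if no `get` reads it, since every bounded sum takes its range from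
its first cell. -/
theorem eval_update_of_avoids {A : ℕ → ℕ → ℕ} {a : ℕ} {f : ℕ → ℕ} : ∀ {t : Term} {ρ : ℕ → ℕ},
    t.avoids a = true → t.eval (Function.update A a f) ρ = t.eval A ρ
  | const n, _, _ => rfl
  | var i, _, _ => rfl
  | get b t, ρ, h => by
    simp only [avoids, Bool.and_eq_true, bne_iff_ne] at h
    simp only [eval, eval_update_of_avoids h.2, Function.update_of_ne h.1.symm]
  | add t u, ρ, h => by
    simp only [avoids, Bool.and_eq_true] at h
    simp only [eval, eval_update_of_avoids h.1, eval_update_of_avoids h.2]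
  | sub t u, ρ, h => by
    simp only [avoids, Bool.and_eq_true] at h
    simp only [eval, eval_update_of_avoids h.1, eval_update_of_avoids h.2]
  | ite t u v, ρ, h => by
    simp only [avoids, Bool.and_eq_true] at h
    simp only [eval, eval_update_of_avoids h.1, eval_update_of_avoids h.2.1,
      eval_update_of_avoids h.2.2]
  | sum i t, ρ, h => by
    simp only [eval, Function.update_of_ne (ne_zero_of_avoids h).symm]
    exact Finset.sum_congr rfl fun j _ => eval_update_of_avoids (t := t) h

/-- A program that stores the value of the term in register `d` and leaves the registers below `d`
unchanged, where `d` is at least `t.bound`. -/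
def compile : Term → ℕ → Cmd
  | const n, d => Cmd.assign d (Expr.const n)
  | var i, d => Cmd.assign d (Expr.var i)
  | get a t, d => Cmd.seq (t.compile d) (Cmd.assign d (Expr.get a (Expr.var d)))
  | add t u, d => Cmd.seq (t.compile d) (Cmd.seq (u.compile (d + 1))
      (Cmd.assign d (Expr.add (Expr.var d) (Expr.var (d + 1)))))
  | sub t u, d => Cmd.seq (t.compile d) (Cmd.seq (u.compile (d + 1))
      (Cmd.assign d (Expr.sub (Expr.var d) (Expr.var (d + 1)))))
  | ite t u v, d => Cmd.seq (t.compile d) (Cmd.ite (Expr.var d) (u.compile d) (v.compile d))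
  | sum i t, d => Cmd.seq (Cmd.assign (d + 1) (Expr.var i)) (Cmd.seq (Cmd.assign d (Expr.const 0))
      (Cmd.seq (forCmd i (Cmd.seq (t.compile (d + 2))
        (Cmd.assign d (Expr.add (Expr.var d) (Expr.var (d + 2))))))
        (Cmd.assign i (Expr.var (d + 1)))))

open Polynomial in
/-- A bound for the running time of `t.compile d` in terms of the number in the first cell of
array `0`. -/
noncomputable def time : Term → ℕ[X]
  | const _ => 2
  | var _ => 2
  | get _ t => t.time + 3
  | add t u => t.time + u.time + 4
  | sub t u => t.time + u.time + 4
  | ite t u v => t.time + u.time + v.time + 2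
  | sum _ t => X * (t.time + 13) + 13

/-- The registers from `d` on act as a stack: the result goes to `d`, and a second operand is
computed with its own result in `d + 1`, which leaves `d` intact. -/
theorem block_compile : ∀ (t : Term) {d : ℕ} (_ : t.bound ≤ d) (σ : Store),
    ∃ ρ, Block (t.compile d) σ ⟨ρ, σ.arr⟩ [] (t.time.eval (σ.arr 0 0)) ∧
      (∀ j < d, ρ j = σ.var j) ∧ ρ d = t.eval σ.arr σ.var
  | const n, d, _, σ => by
    refine ⟨_, (Block.assign d (Expr.const n) σ).mono (by simp [Expr.cost, time]), ?_, ?_⟩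
    · intro j hj; simp [hj.ne]
    · simp [Expr.eval, eval]
  | var i, d, _, σ => by
    refine ⟨_, (Block.assign d (Expr.var i) σ).mono (by simp [Expr.cost, time]), ?_, ?_⟩
    · intro j hj; simp [hj.ne]
    · simp [Expr.eval, eval]
  | get a t, d, hd, σ => by
    obtain ⟨ρ, h1, h2, h3⟩ := block_compile t (d := d) hd σ
    refine ⟨_, (h1.seq (Block.assign d (Expr.get a (Expr.var d)) _)).mono
      (by simp [Expr.cost, time]), ?_, ?_⟩
    · intro j hj; simp [hj.ne, h2 j hj]
    · simp [Expr.eval, eval, h3]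
  | add t u, d, hd, σ => by
    simp only [bound, max_le_iff] at hd
    obtain ⟨ρ, h1, h2, h3⟩ := block_compile t hd.1 σ
    obtain ⟨ρ', h1', h2', h3'⟩ := block_compile u (hd.2.trans d.le_succ) ⟨ρ, σ.arr⟩
    refine ⟨_, (h1.seq (h1'.seq (Block.assign d (Expr.add (Expr.var d) (Expr.var (d + 1)))
      _))).mono (by simp [Expr.cost, time]; omega), ?_, ?_⟩
    · intro j hj; simp [hj.ne, h2' j (by omega), h2 j hj]
    · simp only [Expr.eval, eval, Function.update_self, h3', h2' d (by omega), h3]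
      rw [eval_congr_bound fun i hi => h2 i (hi.trans_le hd.2)]
  | sub t u, d, hd, σ => by
    simp only [bound, max_le_iff] at hd
    obtain ⟨ρ, h1, h2, h3⟩ := block_compile t hd.1 σ
    obtain ⟨ρ', h1', h2', h3'⟩ := block_compile u (hd.2.trans d.le_succ) ⟨ρ, σ.arr⟩
    refine ⟨_, (h1.seq (h1'.seq (Block.assign d (Expr.sub (Expr.var d) (Expr.var (d + 1)))
      _))).mono (by simp [Expr.cost, time]; omega), ?_, ?_⟩
    · intro j hj; simp [hj.ne, h2' j (by omega), h2 j hj]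
    · simp only [Expr.eval, eval, Function.update_self, h3', h2' d (by omega), h3]
      rw [eval_congr_bound fun i hi => h2 i (hi.trans_le hd.2)]
  | ite t u v, d, hd, σ => by
    simp only [bound, max_le_iff] at hd
    obtain ⟨ρ, h1, h2, h3⟩ := block_compile t hd.1 σ
    by_cases ht : t.eval σ.arr σ.var = 0
    · obtain ⟨ρ', h1', h2', h3'⟩ := block_compile v hd.2.2 ⟨ρ, σ.arr⟩
      refine ⟨ρ', (h1.seq (Block.ite (e := Expr.var d) (fun h => absurd (h3.trans ht) h)
        fun _ => h1')).mono
        (by simp [Expr.cost, time]; omega), ?_, ?_⟩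
      · exact fun j hj => (h2' j hj).trans (h2 j hj)
      · rw [h3', eval, if_pos ht]
        exact eval_congr_bound fun i hi => h2 i (hi.trans_le hd.2.2)
    · obtain ⟨ρ', h1', h2', h3'⟩ := block_compile u hd.2.1 ⟨ρ, σ.arr⟩
      refine ⟨ρ', (h1.seq (Block.ite (e := Expr.var d) (fun _ => h1')
        fun h => absurd (h3.symm.trans h) ht)).mono
        (by simp [Expr.cost, time]; omega), ?_, ?_⟩
      · exact fun j hj => (h2' j hj).trans (h2 j hj)
      · rw [h3', eval, if_neg ht]
        exact eval_congr_bound fun i hi => h2 i (hi.trans_le hd.2.1)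
  | sum i t, d, hd, σ => by
    simp only [bound, max_le_iff] at hd
    have hid : i < d := hd.1
    -- Register `d` accumulates the sum, `d + 1` saves the outer value of the summation variable, to
    -- be restored afterwards, and `d + 2` receives the summand.
    have loop := Block.forCmd (i := i) (n := σ.arr 0 0) (t := t.time.eval (σ.arr 0 0) + 4)
      (c := Cmd.seq (t.compile (d + 2)) (Cmd.assign d (Expr.add (Expr.var d) (Expr.var (d + 2)))))
      (P := fun j σ' => σ'.var i = j ∧ σ'.arr = σ.arr ∧
        σ'.var d = ∑ m ∈ Finset.range j, t.eval σ.arr (Function.update σ.var i m) ∧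
        σ'.var (d + 1) = σ.var i ∧ ∀ m < d, m ≠ i → σ'.var m = σ.var m)
      (out := fun _ => []) (fun j σ' h => ⟨h.1, by rw [h.2.1]⟩)
      (by
        rintro j hj ⟨ρ, A⟩ ⟨h1, h2, h3, h4, h5⟩
        simp only at h1 h2 h3 h4 h5
        subst h2
        obtain ⟨ρ', g1, g2, g3⟩ := block_compile t (d := d + 2) (by omega) ⟨ρ, σ.arr⟩
        refine ⟨_, (g1.seq (Block.assign d (Expr.add (Expr.var d) (Expr.var (d + 2))) _)).mono
          (by simp [Expr.cost]), ?_, rfl, ?_, ?_, ?_⟩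
        · simp [hid.ne, g2 i (by omega), h1]
        · simp only [ne_eq, hid.ne', not_false_eq_true, Function.update_of_ne, Function.update_self,
            Expr.eval, g2 d (by omega), g3, h3, Finset.sum_range_succ]
          rw [eval_congr_bound (t := t) (ρ' := Function.update σ.var i j)]
          intro m hm
          by_cases hmi : m = i
          · subst hmi; simp [h1]
          · simp only [Function.update_of_ne hmi]
            exact h5 m (by omega) hmi
        · simp [show d + 1 ≠ i by omega, g2 (d + 1) (by omega), h4]
        · intro m hm hmi
          simp [hmi, hm.ne, g2 m (by omega), h5 m hm hmi])
      (σ := ⟨Function.update (Function.update σ.var (d + 1) (σ.var i)) d 0, σ.arr⟩)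
      ⟨by simp, rfl, by simp [hid.ne'], by simp [show d + 1 ≠ i by omega], fun m hm hmi => by
        simp [hmi, hm.ne, show m ≠ d + 1 by omega]⟩
    obtain ⟨⟨ρ, A⟩, g1, g2, g3, g4, g5, g6⟩ := loop
    simp only at g2 g3 g4 g5 g6
    subst g3
    have h1 := (Block.assign (d + 1) (Expr.var i) σ).seq ((Block.assign d (Expr.const 0) _).seq
      (g1.seq (Block.assign i (Expr.var (d + 1)) _)))
    have h2 : (List.range (σ.arr 0 0)).flatMap (fun _ => ([] : List ℕ)) = [] := by simp
    rw [h2] at h1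
    refine ⟨Function.update ρ i (ρ (d + 1)), h1.mono ?_, ?_, ?_⟩
    · simp [Expr.cost, time]
      ring_nf
      omega
    · intro j hj
      by_cases hji : j = i
      · subst hji; simp [g5]
      · simp [hji, g6 j hj hji]
    · simp [hid.ne', g4, eval]

end Term

end RAM

/-! ### Tables, matrices and enumeration with bounded delay -/

namespace RAM

/-- With the arrays `A` and any registers, `c` runs in at most `t` steps, writing `out`, completing
no item, and ending with the arrays `A'`. -/
def Runs (c : Cmd) (A A' : ℕ → ℕ → ℕ) (out : List ℕ) (t : ℕ) : Prop :=
  ∀ ρ, ∃ ρ', Block c ⟨ρ, A⟩ ⟨ρ', A'⟩ out t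

theorem Runs.seq {c₁ c₂ : Cmd} {A₁ A₂ A₃ : ℕ → ℕ → ℕ} {o₁ o₂ : List ℕ} {t₁ t₂ : ℕ}
    (h₁ : Runs c₁ A₁ A₂ o₁ t₁) (h₂ : Runs c₂ A₂ A₃ o₂ t₂) :
    Runs (Cmd.seq c₁ c₂) A₁ A₃ (o₁ ++ o₂) (t₁ + t₂) := by
  intro ρ
  obtain ⟨ρ₁, h1⟩ := h₁ ρ
  obtain ⟨ρ₂, h2⟩ := h₂ ρ₁
  exact ⟨ρ₂, h1.seq h2⟩

theorem Runs.mono {c : Cmd} {A A' : ℕ → ℕ → ℕ} {o : List ℕ} {t t' : ℕ} (h : Runs c A A' o t)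
    (ht : t ≤ t') : Runs c A A' o t' := by
  intro ρ
  obtain ⟨ρ', h'⟩ := h ρ
  exact ⟨ρ', h'.mono ht⟩

/-- The assignment of `j` to variable `0`. -/
def env₁ (j : ℕ) : ℕ → ℕ := Function.update 0 0 j

/-- The assignment of `i` to variable `0` and of `j` to variable `1`. -/
def env₂ (i j : ℕ) : ℕ → ℕ := Function.update (env₁ i) 1 j

@[simp]
theorem env₁_zero (j : ℕ) : env₁ j 0 = j := rfl

@[simp]
theorem env₂_zero (i j : ℕ) : env₂ i j 0 = i := rfl

@[simp]
theorem env₂_one (i j : ℕ) : env₂ i j 1 = j := rfl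

/-- Store the values of the term at `0, 1, …` in array `a`. -/
def tab (a : ℕ) (t : Term) : Cmd :=
  forCmd 0 (Cmd.seq (t.compile (max 1 t.bound))
    (Cmd.store a (Expr.var 0) (Expr.var (max 1 t.bound))))

/-- The arrays after `tab a t`. -/
def tabArr (a : ℕ) (t : Term) (A : ℕ → ℕ → ℕ) : ℕ → ℕ → ℕ :=
  Function.update A a fun j => if j < A 0 0 then t.eval A (env₁ j) else A a j

open Polynomial in
/-- A bound for the running time of `tab a t`. -/
noncomputable def tabTime (t : Term) : ℕ[X] := X * (t.time + 12) + 7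

/-- As the term does not read array `a`, the entries already written do not disturb the later ones,
and the table can be described in terms of the initial arrays. -/
theorem runs_tab {a : ℕ} {t : Term} (ha : t.avoids a = true) (hc : t.closed [0] = true)
    (A : ℕ → ℕ → ℕ) : Runs (tab a t) A (tabArr a t A) [] ((tabTime t).eval (A 0 0)) := by
  intro ρ
  have ha0 : a ≠ 0 := Term.ne_zero_of_avoids ha
  have loop := Block.forCmd (i := 0) (n := A 0 0) (t := t.time.eval (A 0 0) + 3)
    (c := Cmd.seq (t.compile (max 1 t.bound))
      (Cmd.store a (Expr.var 0) (Expr.var (max 1 t.bound))))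
    (P := fun j σ => σ.var 0 = j ∧
      σ.arr = Function.update A a fun m => if m < j then t.eval A (env₁ m) else A a m)
    (out := fun _ => []) (fun j σ h => ⟨h.1, by rw [h.2, Function.update_of_ne ha0.symm]⟩)
    (by
      rintro j hj ⟨ρ, B⟩ ⟨h1, h2⟩
      simp only at h1 h2
      obtain ⟨ρ', g1, g2, g3⟩ := Term.block_compile t (le_max_right 1 t.bound) ⟨ρ, B⟩
      have hB : B 0 0 = A 0 0 := by rw [h2, Function.update_of_ne ha0.symm]
      simp only [hB] at g1
      refine ⟨_, (g1.seq (Block.store a (Expr.var 0) (Expr.var (max 1 t.bound)) _)).mono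
        (by simp [Expr.cost]), ?_, ?_⟩
      · simp [g2 0 (by omega), h1]
      · simp only [Expr.eval, g2 0 (by omega), g3, h1]
        rw [h2, Function.update_idem, Function.update_self, Term.eval_update_of_avoids ha,
          Term.eval_congr (ρ' := env₁ j) hc (by simp [h1])]
        congr 1
        funext m
        by_cases hm : m = j
        · subst hm; simp
        · rw [Function.update_of_ne hm]
          have : m < j + 1 ↔ m < j := by omega
          simp only [this])
    (σ := ⟨ρ, A⟩) ⟨by simp, by simp⟩
  obtain ⟨⟨ρ', A'⟩, g1, g2, g3⟩ := loop
  simp only at g2 g3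
  subst g3
  refine ⟨ρ', ?_⟩
  have h2 : (List.range (A 0 0)).flatMap (fun _ => ([] : List ℕ)) = [] := by simp
  rw [h2] at g1
  exact g1.mono (by simp [tabTime, add_assoc])

/-- Store the value of the term in the first cell of array `a`. -/
def put (a : ℕ) (t : Term) : Cmd :=
  Cmd.seq (t.compile t.bound) (Cmd.store a (Expr.const 0) (Expr.var t.bound))

theorem runs_put {a : ℕ} {t : Term} (hc : t.closed [] = true) (A : ℕ → ℕ → ℕ) :
    Runs (put a t) A (Function.update A a (Function.update (A a) 0 (t.eval A 0))) []
      ((t.time + 3).eval (A 0 0)) := by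
  intro ρ
  obtain ⟨ρ', g1, g2, g3⟩ := Term.block_compile t le_rfl ⟨ρ, A⟩
  refine ⟨ρ', ?_⟩
  have h := g1.seq (Block.store a (Expr.const 0) (Expr.var t.bound) _)
  simp only [Expr.eval, g3, Term.eval_congr (ρ := ρ) (ρ' := 0) hc (by simp)] at h
  exact h.mono (by simp [Expr.cost])

/-- Write the value of the term. -/
def writeTerm (t : Term) : Cmd :=
  Cmd.seq (t.compile t.bound) (Cmd.write (Expr.var t.bound))

theorem runs_writeTerm {t : Term} (hc : t.closed [] = true) (A : ℕ → ℕ → ℕ) :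
    Runs (writeTerm t) A A [t.eval A 0] ((t.time + 2).eval (A 0 0)) := by
  intro ρ
  obtain ⟨ρ', g1, g2, g3⟩ := Term.block_compile t le_rfl ⟨ρ, A⟩
  refine ⟨ρ', ?_⟩
  have h := g1.seq (Block.write (Expr.var t.bound) _)
  simp only [Expr.eval, g3, Term.eval_congr (ρ := ρ) (ρ' := 0) hc (by simp)] at h
  exact h.mono (by simp [Expr.cost])

/-- Write the values of `t` at all pairs at which `g` is nonzero. -/
def writeMatrix (g t : Term) : Cmd :=
  forCmd 0 (forCmd 1 (Cmd.seq (g.compile (max 2 (max g.bound t.bound)))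
    (Cmd.ite (Expr.var (max 2 (max g.bound t.bound)))
      (Cmd.seq (t.compile (max 2 (max g.bound t.bound)))
        (Cmd.write (Expr.var (max 2 (max g.bound t.bound)))))
      (Cmd.assign (max 2 (max g.bound t.bound)) (Expr.const 0)))))

open Polynomial in
/-- A bound for the running time of `writeMatrix g t`. -/
noncomputable def writeMatrixTime (g t : Term) : ℕ[X] :=
  X * (X * (g.time + t.time + 13) + 16) + 7

theorem runs_writeMatrix {g t : Term} (hg : g.closed [0, 1] = true) (ht : t.closed [0, 1] = true)
    (A : ℕ → ℕ → ℕ) : Runs (writeMatrix g t) A A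
      ((List.range (A 0 0)).flatMap fun i => (List.range (A 0 0)).flatMap fun j =>
        if g.eval A (env₂ i j) = 0 then [] else [t.eval A (env₂ i j)])
      ((writeMatrixTime g t).eval (A 0 0)) := by
  intro ρ
  have loop := Block.forCmd (i := 0) (n := A 0 0)
    (t := A 0 0 * (g.time.eval (A 0 0) + t.time.eval (A 0 0) + 4 + 9) + 7)
    (c := forCmd 1 (Cmd.seq (g.compile (max 2 (max g.bound t.bound)))
      (Cmd.ite (Expr.var (max 2 (max g.bound t.bound)))
        (Cmd.seq (t.compile (max 2 (max g.bound t.bound)))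
          (Cmd.write (Expr.var (max 2 (max g.bound t.bound)))))
        (Cmd.assign (max 2 (max g.bound t.bound)) (Expr.const 0)))))
    (P := fun i σ => σ.var 0 = i ∧ σ.arr = A)
    (out := fun i => (List.range (A 0 0)).flatMap fun j =>
        if g.eval A (env₂ i j) = 0 then [] else [t.eval A (env₂ i j)])
    (fun j σ h => ⟨h.1, by rw [h.2]⟩)
    (by
      rintro i hi ⟨ρ, B⟩ ⟨h1, h2⟩
      simp only at h1 h2
      subst h2
      have loop := Block.forCmd (i := 1) (n := B 0 0)
        (t := g.time.eval (B 0 0) + t.time.eval (B 0 0) + 4)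
        (c := Cmd.seq (g.compile (max 2 (max g.bound t.bound)))
          (Cmd.ite (Expr.var (max 2 (max g.bound t.bound)))
            (Cmd.seq (t.compile (max 2 (max g.bound t.bound)))
              (Cmd.write (Expr.var (max 2 (max g.bound t.bound)))))
            (Cmd.assign (max 2 (max g.bound t.bound)) (Expr.const 0))))
        (P := fun j σ => σ.var 1 = j ∧ σ.var 0 = i ∧ σ.arr = B)
        (out := fun j => if g.eval B (env₂ i j) = 0 then [] else [t.eval B (env₂ i j)])
        (fun j σ h => ⟨h.1, by rw [h.2.2]⟩)
        (by
          rintro j hj ⟨ρ, B⟩ ⟨h1, h2, h3⟩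
          simp only at h1 h2 h3
          subst h3
          set D := max 2 (max g.bound t.bound) with hD
          obtain ⟨ρ', g1, g2, g3⟩ := Term.block_compile g (d := D) (by omega) ⟨ρ, B⟩
          simp only at g1 g3 g2
          rw [Term.eval_congr (ρ' := env₂ i j) hg (by simp [h1, h2])] at g3
          by_cases h0 : g.eval B (env₂ i j) = 0
          · rw [if_pos h0]
            refine ⟨_, (g1.seq (Block.ite (e := Expr.var D) (fun h => absurd (g3.trans h0) h)
              fun _ => Block.assign D (Expr.const 0) _)).mono (by simp [Expr.cost]),
              ?_, ?_, rfl⟩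
            · simp [show 1 ≠ D by omega, g2 1 (by omega), h1]
            · simp [show 0 ≠ D by omega, g2 0 (by omega), h2]
          · rw [if_neg h0]
            obtain ⟨ρ'', g1', g2', g3'⟩ := Term.block_compile t (d := D) (by omega) ⟨ρ', B⟩
            simp only at g1' g3' g2'
            rw [Term.eval_congr (ρ' := env₂ i j) ht
              (by simp [g2 0 (by omega), g2 1 (by omega), h1, h2])] at g3'
            have hw := g1.seq (Block.ite (e := Expr.var D) (c₂ := Cmd.assign D (Expr.const 0))
              (fun _ => g1'.seq (Block.write (Expr.var D) _))
              fun h => absurd (g3.symm.trans h) h0)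
            simp only [Expr.eval, g3', List.nil_append] at hw
            refine ⟨_, hw.mono (by simp [Expr.cost]; omega), ?_, ?_, rfl⟩
            · simp [g2' 1 (by omega), g2 1 (by omega), h1]
            · simp [g2' 0 (by omega), g2 0 (by omega), h2])
        (σ := ⟨ρ, B⟩) ⟨by simp, by simp [h1], rfl⟩
      obtain ⟨⟨ρ', A'⟩, g1, g2, g3, g4⟩ := loop
      simp only at g2 g3 g4
      subst g4
      exact ⟨_, g1, by simp [g3], rfl⟩)
    (σ := ⟨ρ, A⟩) ⟨by simp, rfl⟩
  obtain ⟨⟨ρ', A'⟩, g1, g2, g3⟩ := loop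
  simp only at g2 g3
  subst g3
  exact ⟨ρ', g1.mono (by simp [writeMatrixTime, add_assoc])⟩

/-! ### Enumeration -/

/-- The run `τ` completes exactly the items `items`, with delay at most `d`, except that at most
`r` steps precede the completion of the first item (or the end, if there is none). -/
inductive Yields (d : ℕ) : ℕ → List Event → List (List ℕ) → Prop where
  | nil {r : ℕ} {τ : List Event} : Event.yield ∉ τ → written τ = [] → τ.length ≤ r →
      Yields d r τ []
  | cons {r : ℕ} {w τ : List Event} {items : List (List ℕ)} : Event.yield ∉ w → w.length ≤ r →
      Yields d d τ items → Yields d r (w ++ Event.yield :: τ) (written w :: items)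

theorem Yields.append_left {d r r' : ℕ} {τ w : List Event} {items : List (List ℕ)}
    (h : Yields d r τ items) (hw : Event.yield ∉ w) (hw' : written w = [])
    (hr : w.length + r ≤ r') : Yields d r' (w ++ τ) items := by
  cases h with
  | nil h1 h2 h3 =>
    refine Yields.nil (by simp [hw, h1]) (by rw [written_append, hw', h2]; rfl) ?_
    rw [List.length_append]; omega
  | @cons _ v τ items h1 h2 h3 =>
    rw [← List.append_assoc, ← List.nil_append (written v), ← hw', ← written_append]
    refine Yields.cons (by simp [hw, h1]) ?_ h3
    rw [List.length_append]; omega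

theorem Yields.exists_blocks {d r : ℕ} {τ : List Event} {items : List (List ℕ)}
    (h : Yields d r τ items) : r ≤ d → ∃ (blocks : List (List Event)) (last : List Event),
      τ = (blocks.map fun b => b ++ [Event.yield]).flatten ++ last ∧
      (∀ b ∈ blocks, Event.yield ∉ b ∧ b.length ≤ d) ∧
      Event.yield ∉ last ∧ last.length ≤ d ∧ written last = [] ∧ blocks.map written = items := by
  induction h with
  | @nil r τ h1 h2 h3 => exact fun hr => ⟨[], τ, rfl, by simp, h1, h3.trans hr, h2, rfl⟩
  | @cons r w τ items h1 h2 h3 ih =>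
    intro hr
    obtain ⟨blocks, last, rfl, g2, g3, g4, g5, rfl⟩ := ih le_rfl
    refine ⟨w :: blocks, last, by simp, ?_, g3, g4, g5, rfl⟩
    rintro b hb
    rcases List.mem_cons.1 hb with rfl | hb
    · exact ⟨h1, h2.trans hr⟩
    · exact g2 b hb

/-- A program that, after a preparation, writes an item, completes it and advances to the next
state, and repeats this as long as the first cell of array `f` is nonzero. -/
def enumerate (init item next : Cmd) (f : ℕ) : Cmd :=
  Cmd.seq init (Cmd.seq (Cmd.seq item (Cmd.seq Cmd.yield next))
    (Cmd.while (Expr.get f (Expr.const 0)) (Cmd.seq item (Cmd.seq Cmd.yield next))))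

/-- Between two completions there is one advance, one test of the flag (three steps) and the writing
of one item. The first item is written without a test, which requires `0 < N`. -/
theorem enumeratesWithDelay_enumerate {init item next : Cmd} {f N t₀ t₁ t₂ d : ℕ}
    {args : List (List ℕ)} {state : ℕ → ℕ → ℕ → ℕ} {out : ℕ → List ℕ}
    (hinit : Runs init (initStore args).arr (state 0) [] t₀)
    (hitem : ∀ i < N, Runs item (state i) (state i) (out i) t₁)
    (hnext : ∀ i < N, Runs next (state i) (state (i + 1)) [] t₂)
    (hflag : ∀ i < N, state (i + 1) f 0 ≠ 0 ↔ i + 1 < N) (hN : 0 < N)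
    (hd : t₀ + t₁ + t₂ + 3 ≤ d) :
    EnumeratesWithDelay (enumerate init item next f) args ((List.range N).map out) d := by
  have key : ∀ m i, i + (m + 1) = N → ∀ ρ, ∃ τ τ' σ₁ σ₂,
      Exec (Cmd.seq item (Cmd.seq Cmd.yield next)) ⟨ρ, state i⟩ τ σ₁ ∧
      Exec (Cmd.while (Expr.get f (Expr.const 0)) (Cmd.seq item (Cmd.seq Cmd.yield next)))
        σ₁ τ' σ₂ ∧
      Yields d t₁ (τ ++ τ') ((List.range' i (m + 1)).map out) := by
    intro m
    induction m with
    | zero =>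
      intro i hi ρ
      obtain ⟨ρ₁, τ₁, a1, a2, a3, a4⟩ := hitem i (by omega) ρ
      obtain ⟨ρ₂, τ₂, b1, b2, b3, b4⟩ := hnext i (by omega) ρ₁
      have hf : (Expr.get f (Expr.const 0)).eval ⟨ρ₂, state (i + 1)⟩ = 0 := by
        by_contra h
        exact absurd ((hflag i (by omega)).1 h) (by omega)
      obtain ⟨τ₃, c1, c2, c3, c4⟩ := Block.while_false
        (c := Cmd.seq item (Cmd.seq Cmd.yield next)) hf
      refine ⟨_, _, _, _, Exec.seq a1 (Exec.seq (Exec.yield _) b1), c1, ?_⟩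
      rw [List.append_assoc, List.append_assoc, List.singleton_append]
      simp only [zero_add, List.range'_one, List.map_cons, List.map_nil]
      rw [← a2]
      refine Yields.cons a3 a4 (Yields.nil (by simp [b3, c3]) ?_ ?_)
      · rw [written_append, b2, c2]; rfl
      · simp only [Expr.cost] at c4
        rw [List.length_append]; omega
    | succ m ih =>
      intro i hi ρ
      obtain ⟨ρ₁, τ₁, a1, a2, a3, a4⟩ := hitem i (by omega) ρ
      obtain ⟨ρ₂, τ₂, b1, b2, b3, b4⟩ := hnext i (by omega) ρ₁
      have hf : (Expr.get f (Expr.const 0)).eval ⟨ρ₂, state (i + 1)⟩ ≠ 0 :=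
        (hflag i (by omega)).2 (by omega)
      obtain ⟨τ, τ', σ₁, σ₂, d1, d2, d3⟩ := ih (i + 1) (by omega) ρ₂
      refine ⟨_, _, _, _, Exec.seq a1 (Exec.seq (Exec.yield _) b1), Exec.while_true hf d1 d2, ?_⟩
      rw [List.range'_succ, List.map_cons, ← a2]
      -- The steps of `next` and of the test precede the next item; they write nothing and are
      -- charged to its delay.
      have h4 := d3.append_left (r' := d)
        (w := τ₂ ++ ((Expr.get f (Expr.const 0)).ticks ++ [Event.tick]))
        (by simp [b3, yield_notMem_ticks]) (by simp [written_append, b2, written_ticks])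
        (by simp [Expr.ticks, Expr.cost]; omega)
      have h5 := Yields.cons a3 a4 h4
      simpa using h5
  obtain ⟨ρ₀, τ₀, a1, a2, a3, a4⟩ := hinit (initStore args).var
  obtain ⟨τ, τ', σ₁, σ₂, d1, d2, d3⟩ := key (N - 1) 0 (by omega) ρ₀
  rw [Nat.sub_add_cancel hN, ← List.range_eq_range'] at d3
  obtain ⟨blocks, last, h1, h2⟩ := (d3.append_left (r' := d) a3 a2 (by omega)).exists_blocks le_rfl
  exact ⟨blocks, last, σ₂, h1 ▸ Exec.seq a1 (Exec.seq d1 d2), h2⟩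

end RAM

/-! ## Mixed radix counters -/

section Odometer

/-- The digit of `t` at position `x` in the mixed radix system with the radices `r`. -/
def mixedDigit (r : ℕ → ℕ) (t x : ℕ) : ℕ := t / (∏ u ∈ Finset.range x, r u) % r x

variable {r : ℕ → ℕ}

theorem mixedDigit_lt (hr : ∀ x, 0 < r x) (t x : ℕ) : mixedDigit r t x < r x :=
  Nat.mod_lt _ (hr x)

/-- A carry reaches position `x` exactly when all lower digits are maximal. -/
theorem prod_dvd_succ_iff (hr : ∀ x, 0 < r x) (t x : ℕ) :
    (∏ u ∈ Finset.range x, r u) ∣ t + 1 ↔ ∀ u < x, ¬ mixedDigit r t u + 1 < r u := by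
  induction x with
  | zero => simp
  | succ x ih =>
    rw [Finset.prod_range_succ]
    have hP : 0 < ∏ u ∈ Finset.range x, r u := Finset.prod_pos fun u _ => hr u
    set P := ∏ u ∈ Finset.range x, r u with hPdef
    have hlt := mixedDigit_lt hr t x
    have hmain : P ∣ t + 1 → (P * r x ∣ t + 1 ↔ ¬ mixedDigit r t x + 1 < r x) := by
      intro hdvd
      have h1 : (t + 1) / P = t / P + 1 := by rw [Nat.succ_div, if_pos hdvd]
      have h2 : P * r x ∣ t + 1 ↔ r x ∣ t / P + 1 := by
        rw [← h1]
        constructor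
        · rintro ⟨c, hc⟩
          exact ⟨c, by rw [hc, mul_assoc, Nat.mul_div_cancel_left _ hP]⟩
        · rintro ⟨c, hc⟩
          exact ⟨c, by rw [mul_assoc, ← hc, Nat.mul_div_cancel' hdvd]⟩
      rw [h2]
      have h3 : mixedDigit r t x = t / P % r x := rfl
      have h4 := Nat.mod_add_div (t / P) (r x)
      rw [h3] at hlt ⊢
      have h5 : t / P + 1 = (t / P % r x + 1) + r x * (t / P / r x) := by omega
      rw [h5, Nat.dvd_add_left (Dvd.intro _ rfl)]
      constructor
      · intro h
        exact not_lt.2 (Nat.le_of_dvd (Nat.succ_pos _) h)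
      · intro h
        rw [show t / P % r x + 1 = r x by omega]
    constructor
    · intro h u hu
      have hdvd : P ∣ t + 1 := (Dvd.intro _ rfl).trans h
      rcases Nat.lt_succ_iff_lt_or_eq.1 hu with hu | rfl
      · exact ih.1 hdvd u hu
      · exact (hmain hdvd).1 h
    · intro h
      exact (hmain (ih.2 fun u hu => h u (hu.trans x.lt_succ_self))).2 (h x x.lt_succ_self)

/-- The rule by which the counter advances all digits simultaneously from the old ones, so that the
number `t` itself, which may be exponentially large, is never stored. -/
theorem mixedDigit_succ (hr : ∀ x, 0 < r x) (t x : ℕ) :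
    mixedDigit r (t + 1) x =
      if ∀ u < x, ¬ mixedDigit r t u + 1 < r u then
        if mixedDigit r t x + 1 < r x then mixedDigit r t x + 1 else 0
      else mixedDigit r t x := by
  have hlt := mixedDigit_lt hr t x
  by_cases h : ∀ u < x, ¬ mixedDigit r t u + 1 < r u
  · rw [if_pos h]
    have h1 := (prod_dvd_succ_iff hr t x).2 h
    have h2 : mixedDigit r (t + 1) x = (t / (∏ u ∈ Finset.range x, r u) + 1) % r x := by
      rw [mixedDigit, Nat.succ_div, if_pos h1]
    rw [h2, Nat.add_mod]
    change (mixedDigit r t x + 1 % r x) % r x = _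
    by_cases h3 : mixedDigit r t x + 1 < r x
    · rw [if_pos h3, Nat.mod_eq_of_lt (show 1 < r x by omega), Nat.mod_eq_of_lt h3]
    · rw [if_neg h3]
      by_cases h4 : r x = 1
      · rw [h4, Nat.mod_one]
      · rw [Nat.mod_eq_of_lt (show 1 < r x by omega), show mixedDigit r t x + 1 = r x by omega,
          Nat.mod_self]
  · rw [if_neg h]
    have h1 := (prod_dvd_succ_iff hr t x).not.2 h
    rw [mixedDigit, Nat.succ_div, if_neg h1]
    rfl

theorem exists_mixedDigit_succ_lt_iff (hr : ∀ x, 0 < r x) {t n : ℕ}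
    (ht : t < ∏ u ∈ Finset.range n, r u) :
    (∃ x < n, mixedDigit r t x + 1 < r x) ↔ t + 1 < ∏ u ∈ Finset.range n, r u := by
  rw [← not_iff_not]
  push Not
  have h := prod_dvd_succ_iff hr t n
  simp only [not_lt] at h
  rw [← h]
  constructor
  · exact Nat.le_of_dvd t.succ_pos
  · intro h'
    rw [show t + 1 = ∏ u ∈ Finset.range n, r u by omega]

/-- The first `m` digits determine the residue modulo the product of the first `m` radices, by
induction on `m`. -/
theorem eq_of_mixedDigit_eq {n t t' : ℕ} (ht : t < ∏ u ∈ Finset.range n, r u)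
    (ht' : t' < ∏ u ∈ Finset.range n, r u) (h : ∀ x < n, mixedDigit r t x = mixedDigit r t' x) :
    t = t' := by
  have key : ∀ m ≤ n, t % (∏ u ∈ Finset.range m, r u) = t' % (∏ u ∈ Finset.range m, r u) := by
    intro m
    induction m with
    | zero => simp [Nat.mod_one]
    | succ m ih =>
      intro hm
      rw [Finset.prod_range_succ, Nat.mod_mul, Nat.mod_mul, ih (by omega)]
      have := h m (by omega)
      rw [mixedDigit, mixedDigit] at this
      rw [this]
  have := key n le_rfl
  rwa [Nat.mod_eq_of_lt ht, Nat.mod_eq_of_lt ht'] at this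

theorem exists_mixedDigit_eq {n : ℕ} {c : ℕ → ℕ} (hc : ∀ x < n, c x < r x) :
    ∃ t < ∏ u ∈ Finset.range n, r u, ∀ x < n, mixedDigit r t x = c x := by
  let f : ∀ i : Fin n, Fin (r i) := fun i => ⟨c i, hc i i.2⟩
  refine ⟨finPiFinEquiv f, ?_, fun x hx => ?_⟩
  · rw [Finset.prod_range]
    exact (finPiFinEquiv f).2
  · have h1 : ((finPiFinEquiv.symm (finPiFinEquiv f) ⟨x, hx⟩ : Fin _) : ℕ) = c x := by
      rw [Equiv.symm_apply_apply]
    rw [← h1, mixedDigit, Finset.prod_range]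
    rfl

end Odometer

/-! ## The sets of edges equivalent to a given one -/

section Lifting

variable {V : Type*} (G : SimpleGraph V) (X : Set V) (N : Set (Sym2 V))

/-- The vertices with a pendant edge in `N`. -/
def activeCenters : Set V := {x | ∃ y ∈ pendantNbrs G X x, s(x, y) ∈ N}

open Classical in
/-- The number of choices for the pendant edges at `x` in a set equivalent to `N`. -/
noncomputable def pendantRadix (x : V) : ℕ :=
  if x ∈ activeCenters G X N then (pendantNbrs G X x).ncard else 1

variable {G X N} in
theorem pendantRadix_pos [Finite V] (x : V) : 0 < pendantRadix G X N x := by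
  rw [pendantRadix]
  split_ifs with h
  · obtain ⟨y, hy, -⟩ := h
    exact (Set.ncard_pos (Set.toFinite _)).2 ⟨y, hy⟩
  · exact one_pos

variable [LinearOrder V]

/-- The number of pendant neighbours of `x` preceding `u`. -/
noncomputable def pendantRank (x u : V) : ℕ := {w | w ∈ pendantNbrs G X x ∧ w < u}.ncard

/-- Replace the pendant edge in `N` at `x` by the pendant edge of rank `c x`, for all `x`. -/
def liftCut (c : V → ℕ) : Set (Sym2 V) :=
  (N \ ⋃ x ∈ X, pendantEdges G X x) ∪
    {p | ∃ x ∈ activeCenters G X N, ∃ u ∈ pendantNbrs G X x, pendantRank G X x u = c x ∧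
      p = s(x, u)}

variable {G X N} {c c' : V → ℕ}

theorem mk_mem_liftCut_of_mem_pendantNbrs (hX : G.IsVertexCover X) {x u : V}
    (hu : u ∈ pendantNbrs G X x) :
    s(x, u) ∈ liftCut G X N c ↔ x ∈ activeCenters G X N ∧ pendantRank G X x u = c x := by
  have hx : x ∈ X := (hX hu.2.1).resolve_right hu.1
  constructor
  · rintro (⟨-, h⟩ | ⟨x', hx', u', hu', hr, h⟩)
    · exact absurd ((mk_mem_iUnion_pendantEdges_iff hX).2 (Or.inl hu)) h
    · rcases Sym2.eq_iff.1 h with ⟨rfl, rfl⟩ | ⟨rfl, rfl⟩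
      · exact ⟨hx', hr⟩
      · exact absurd hx hu'.1
  · rintro ⟨h1, h2⟩
    exact Or.inr ⟨x, h1, u, hu, h2, rfl⟩

theorem mk_mem_liftCut_of_notMem (hX : G.IsVertexCover X) {x u : V}
    (hu : u ∉ pendantNbrs G X x) (hx : x ∉ pendantNbrs G X u) :
    s(x, u) ∈ liftCut G X N c ↔ s(x, u) ∈ N := by
  have hL : s(x, u) ∉ ⋃ x ∈ X, pendantEdges G X x := by
    rw [mk_mem_iUnion_pendantEdges_iff hX]
    tauto
  constructor
  · rintro (⟨h, -⟩ | ⟨x', hx', u', hu', hr, h⟩)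
    · exact h
    · rcases Sym2.eq_iff.1 h with ⟨rfl, rfl⟩ | ⟨rfl, rfl⟩
      · exact absurd hu' hu
      · exact absurd hu' hx
  · exact fun h => Or.inl ⟨h, hL⟩

variable [Finite V]

theorem exists_pendantRank_eq {x : V} (hx : x ∈ activeCenters G X N)
    (hc : c x < pendantRadix G X N x) :
    ∃ u ∈ pendantNbrs G X x, pendantRank G X x u = c x := by
  rw [pendantRadix, if_pos hx] at hc
  have : c x ∈ Set.Iio (pendantNbrs G X x).ncard := hc
  rw [← image_ncard_lt] at this
  exact this

/-- The replacement leaves one pendant edge at each active centre, because ranks are injective and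
all ranks below the radix occur. -/
theorem pendantEquiv_liftCut (hX : G.IsVertexCover X)
    (hsub : ∀ x ∈ X, (N ∩ pendantEdges G X x).Subsingleton)
    (hc : ∀ x, c x < pendantRadix G X N x) : PendantEquiv G X N (liftCut G X N c) := by
  refine ⟨?_, fun x hx => ?_⟩
  · ext p
    induction p using Sym2.ind with
    | _ u v =>
      simp only [Set.mem_sdiff]
      refine and_congr_left fun hL => ?_
      rw [mk_mem_iUnion_pendantEdges_iff hX, not_or] at hL
      exact (mk_mem_liftCut_of_notMem hX hL.1 hL.2).symm
  · refine encard_eq_of_subsingleton_of_nonempty_iff (hsub x hx) ?_ ?_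
    · rw [subsingleton_inter_pendantEdges_iff]
      intro y hy y' hy' h1 h2
      rw [mk_mem_liftCut_of_mem_pendantNbrs hX hy] at h1
      rw [mk_mem_liftCut_of_mem_pendantNbrs hX hy'] at h2
      exact injOn_ncard_lt _ hy hy' (h1.2.trans h2.2.symm)
    · rw [nonempty_inter_pendantEdges_iff, nonempty_inter_pendantEdges_iff]
      constructor
      · intro h
        obtain ⟨u, hu, hr⟩ := exists_pendantRank_eq h (hc x)
        exact ⟨u, hu, (mk_mem_liftCut_of_mem_pendantNbrs hX hu).2 ⟨h, hr⟩⟩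
      · rintro ⟨u, hu, h⟩
        exact ((mk_mem_liftCut_of_mem_pendantNbrs hX hu).1 h).1

/-- At each active centre `M` has exactly one pendant edge, and its rank is the digit; at the other
centres the radix `1` forces the digit `0`. -/
theorem exists_eq_liftCut (hX : G.IsVertexCover X)
    (hsub : ∀ x ∈ X, (N ∩ pendantEdges G X x).Subsingleton) {M : Set (Sym2 V)}
    (hM : PendantEquiv G X N M) :
    ∃ c : V → ℕ, (∀ x, c x < pendantRadix G X N x) ∧ M = liftCut G X N c := by
  have hcov : ∀ {x y}, y ∈ pendantNbrs G X x → x ∈ X :=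
    fun hy => (hX hy.2.1).resolve_right hy.1
  have hact : ∀ x, x ∈ X → (x ∈ activeCenters G X N ↔
      ∃ y ∈ pendantNbrs G X x, s(x, y) ∈ M) := by
    intro x hx
    rw [← nonempty_inter_pendantEdges_iff, ← Set.encard_ne_zero, ← hM.2 x hx, Set.encard_ne_zero,
      nonempty_inter_pendantEdges_iff]
    rfl
  have hc : ∀ x, ∃ m, m < pendantRadix G X N x ∧ (x ∈ activeCenters G X N →
      ∃ u ∈ pendantNbrs G X x, s(x, u) ∈ M ∧ pendantRank G X x u = m) := by
    intro x
    by_cases hx : x ∈ activeCenters G X N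
    · have hxX : x ∈ X := by
        obtain ⟨y, hy, -⟩ := hx
        exact hcov hy
      obtain ⟨u, hu, huM⟩ := (hact x hxX).1 hx
      refine ⟨pendantRank G X x u, ?_, fun _ => ⟨u, hu, huM, rfl⟩⟩
      rw [pendantRadix, if_pos hx]
      have : pendantRank G X x u ∈ Set.Iio (pendantNbrs G X x).ncard := by
        rw [← image_ncard_lt]
        exact ⟨u, hu, rfl⟩
      exact this
    · exact ⟨0, pendantRadix_pos x, fun h => absurd h hx⟩
  choose c hc1 hc2 using hc
  refine ⟨c, hc1, ?_⟩
  have key : ∀ x u, u ∈ pendantNbrs G X x → (s(x, u) ∈ M ↔ s(x, u) ∈ liftCut G X N c) := by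
    intro x u hu
    rw [mk_mem_liftCut_of_mem_pendantNbrs hX hu]
    constructor
    · intro h
      have hx := (hact x (hcov hu)).2 ⟨u, hu, h⟩
      refine ⟨hx, ?_⟩
      obtain ⟨u', hu', h', hr⟩ := hc2 x hx
      have h2 : (M ∩ pendantEdges G X x).Subsingleton := by
        rw [← Set.encard_le_one_iff_subsingleton, ← hM.2 x (hcov hu),
          Set.encard_le_one_iff_subsingleton]
        exact hsub x (hcov hu)
      rw [subsingleton_inter_pendantEdges_iff.1 h2 u hu u' hu' h h', hr]
    · rintro ⟨hx, hr⟩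
      obtain ⟨u', hu', h', hr'⟩ := hc2 x hx
      rwa [injOn_ncard_lt _ hu hu' (hr.trans hr'.symm)]
  ext p
  induction p using Sym2.ind with
  | _ u v =>
    by_cases hv : v ∈ pendantNbrs G X u
    · exact key u v hv
    · by_cases hu : u ∈ pendantNbrs G X v
      · rw [Sym2.eq_swap]
        exact key v u hu
      · rw [mk_mem_liftCut_of_notMem hX hv hu]
        have hL : s(u, v) ∉ ⋃ x ∈ X, pendantEdges G X x := by
          rw [mk_mem_iUnion_pendantEdges_iff hX]
          tauto
        have := Set.ext_iff.1 hM.1 s(u, v)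
        simp only [Set.mem_sdiff, hL, not_false_eq_true, and_true] at this
        exact this.symm

theorem eq_of_liftCut_eq (hX : G.IsVertexCover X) (hc : ∀ x, c x < pendantRadix G X N x)
    (hc' : ∀ x, c' x < pendantRadix G X N x) (h : liftCut G X N c = liftCut G X N c') :
    c = c' := by
  funext x
  by_cases hx : x ∈ activeCenters G X N
  · obtain ⟨u, hu, hr⟩ := exists_pendantRank_eq hx (hc x)
    have h1 := (mk_mem_liftCut_of_mem_pendantNbrs (N := N) hX hu).2 ⟨hx, hr⟩
    rw [h, mk_mem_liftCut_of_mem_pendantNbrs hX hu] at h1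
    rw [← hr, h1.2]
  · have h1 := hc x
    have h2 := hc' x
    rw [pendantRadix, if_neg hx] at h1 h2
    omega

end Lifting

/-! ## The programs -/

namespace RAM

namespace Term

/-- Conjunction. -/
def and (t u : Term) : Term := ite t u (const 0)

/-- Disjunction. -/
def or (t u : Term) : Term := ite t (const 1) u

/-- Negation. -/
def not (t : Term) : Term := ite t (const 0) (const 1)

/-- Implication. -/
def imp (t u : Term) : Term := ite t u (const 1)

/-- `t < u`. -/
def lt (t u : Term) : Term := sub u t

/-- `t ≤ u`. -/
def le (t u : Term) : Term := not (sub t u)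

/-- `t = u`. -/
def eq (t u : Term) : Term := not (add (sub t u) (sub u t))

/-- `t` is nonzero for some value of the variable `i`. -/
def ex (i : ℕ) (t : Term) : Term := sum i t

/-- `t` is nonzero for all values of the variable `i`. -/
def all (i : ℕ) (t : Term) : Term := not (sum i (not t))

/-- The number of values of the variable `i` for which `t` is nonzero. -/
def count (i : ℕ) (t : Term) : Term := sum i (ite t (const 1) (const 0))

/-- `t`, viewed as a formula, is true. -/
def Holds (A : ℕ → ℕ → ℕ) (t : Term) (ρ : ℕ → ℕ) : Prop := t.eval A ρ ≠ 0

section Holds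

variable {A : ℕ → ℕ → ℕ} {t u : Term} {ρ : ℕ → ℕ} {n : ℕ}

@[simp]
theorem holds_and : (and t u).Holds A ρ ↔ t.Holds A ρ ∧ u.Holds A ρ := by
  simp [Holds, and, eval]

@[simp]
theorem holds_or : (or t u).Holds A ρ ↔ t.Holds A ρ ∨ u.Holds A ρ := by
  simp only [Holds, or, eval]
  split_ifs with h <;> simp [h]

@[simp]
theorem holds_not : (not t).Holds A ρ ↔ ¬ t.Holds A ρ := by
  simp [Holds, not, eval]

@[simp]
theorem holds_imp : (imp t u).Holds A ρ ↔ (t.Holds A ρ → u.Holds A ρ) := by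
  simp only [Holds, imp, eval]
  split_ifs with h <;> simp [h]

@[simp]
theorem holds_lt : (lt t u).Holds A ρ ↔ t.eval A ρ < u.eval A ρ := by
  simp only [Holds, lt, eval]; omega

@[simp]
theorem holds_le : (le t u).Holds A ρ ↔ t.eval A ρ ≤ u.eval A ρ := by
  rw [le, holds_not]
  simp only [Holds, eval]; omega

@[simp]
theorem holds_eq : (eq t u).Holds A ρ ↔ t.eval A ρ = u.eval A ρ := by
  rw [eq, holds_not]
  simp only [Holds, eval]; omega

@[simp]
theorem holds_get {a : ℕ} : (get a t).Holds A ρ ↔ A a (t.eval A ρ) ≠ 0 := Iff.rfl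

@[simp]
theorem eval_ite : (ite t u v).eval A ρ =
    open Classical in if t.Holds A ρ then u.eval A ρ else v.eval A ρ := by
  simp only [eval, Holds]
  split_ifs <;> simp_all

theorem holds_ex {i : ℕ} (hn : A 0 0 = n) :
    (ex i t).Holds A ρ ↔ ∃ j : Fin n, t.Holds A (Function.update ρ i j) := by
  subst hn
  simp [ex, Holds, eval, Fin.exists_iff]

theorem holds_all {i : ℕ} (hn : A 0 0 = n) :
    (all i t).Holds A ρ ↔ ∀ j : Fin n, t.Holds A (Function.update ρ i j) := by
  have h := holds_ex (t := not t) (ρ := ρ) (i := i) hn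
  simp only [holds_not] at h
  rw [all, holds_not, show sum i (not t) = ex i (not t) from rfl, h, not_exists]
  simp

theorem eval_count {i : ℕ} (hn : A 0 0 = n) :
    (count i t).eval A ρ = {j : Fin n | t.Holds A (Function.update ρ i j)}.ncard := by
  classical
  subst hn
  rw [Set.ncard_eq_toFinset_card', Set.toFinset_ofPred, Finset.card_filter, count, eval,
    Finset.sum_range]
  refine Finset.sum_congr rfl fun j _ => ?_
  simp only [eval, Holds]
  split_ifs <;> simp_all

end Holds

/-- Variables `i` and `j` are adjacent vertices of the graph encoded in array `0`. -/
def adj (i j : ℕ) : Term := get 0 (add (const 3) (add (sum 50 (var i)) (var j)))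

/-- The degree of variable `0` is larger than the parameter. -/
def highTerm : Term := lt (get 1 (const 0)) (count 1 (adj 0 1))

/-- Variable `0` has a small degree and all its neighbours have large degree. -/
def lowTerm : Term :=
  and (not (get 10 (var 0))) (all 1 (imp (adj 0 1) (get 10 (var 1))))

/-- The degree of variable `0`. -/
def degTerm : Term := count 1 (adj 0 1)

/-- The number of common neighbours of variables `1` and `2` in array `11` that precede
variable `0`. -/
def commonTerm : Term :=
  count 3 (and (and (get 11 (var 3)) (and (adj 3 1) (adj 3 2))) (lt (var 3) (var 0)))

/-- Variable `0` is a kept vertex. -/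
def keptTerm : Term :=
  imp (get 11 (var 0)) (or
    (and (eq (get 12 (var 0)) (const 1)) (ex 1 (and (adj 0 1) (all 2 (imp (get 11 (var 2))
      (imp (eq (get 12 (var 2)) (const 1)) (imp (adj 2 1) (not (lt (var 2) (var 0))))))))))
    (and (not (eq (get 12 (var 0)) (const 1))) (ex 1 (ex 2 (and (adj 0 1) (and (adj 0 2) (or
      (and (eq (var 1) (var 2)) (le commonTerm (get 1 (const 0))))
      (and (not (eq (var 1) (var 2))) (le commonTerm (const 2))))))))))

end Term

/-- Compute the tables of the kernelization: vertices of large degree (array `10`), vertices of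
small degree with neighbours of large degree (array `11`), degrees (array `12`) and kept vertices
(array `13`). -/
def kernelTables : Cmd :=
  Cmd.seq (tab 10 Term.highTerm) (Cmd.seq (tab 11 Term.lowTerm)
    (Cmd.seq (tab 12 Term.degTerm) (tab 13 Term.keptTerm)))

/-- The arrays after `kernelTables`. -/
def kernelTablesArr (A : ℕ → ℕ → ℕ) : ℕ → ℕ → ℕ :=
  tabArr 13 Term.keptTerm (tabArr 12 Term.degTerm (tabArr 11 Term.lowTerm
    (tabArr 10 Term.highTerm A)))

/-- A bound for the running time of `kernelTables`. -/
noncomputable def kernelTablesTime : Polynomial ℕ :=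
  tabTime Term.highTerm + tabTime Term.lowTerm + tabTime Term.degTerm + tabTime Term.keptTerm

theorem tabArr_apply_of_ne {a b : ℕ} {t : Term} {A : ℕ → ℕ → ℕ} (h : b ≠ a) :
    tabArr a t A b = A b := Function.update_of_ne h _ _

theorem tabArr_apply_self {a : ℕ} {t : Term} {A : ℕ → ℕ → ℕ} {n : ℕ} (hn : A 0 0 = n) (j : Fin n) :
    tabArr a t A a j = t.eval A (env₁ j) := by
  simp [tabArr, hn]

theorem runs_kernelTables (A : ℕ → ℕ → ℕ) :
    Runs kernelTables A (kernelTablesArr A) [] (kernelTablesTime.eval (A 0 0)) := by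
  have h10 := runs_tab (a := 10) (t := Term.highTerm) (by decide) (by decide) A
  have h11 := runs_tab (a := 11) (t := Term.lowTerm) (by decide) (by decide)
    (tabArr 10 Term.highTerm A)
  have h12 := runs_tab (a := 12) (t := Term.degTerm) (by decide) (by decide)
    (tabArr 11 Term.lowTerm (tabArr 10 Term.highTerm A))
  have h13 := runs_tab (a := 13) (t := Term.keptTerm) (by decide) (by decide)
    (tabArr 12 Term.degTerm (tabArr 11 Term.lowTerm (tabArr 10 Term.highTerm A)))
  refine (h10.seq (h11.seq (h12.seq h13))).mono ?_
  simp only [tabArr_apply_of_ne (show 0 ≠ 10 by decide), tabArr_apply_of_ne (show 0 ≠ 11 by decide),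
    tabArr_apply_of_ne (show 0 ≠ 12 by decide), kernelTablesTime, Polynomial.eval_add]
  omega

/-- Array `0` encodes a graph `G` on `n` vertices. -/
structure EncodesGraph (A : ℕ → ℕ → ℕ) {n : ℕ} (G : SimpleGraph (Fin n)) : Prop where
  order : A 0 0 = n
  adj : ∀ i j : Fin n, A 0 (3 + (n * i + j)) ≠ 0 ↔ G.Adj i j

/-- Arrays `0` and `1` encode the graph `G` and the parameter `k`, and arrays `10` to `13` hold the
tables of the kernelization. -/
structure EncodesTables (A : ℕ → ℕ → ℕ) {n : ℕ} (G : SimpleGraph (Fin n)) (k : ℕ) : Prop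
    extends EncodesGraph A G where
  param : A 1 0 = k
  high : ∀ v : Fin n, A 10 v ≠ 0 ↔ v ∈ highDegree G k
  low : ∀ v : Fin n, A 11 v ≠ 0 ↔ v ∈ lowRest G k
  deg : ∀ v : Fin n, A 12 v = (G.neighborSet v).ncard
  kept : ∀ v : Fin n, A 13 v ≠ 0 ↔ v ∈ keptVertices G k

variable {A : ℕ → ℕ → ℕ} {n k : ℕ} {G : SimpleGraph (Fin n)}

/-- The matrix starts behind three header cells. The language has no multiplication, so `n * i` is
computed as a sum of `n` equal summands over the reserved variable `50`, which must not capture `i`.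
-/
theorem EncodesGraph.eval_holds_adj (h : EncodesGraph A G) {ρ : ℕ → ℕ} {i j : ℕ} (hi : i ≠ 50)
    {u v : Fin n} (hu : ρ i = u) (hv : ρ j = v) : (Term.adj i j).Holds A ρ ↔ G.Adj u v := by
  rw [← h.adj, Term.adj, Term.holds_get]
  simp [Term.eval, Function.update_of_ne hi, h.order, hu, hv]

theorem EncodesGraph.congr {B : ℕ → ℕ → ℕ} (h : EncodesGraph A G) (hB : B 0 = A 0) :
    EncodesGraph B G := ⟨by rw [hB, h.order], by rw [hB]; exact h.adj⟩

theorem EncodesGraph.encodesTables (h : EncodesGraph A G) (hk : A 1 0 = k) :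
    EncodesTables (kernelTablesArr A) G k := by
  set A₁ := tabArr 10 Term.highTerm A with hA₁
  set A₂ := tabArr 11 Term.lowTerm A₁ with hA₂
  set A₃ := tabArr 12 Term.degTerm A₂ with hA₃
  set A₄ := tabArr 13 Term.keptTerm A₃ with hA₄
  have e₁ : ∀ b ≠ 10, A₁ b = A b := fun b hb => tabArr_apply_of_ne hb
  have e₂ : ∀ b ≠ 11, A₂ b = A₁ b := fun b hb => tabArr_apply_of_ne hb
  have e₃ : ∀ b ≠ 12, A₃ b = A₂ b := fun b hb => tabArr_apply_of_ne hb
  have e₄ : ∀ b ≠ 13, A₄ b = A₃ b := fun b hb => tabArr_apply_of_ne hb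
  have h₁ : EncodesGraph A₁ G := h.congr (e₁ 0 (by decide))
  have h₂ : EncodesGraph A₂ G := h₁.congr (e₂ 0 (by decide))
  have h₃ : EncodesGraph A₃ G := h₂.congr (e₃ 0 (by decide))
  have h₄ : EncodesGraph A₄ G := h₃.congr (e₄ 0 (by decide))
  have hdegset : ∀ {B : ℕ → ℕ → ℕ}, EncodesGraph B G → ∀ v : Fin n,
      (Term.count 1 (Term.adj 0 1)).eval B (env₁ v) = (G.neighborSet v).ncard := by
    intro B hB v
    rw [Term.eval_count hB.order]
    congr 1
    ext w
    exact hB.eval_holds_adj (by decide) (by simp) (by simp)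
  have hhigh : ∀ v : Fin n, A₁ 10 v ≠ 0 ↔ v ∈ highDegree G k := by
    intro v
    rw [hA₁, tabArr_apply_self h.order]
    change Term.highTerm.Holds A _ ↔ _
    rw [Term.highTerm, Term.holds_lt, hdegset h]
    simp [Term.eval, hk, highDegree]
  have hlow : ∀ v : Fin n, A₂ 11 v ≠ 0 ↔ v ∈ lowRest G k := by
    intro v
    rw [hA₂, tabArr_apply_self h₁.order]
    change Term.lowTerm.Holds A₁ _ ↔ _
    rw [Term.lowTerm, Term.holds_and, Term.holds_all h₁.order]
    have : ∀ w : Fin n, (Term.adj 0 1).Holds A₁ (Function.update (env₁ v) 1 w) ↔ G.Adj v w :=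
      fun w => h₁.eval_holds_adj (by decide) (by simp) (by simp)
    simp only [Term.holds_not, Term.holds_get, Term.holds_imp, this, Term.eval,
      Function.update_self, env₁_zero, hhigh]
    rfl
  have hdeg : ∀ v : Fin n, A₃ 12 v = (G.neighborSet v).ncard := by
    intro v
    rw [hA₃, tabArr_apply_self h₂.order]
    exact hdegset h₂ v
  have hlow₃ : ∀ v : Fin n, A₃ 11 v ≠ 0 ↔ v ∈ lowRest G k := by
    intro v
    rw [e₃ 11 (by decide)]
    exact hlow v
  have hkept : ∀ v : Fin n, A₄ 13 v ≠ 0 ↔ v ∈ keptVertices G k := by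
    intro v
    rw [hA₄, tabArr_apply_self h₃.order]
    change Term.keptTerm.Holds A₃ _ ↔ _
    have a₀₁ : ∀ x : Fin n, (Term.adj 0 1).Holds A₃ (Function.update (env₁ v) 1 x) ↔ G.Adj v x :=
      fun x => h₃.eval_holds_adj (by decide) (by simp) (by simp)
    have b₀₁ : ∀ x y : Fin n, (Term.adj 0 1).Holds A₃
        (Function.update (Function.update (env₁ v) 1 x) 2 y) ↔ G.Adj v x :=
      fun x y => h₃.eval_holds_adj (by decide) (by simp) (by simp)
    have b₀₂ : ∀ x y : Fin n, (Term.adj 0 2).Holds A₃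
        (Function.update (Function.update (env₁ v) 1 x) 2 y) ↔ G.Adj v y :=
      fun x y => h₃.eval_holds_adj (by decide) (by simp) (by simp)
    have b₂₁ : ∀ x u : Fin n, (Term.adj 2 1).Holds A₃
        (Function.update (Function.update (env₁ v) 1 x) 2 u) ↔ G.Adj u x :=
      fun x y => h₃.eval_holds_adj (by decide) (by simp) (by simp)
    have hcommon : ∀ x y : Fin n, Term.commonTerm.eval A₃
        (Function.update (Function.update (env₁ v) 1 x) 2 y) =
        {u | (u ∈ lowRest G k ∧ G.Adj u x ∧ G.Adj u y) ∧ u < v}.ncard := by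
      intro x y
      rw [Term.commonTerm, Term.eval_count h₃.order]
      congr 1
      ext u
      have c₃₁ : (Term.adj 3 1).Holds A₃ (Function.update (Function.update (Function.update
        (env₁ v) 1 x) 2 y) 3 u) ↔ G.Adj u x := h₃.eval_holds_adj (by decide) (by simp) (by simp)
      have c₃₂ : (Term.adj 3 2).Holds A₃ (Function.update (Function.update (Function.update
        (env₁ v) 1 x) 2 y) 3 u) ↔ G.Adj u y := h₃.eval_holds_adj (by decide) (by simp) (by simp)
      simp only [Set.mem_ofPred_eq, Term.holds_and, Term.holds_get, Term.holds_lt, Term.eval,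
        Function.update_self, hlow₃, c₃₁, c₃₂]
      simp
    have hparam : A₃ 1 0 = k := by
      rw [e₃ 1 (by decide), e₂ 1 (by decide), e₁ 1 (by decide), hk]
    simp only [Term.keptTerm, Term.holds_imp, Term.holds_or, Term.holds_and, Term.holds_eq,
      Term.holds_not, Term.holds_get, Term.holds_lt, Term.holds_le, Term.holds_ex h₃.order,
      Term.holds_all h₃.order, Term.eval, hcommon, a₀₁, b₀₁, b₀₂, b₂₁, env₁_zero, hlow₃, hdeg,
      Function.update_self, hparam]
    simp [keptVertices, Fin.val_inj]
  change EncodesTables A₄ G k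
  refine ⟨h₄, ?_, ?_, ?_, ?_, hkept⟩
  · rw [e₄ 1 (by decide), e₃ 1 (by decide), e₂ 1 (by decide), e₁ 1 (by decide), hk]
  · intro v
    rw [e₄ 10 (by decide), e₃ 10 (by decide), e₂ 10 (by decide), hhigh]
  · intro v
    rw [e₄ 11 (by decide), hlow₃]
  · intro v
    rw [e₄ 12 (by decide), hdeg]

theorem kernelTablesArr_apply_of_ne {b : ℕ} (h₁ : b ≠ 10) (h₂ : b ≠ 11) (h₃ : b ≠ 12)
    (h₄ : b ≠ 13) : kernelTablesArr A b = A b := by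
  rw [kernelTablesArr, tabArr_apply_of_ne h₄, tabArr_apply_of_ne h₃, tabArr_apply_of_ne h₂,
    tabArr_apply_of_ne h₁]

end RAM

/-! ## Words encoding graphs -/

section Words

theorem encodeEdges_eq_flatMap {n : ℕ} (M : Set (Sym2 (Fin n))) :
    encodeEdges M = (List.finRange n).flatMap fun i => (List.finRange n).map fun j =>
      open Classical in if s(i, j) ∈ M then 1 else 0 := by
  rw [encodeEdges, List.ofFn_mul, List.flatMap, List.ofFn_eq_map]
  congr 2
  funext i
  rw [List.ofFn_eq_map]
  congr 1
  funext j
  have h : (i : ℕ) * n + j < n * n := by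
    have := Nat.mul_le_mul_right n (Nat.succ_le_of_lt i.2)
    rw [Nat.succ_mul] at this
    omega
  have h1 : (⟨i * n + j, h⟩ : Fin (n * n)) = finProdFinEquiv (i, j) := by
    ext
    simp [finProdFinEquiv, add_comm, mul_comm]
  have h2 : ((finProdFinEquiv (i, j)).divNat, (finProdFinEquiv (i, j)).modNat) = (i, j) :=
    finProdFinEquiv.symm_apply_apply (i, j)
  rw [Prod.mk.injEq] at h2
  rw [h1, h2.1, h2.2]

theorem encodeEdges_getD {n : ℕ} (M : Set (Sym2 (Fin n))) (i j : Fin n) :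
    (encodeEdges M).getD (n * i + j) 0 = open Classical in if s(i, j) ∈ M then 1 else 0 := by
  have h1 : n * (i : ℕ) + j = (finProdFinEquiv (i, j) : ℕ) := by
    simp [finProdFinEquiv, add_comm]
  have h2 : ((finProdFinEquiv (i, j)).divNat, (finProdFinEquiv (i, j)).modNat) = (i, j) :=
    finProdFinEquiv.symm_apply_apply (i, j)
  rw [Prod.mk.injEq] at h2
  rw [h1, encodeEdges, List.getD_eq_getElem _ _ (by rw [List.length_ofFn]; exact Fin.is_lt _),
    List.getElem_ofFn, Fin.eta, h2.1, h2.2]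

theorem flatMap_filter_of_eq_nil {α β : Type*} {p : α → Bool} {F : α → List β} (l : List α)
    (h : ∀ a ∈ l, p a = false → F a = []) : (l.filter p).flatMap F = l.flatMap F := by
  induction l with
  | nil => rfl
  | cons a l ih =>
    have ih := ih fun b hb => h b (List.mem_cons_of_mem _ hb)
    cases hp : p a
    · rw [List.filter_cons_of_neg (by simp [hp]), List.flatMap_cons, h a List.mem_cons_self hp, ih,
        List.nil_append]
    · rw [List.filter_cons_of_pos hp, List.flatMap_cons, List.flatMap_cons, ih]

theorem map_finRange_eq_filter {m n : ℕ} (e : Fin m ↪o Fin n) :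
    (List.finRange m).map e =
      (List.finRange n).filter (open Classical in fun i => decide (i ∈ Set.range e)) := by
  refine List.Perm.eq_of_pairwise' (r := (· < ·)) ?_ ?_ ?_
  · rw [List.pairwise_map]
    exact (List.pairwise_lt_finRange m).imp fun h => e.strictMono h
  · exact (List.pairwise_lt_finRange n).filter _
  · rw [List.perm_ext_iff_of_nodup]
    · intro i
      simp
    · exact (List.nodup_finRange m).map e.injective
    · exact (List.nodup_finRange n).filter _

/-- Used for rows and for columns: scanning the matrix of `G` and skipping deleted vertices writes
the matrix of the kernel, because `e` lists the retained vertices in increasing order. -/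
theorem flatMap_finRange_of_eq_nil {β : Type*} {m n : ℕ} (e : Fin m ↪o Fin n)
    {F : Fin n → List β} (h : ∀ i ∉ Set.range e, F i = []) :
    (List.finRange n).flatMap F = (List.finRange m).flatMap fun a => F (e a) := by
  rw [← flatMap_filter_of_eq_nil (List.finRange n) fun i _ hi => h i (of_decide_eq_false hi),
    ← map_finRange_eq_filter, List.flatMap_map]

theorem flatMap_range_eq {β : Type*} {n : ℕ} (F : ℕ → List β) :
    (List.range n).flatMap F = (List.finRange n).flatMap fun i : Fin n => F i := by
  rw [← List.map_coe_finRange_eq_range, List.flatMap_map]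

theorem le_bitSize_of_length {w : List ℕ} : w.length ≤ bitSize w := by
  induction w with
  | nil => simp [bitSize]
  | cons a w ih =>
    simp only [bitSize, List.map_cons, List.sum_cons, List.length_cons] at *
    omega

theorem bitSize_le {w : List ℕ} {b : ℕ} (h : ∀ a ∈ w, a ≤ b) :
    bitSize w ≤ w.length * (b + 1) := by
  induction w with
  | nil => simp [bitSize]
  | cons a w ih =>
    have h1 := ih fun a ha => h a (List.mem_cons_of_mem _ ha)
    have h2 : a.size ≤ a := Nat.size_le.2 Nat.lt_two_pow_self
    have h3 := h a List.mem_cons_self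
    simp only [bitSize, List.map_cons, List.sum_cons, List.length_cons] at *
    rw [Nat.succ_mul]
    omega

theorem length_encodeEdges {n : ℕ} (M : Set (Sym2 (Fin n))) : (encodeEdges M).length = n * n := by
  rw [encodeEdges, List.length_ofFn]

theorem le_one_of_mem_encodeEdges {n : ℕ} {M : Set (Sym2 (Fin n))} {a : ℕ}
    (h : a ∈ encodeEdges M) : a ≤ 1 := by
  rw [encodeEdges, List.mem_ofFn] at h
  obtain ⟨i, rfl⟩ := h
  split_ifs <;> simp

theorem MulticutInstance.order_le_size (x : MulticutInstance) :
    x.order ≤ EnumMatchingMulticut.size x := by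
  refine le_trans ?_ (le_bitSize_of_length (w := x.encode))
  simp only [MulticutInstance.encode, List.length_cons, length_encodeEdges]
  have := Nat.le_mul_self x.order
  omega

theorem Polynomial.eval_nat_mono (p : Polynomial ℕ) {a b : ℕ} (h : a ≤ b) :
    p.eval a ≤ p.eval b := by
  rw [Polynomial.eval_eq_sum, Polynomial.eval_eq_sum]
  exact Finset.sum_le_sum fun i _ => Nat.mul_le_mul_left _ (Nat.pow_le_pow_left h i)

end Words

/-! ## The compressor -/

section Compressor

/-- The kept vertices in increasing order. -/
noncomputable def keptEmb {n : ℕ} (G : SimpleGraph (Fin n)) (k : ℕ) :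
    Fin (keptVertices G k).ncard ↪o Fin n :=
  (Set.toFinite (keptVertices G k)).toFinset.orderEmbOfFin
    (Set.ncard_eq_toFinset_card _ (Set.toFinite _)).symm

theorem range_keptEmb {n : ℕ} (G : SimpleGraph (Fin n)) (k : ℕ) :
    Set.range (keptEmb G k) = keptVertices G k := by
  rw [keptEmb, Finset.range_orderEmbOfFin, Set.Finite.coe_toFinset]

/-- The parameter of an instance. -/
noncomputable def MulticutInstance.cover (x : MulticutInstance) : ℕ :=
  x.graph.vertexCoverNum.toNat

/-- The compressed instance. -/
noncomputable def MulticutInstance.kernel (x : MulticutInstance) : MulticutInstance where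
  order := (keptVertices x.graph x.cover).ncard
  graph := x.graph.comap (keptEmb x.graph x.cover)
  parts := min (max 0 (x.parts - {v | ∀ w, ¬ x.graph.Adj v w}.ncard))
    ((keptVertices x.graph x.cover).ncard + 1)

theorem MulticutInstance.vertexCoverNum_eq (x : MulticutInstance) :
    x.graph.vertexCoverNum = x.cover :=
  (ENat.natCast_toNat SimpleGraph.vertexCoverNum_ne_top_of_finite).symm

theorem MulticutInstance.cover_kernel (x : MulticutInstance) : x.kernel.cover = x.cover := by
  have h := vertexCoverNum_comap_keptVertices (keptEmb x.graph x.cover).injective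
    (range_keptEmb x.graph x.cover) x.vertexCoverNum_eq
  rw [MulticutInstance.cover, MulticutInstance.kernel, h]
  rfl

theorem MulticutInstance.order_kernel_le (x : MulticutInstance) :
    x.kernel.order ≤ 9 * x.cover ^ 2 :=
  ncard_keptVertices_le x.vertexCoverNum_eq

theorem MulticutInstance.bitSize_encode_kernel_le (x : MulticutInstance) :
    bitSize x.kernel.encode ≤
      (3 + (9 * x.cover ^ 2) * (9 * x.cover ^ 2)) * (9 * x.cover ^ 2 + 2) := by
  have h1 := x.order_kernel_le
  refine (bitSize_le (b := 9 * x.cover ^ 2 + 1) ?_).trans (Nat.mul_le_mul_right _ ?_)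
  · intro a ha
    have h2 : (0 : ℤ) ≤ x.kernel.parts := le_min (le_max_left _ _) (by positivity)
    have h3 : x.kernel.parts ≤ x.kernel.order + 1 := min_le_right _ _
    simp only [MulticutInstance.encode, List.mem_cons] at ha
    rcases ha with rfl | rfl | rfl | ha
    · omega
    · omega
    · omega
    · have := le_one_of_mem_encodeEdges ha
      omega
  · simp only [MulticutInstance.encode, List.length_cons, length_encodeEdges]
    have := Nat.mul_le_mul h1 h1
    omega

namespace RAM

/-- The number of kept vertices. -/
def Term.orderTerm : Term := count 0 (get 13 (var 0))

/-- The number of isolated vertices. -/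
def Term.isolatedTerm : Term := count 0 (eq (get 12 (var 0)) (const 0))

/-- The number of parts demanded in the compressed instance. -/
def Term.partsTerm : Term :=
  sub (sub (get 0 (const 1)) isolatedTerm)
    (sub (sub (get 0 (const 1)) isolatedTerm) (add orderTerm (const 1)))

/-- Variables `0` and `1` are kept vertices. -/
def Term.keptPairTerm : Term := and (get 13 (var 0)) (get 13 (var 1))

/-- The entry of the adjacency matrix at the variables `0` and `1`. -/
def Term.adjEntryTerm : Term := ite (adj 0 1) (const 1) (const 0)

/-- The compressor. -/
def compressor : Cmd :=
  Cmd.seq kernelTables (Cmd.seq (writeTerm (Term.get 1 (Term.const 0)))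
    (Cmd.seq (writeTerm Term.orderTerm) (Cmd.seq (writeTerm Term.partsTerm)
      (Cmd.seq (writeTerm (Term.const 0)) (writeMatrix Term.keptPairTerm Term.adjEntryTerm)))))

/-- A bound for the running time of the compressor. -/
noncomputable def compressorTime : Polynomial ℕ :=
  kernelTablesTime + (((Term.get 1 (Term.const 0)).time + 2) + ((Term.orderTerm.time + 2) +
    ((Term.partsTerm.time + 2) + (((Term.const 0).time + 2) +
      writeMatrixTime Term.keptPairTerm Term.adjEntryTerm))))

theorem encodesGraph_initStore (x : MulticutInstance) (args : List (List ℕ)) :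
    EncodesGraph (initStore (x.encode :: args)).arr x.graph where
  order := rfl
  adj i j := by
    have h : (initStore (x.encode :: args)).arr 0 (3 + (x.order * i + j)) =
        (encodeEdges x.graph.edgeSet).getD (x.order * i + j) 0 := by
      rw [add_comm]
      rfl
    rw [h, encodeEdges_getD, SimpleGraph.mem_edgeSet]
    split_ifs with h1 <;> simp [h1]

theorem computes_compressor (x : MulticutInstance) :
    Computes compressor [x.encode, [x.cover]] (x.kernel.cover :: x.kernel.encode)
      (compressorTime.eval x.order) := by
  set A := (initStore [x.encode, [x.cover]]).arr with hA
  have hG : EncodesGraph A x.graph := encodesGraph_initStore x _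
  have hT : EncodesTables (kernelTablesArr A) x.graph x.cover := hG.encodesTables rfl
  set B := kernelTablesArr A with hB
  have h1 := runs_kernelTables A
  rw [hG.order] at h1
  have h2 := runs_writeTerm (t := Term.get 1 (Term.const 0)) (by decide) B
  have h3 := runs_writeTerm (t := Term.orderTerm) (by decide) B
  have h4 := runs_writeTerm (t := Term.partsTerm) (by decide) B
  have h5 := runs_writeTerm (t := Term.const 0) (by decide) B
  have h6 := runs_writeMatrix (g := Term.keptPairTerm) (t := Term.adjEntryTerm) (by decide)
    (by decide) B
  have hrun := (h1.seq (h2.seq (h3.seq (h4.seq (h5.seq h6))))) (initStore [x.encode, [x.cover]]).var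
  obtain ⟨ρ, τ, hexec, hout, -, htime⟩ := hrun
  refine ⟨τ, _, hexec, ?_, htime.trans (le_of_eq ?_)⟩
  · rw [hout]
    have horder : Term.orderTerm.eval B 0 = x.kernel.order := by
      rw [Term.orderTerm, Term.eval_count hT.order]
      simp only [Term.holds_get, Term.eval, Function.update_self, hT.kept]
      rfl
    have hiso : Term.isolatedTerm.eval B 0 = {v | ∀ w, ¬ x.graph.Adj v w}.ncard := by
      rw [Term.isolatedTerm, Term.eval_count hT.order]
      simp only [Term.holds_eq, Term.eval, Function.update_self, hT.deg]
      congr 1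
      ext v
      simp only [Set.mem_ofPred_eq]
      rw [Set.ncard_eq_zero (Set.toFinite _), Set.eq_empty_iff_forall_notMem]
      rfl
    have hparts : Term.partsTerm.eval B 0 = x.kernel.parts.toNat := by
      have h0 : B 0 1 = x.parts.toNat := by
        rw [hB, kernelTablesArr_apply_of_ne (by decide) (by decide) (by decide) (by decide)]
        rfl
      have hp : x.kernel.parts = min (max 0 (x.parts - {v | ∀ w, ¬ x.graph.Adj v w}.ncard))
        (x.kernel.order + 1) := rfl
      -- With truncated subtraction, `a - (a - b)` is the minimum of `a` and `b`, and subtracting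
      -- the isolated vertices from the positive part already stops at `0`.
      simp only [Term.partsTerm, Term.eval, horder, hiso, h0]
      omega
    have hneg : (-x.kernel.parts).toNat = 0 := by
      have h2 : (0 : ℤ) ≤ x.kernel.parts := le_min (le_max_left _ _) (by positivity)
      omega
    have hkk : (Term.get 1 (Term.const 0)).eval B 0 = x.kernel.cover := by
      rw [MulticutInstance.cover_kernel]
      exact hT.param
    rw [horder, hparts, hkk, MulticutInstance.encode, hneg, encodeEdges_eq_flatMap]
    simp only [List.nil_append, List.singleton_append, List.cons.injEq, Term.eval, true_and]
    rw [hT.order, flatMap_range_eq, flatMap_finRange_of_eq_nil (keptEmb x.graph x.cover)]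
    · change (List.finRange x.kernel.order).flatMap _ = _
      congr 1
      funext a
      rw [flatMap_range_eq, flatMap_finRange_of_eq_nil (keptEmb x.graph x.cover)]
      · rw [List.map_eq_flatMap]
        change (List.finRange x.kernel.order).flatMap _ = _
        congr 1
        funext b
        have ha : keptEmb x.graph x.cover a ∈ keptVertices x.graph x.cover :=
          (range_keptEmb x.graph x.cover).subset ⟨a, rfl⟩
        have hb : keptEmb x.graph x.cover b ∈ keptVertices x.graph x.cover :=
          (range_keptEmb x.graph x.cover).subset ⟨b, rfl⟩
        have hpair : Term.keptPairTerm.Holds B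
            (env₂ (keptEmb x.graph x.cover a) (keptEmb x.graph x.cover b)) := by
          rw [Term.keptPairTerm, Term.holds_and, Term.holds_get, Term.holds_get]
          simp only [Term.eval, env₂_zero, env₂_one, hT.kept]
          exact ⟨ha, hb⟩
        have hadj := hT.eval_holds_adj (i := 0) (j := 1)
          (ρ := env₂ (keptEmb x.graph x.cover a) (keptEmb x.graph x.cover b)) (by decide)
          (env₂_zero _ _) (env₂_one _ _)
        rw [if_neg hpair, Term.adjEntryTerm, Term.eval_ite, hadj]
        rfl
      · intro i hi
        rw [range_keptEmb] at hi
        rw [if_pos]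
        by_contra hne
        have hpair : Term.keptPairTerm.Holds B (env₂ (keptEmb x.graph x.cover a) i) := hne
        rw [Term.keptPairTerm, Term.holds_and, Term.holds_get, Term.holds_get] at hpair
        simp only [Term.eval, env₂_zero, env₂_one, hT.kept] at hpair
        exact hi hpair.2
    · intro i hi
      rw [range_keptEmb] at hi
      rw [List.flatMap_eq_nil_iff]
      intro j hj
      rw [if_pos]
      by_contra hne
      have hpair : Term.keptPairTerm.Holds B (env₂ i j) := hne
      rw [Term.keptPairTerm, Term.holds_and, Term.holds_get, Term.holds_get] at hpair
      simp only [Term.eval, env₂_zero, env₂_one, hT.kept] at hpair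
      exact hi hpair.1
  · rw [hT.order]
    simp only [compressorTime, Polynomial.eval_add]

end RAM

end Compressor

/-! ## The lifting algorithm -/

section Lifter

theorem mk_mem_liftCut_iff {V : Type*} [LinearOrder V] {G : SimpleGraph V} {X : Set V}
    {N : Set (Sym2 V)} {c : V → ℕ} (hX : G.IsVertexCover X) {u v : V} :
    s(u, v) ∈ liftCut G X N c ↔
      (u ∈ pendantNbrs G X v ∧ v ∈ activeCenters G X N ∧ pendantRank G X v u = c v) ∨
      (v ∈ pendantNbrs G X u ∧ u ∈ activeCenters G X N ∧ pendantRank G X u v = c u) ∨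
      (u ∉ pendantNbrs G X v ∧ v ∉ pendantNbrs G X u ∧ s(u, v) ∈ N) := by
  by_cases hu : u ∈ pendantNbrs G X v
  · have hv : v ∉ pendantNbrs G X u := fun hv => hv.1 ((hX hu.2.1).resolve_right hu.1)
    rw [Sym2.eq_swap, mk_mem_liftCut_of_mem_pendantNbrs hX hu]
    simp [hu, hv]
  · by_cases hv : v ∈ pendantNbrs G X u
    · rw [mk_mem_liftCut_of_mem_pendantNbrs hX hv]
      simp [hu, hv]
    · rw [mk_mem_liftCut_of_notMem hX hv hu]
      simp [hu, hv]

/-- This is how the lifting program finds the name in the kernel of a vertex of `G`, in order to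
look up entries of the given solution. -/
theorem ncard_kept_lt_keptEmb {n : ℕ} (G : SimpleGraph (Fin n)) (k : ℕ)
    (a : Fin (keptVertices G k).ncard) :
    {w | w < keptEmb G k a ∧ w ∈ keptVertices G k}.ncard = a := by
  have h : {w | w < keptEmb G k a ∧ w ∈ keptVertices G k} = keptEmb G k '' Set.Iio a := by
    ext w
    constructor
    · rintro ⟨h1, h2⟩
      obtain ⟨b, rfl⟩ := (range_keptEmb G k).superset h2
      exact ⟨b, (keptEmb G k).lt_iff_lt.1 h1, rfl⟩
    · rintro ⟨b, hb, rfl⟩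
      exact ⟨(keptEmb G k).lt_iff_lt.2 hb, (range_keptEmb G k).subset ⟨b, rfl⟩⟩
  rw [h, Set.ncard_image_of_injective _ (keptEmb G k).injective, Set.ncard_eq_toFinset_card']
  simp

namespace RAM

namespace Term

/-- The number of kept vertices preceding variable `0`. -/
def rankTerm : Term := count 1 (and (lt (var 1) (var 0)) (get 13 (var 1)))

/-- Variable `i` is a pendant vertex adjacent to variable `j`. -/
def pendant (i j : ℕ) : Term :=
  and (get 11 (var i)) (and (eq (get 12 (var i)) (const 1)) (adj i j))

/-- The edge between variables `0` and `1` belongs to the given solution. -/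
def cutTerm : Term :=
  and (get 13 (var 0)) (and (get 13 (var 1))
    (get 4 (add (sum 50 (ite (get 13 (var 50)) (get 14 (var 0)) (const 0))) (get 14 (var 1)))))

/-- The given solution contains a pendant edge at variable `0`. -/
def activeTerm : Term := ex 1 (and (pendant 1 0) cutTerm)

/-- The number of choices for the pendant edges at variable `0`. -/
def radixTerm : Term := ite (get 15 (var 0)) (count 1 (pendant 1 0)) (const 1)

/-- The current digit at variable `i` is not the largest one. -/
def notLast (i : ℕ) : Term := lt (add (get 18 (var i)) (const 1)) (get 16 (var i))

/-- The next digit at variable `0`. -/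
def nextTerm : Term :=
  ite (all 1 (imp (lt (var 1) (var 0)) (not (notLast 1))))
    (ite (notLast 0) (add (get 18 (var 0)) (const 1)) (const 0)) (get 18 (var 0))

/-- Some digit is not the largest one. -/
def flagTerm : Term := ex 0 (notLast 0)

/-- Variable `i` is a pendant vertex at variable `j`, and the edge between them is chosen. -/
def chosen (i j : ℕ) : Term :=
  and (pendant i j) (and (get 15 (var j))
    (eq (count 3 (and (pendant 3 j) (lt (var 3) (var i)))) (get 18 (var j))))

/-- The entry of the matrix of the current lifted solution at the variables `0` and `1`. -/
def liftEntryTerm : Term :=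
  ite (or (chosen 0 1) (or (chosen 1 0)
    (and (not (pendant 0 1)) (and (not (pendant 1 0)) cutTerm)))) (const 1) (const 0)

end Term

/-- Compute the tables of the lifting algorithm. -/
def lifterTables : Cmd :=
  Cmd.seq kernelTables (Cmd.seq (tab 14 Term.rankTerm) (Cmd.seq (tab 15 Term.activeTerm)
    (tab 16 Term.radixTerm)))

/-- The arrays after `lifterTables`. -/
def lifterTablesArr (A : ℕ → ℕ → ℕ) : ℕ → ℕ → ℕ :=
  tabArr 16 Term.radixTerm (tabArr 15 Term.activeTerm (tabArr 14 Term.rankTerm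
    (kernelTablesArr A)))

/-- Advance the counter. -/
def lifterNext : Cmd :=
  Cmd.seq (put 20 Term.flagTerm) (Cmd.seq (tab 19 Term.nextTerm)
    (tab 18 (Term.get 19 (Term.var 0))))

/-- The arrays after `lifterNext`. -/
def lifterNextArr (A : ℕ → ℕ → ℕ) : ℕ → ℕ → ℕ :=
  tabArr 18 (Term.get 19 (Term.var 0)) (tabArr 19 Term.nextTerm
    (Function.update A 20 (Function.update (A 20) 0 (Term.flagTerm.eval A 0))))

/-- The lifting algorithm. -/
def lifter : Cmd :=
  enumerate lifterTables (writeMatrix (Term.const 1) Term.liftEntryTerm) lifterNext 20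

/-- A bound for the running time of `lifterTables`. -/
noncomputable def lifterTablesTime : Polynomial ℕ :=
  kernelTablesTime + (tabTime Term.rankTerm + (tabTime Term.activeTerm + tabTime Term.radixTerm))

/-- A bound for the running time of `lifterNext`. -/
noncomputable def lifterNextTime : Polynomial ℕ :=
  (Term.flagTerm.time + 3) + (tabTime Term.nextTerm + tabTime (Term.get 19 (Term.var 0)))

theorem runs_lifterTables (A : ℕ → ℕ → ℕ) :
    Runs lifterTables A (lifterTablesArr A) [] (lifterTablesTime.eval (A 0 0)) := by
  have h1 := runs_kernelTables A
  have h2 := runs_tab (a := 14) (t := Term.rankTerm) (by decide) (by decide) (kernelTablesArr A)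
  have h3 := runs_tab (a := 15) (t := Term.activeTerm) (by decide) (by decide)
    (tabArr 14 Term.rankTerm (kernelTablesArr A))
  have h4 := runs_tab (a := 16) (t := Term.radixTerm) (by decide) (by decide)
    (tabArr 15 Term.activeTerm (tabArr 14 Term.rankTerm (kernelTablesArr A)))
  refine (h1.seq (h2.seq (h3.seq h4))).mono (le_of_eq ?_)
  simp only [tabArr_apply_of_ne (show 0 ≠ 14 by decide), tabArr_apply_of_ne (show 0 ≠ 15 by decide),
    kernelTablesArr_apply_of_ne (show 0 ≠ 10 by decide) (show 0 ≠ 11 by decide)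
      (show 0 ≠ 12 by decide) (show 0 ≠ 13 by decide), lifterTablesTime, Polynomial.eval_add]

theorem runs_lifterNext (A : ℕ → ℕ → ℕ) :
    Runs lifterNext A (lifterNextArr A) [] (lifterNextTime.eval (A 0 0)) := by
  have h1 := runs_put (a := 20) (t := Term.flagTerm) (by decide) A
  have h2 := runs_tab (a := 19) (t := Term.nextTerm) (by decide) (by decide)
    (Function.update A 20 (Function.update (A 20) 0 (Term.flagTerm.eval A 0)))
  have h3 := runs_tab (a := 18) (t := Term.get 19 (Term.var 0)) (by decide) (by decide)
    (tabArr 19 Term.nextTerm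
      (Function.update A 20 (Function.update (A 20) 0 (Term.flagTerm.eval A 0))))
  refine (h1.seq (h2.seq h3)).mono (le_of_eq ?_)
  simp only [tabArr_apply_of_ne (show 0 ≠ 19 by decide),
    Function.update_of_ne (show 0 ≠ 20 by decide), lifterNextTime, Polynomial.eval_add]

/-- The arrays hold the tables of the lifting algorithm for the set of edges `N`. -/
structure EncodesLift (A : ℕ → ℕ → ℕ) {n : ℕ} (G : SimpleGraph (Fin n)) (k : ℕ)
    (N : Set (Sym2 (Fin n))) : Prop extends EncodesTables A G k where
  cut : ∀ u v : Fin n, Term.cutTerm.Holds A (env₂ u v) ↔ s(u, v) ∈ N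
  active : ∀ v : Fin n, A 15 v ≠ 0 ↔ v ∈ activeCenters G (lowRest G k)ᶜ N
  radix : ∀ v : Fin n, A 16 v = pendantRadix G (lowRest G k)ᶜ N v

variable {A : ℕ → ℕ → ℕ} {n k : ℕ} {G : SimpleGraph (Fin n)} {N : Set (Sym2 (Fin n))}

theorem EncodesTables.holds_pendant (h : EncodesTables A G k) {ρ : ℕ → ℕ} {i j : ℕ} (hi : i ≠ 50)
    {u v : Fin n} (hu : ρ i = u) (hv : ρ j = v) :
    (Term.pendant i j).Holds A ρ ↔ u ∈ pendantNbrs G (lowRest G k)ᶜ v := by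
  simp only [Term.pendant, Term.holds_and, Term.holds_get, Term.holds_eq, Term.eval,
    h.eval_holds_adj hi hu hv, hu, h.low, h.deg]
  rw [pendantNbrs, Set.mem_ofPred_eq, Set.mem_compl_iff, not_not, G.adj_comm u v]
  have : (G.neighborSet u).encard = 1 ↔ (G.neighborSet u).ncard = 1 := by
    rw [← (Set.toFinite _).cast_ncard_eq]
    exact_mod_cast Iff.rfl
  tauto

theorem EncodesTables.update (h : EncodesTables A G k) {a : ℕ} (ha : 14 ≤ a) (f : ℕ → ℕ) :
    EncodesTables (Function.update A a f) G k := by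
  have e : ∀ b < 14, Function.update A a f b = A b :=
    fun b hb => Function.update_of_ne (by omega) _ _
  refine ⟨h.toEncodesGraph.congr (e 0 (by decide)), ?_, ?_, ?_, ?_, ?_⟩
  · rw [e 1 (by decide), h.param]
  · rw [e 10 (by decide)]; exact h.high
  · rw [e 11 (by decide)]; exact h.low
  · rw [e 12 (by decide)]; exact h.deg
  · rw [e 13 (by decide)]; exact h.kept

/-- The inputs and tables that matter occupy arrays below `17`, so the counter, its buffer and the
flag can change freely in the arrays `18` to `20`. -/
theorem EncodesLift.update (h : EncodesLift A G k N) {a : ℕ} (ha : 17 ≤ a) (f : ℕ → ℕ) :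
    EncodesLift (Function.update A a f) G k N := by
  have e : ∀ b < 17, Function.update A a f b = A b :=
    fun b hb => Function.update_of_ne (by omega) _ _
  refine ⟨h.toEncodesTables.update (by omega) f, ?_, ?_, ?_⟩
  · intro u v
    rw [Term.Holds, Term.eval_update_of_avoids]
    · exact h.cut u v
    · simp only [Term.cutTerm, Term.and, Term.avoids, Bool.and_eq_true, bne_iff_ne]
      omega
  · rw [e 15 (by decide)]; exact h.active
  · rw [e 16 (by decide)]; exact h.radix

theorem encodesLift_lifterTablesArr (hG : EncodesGraph A G) (hk : A 1 0 = k)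
    {M : Set (Sym2 (Fin (keptVertices G k).ncard))}
    (hM : ∀ j, A 4 j = (encodeEdges M).getD j 0) :
    EncodesLift (lifterTablesArr A) G k (Sym2.map (keptEmb G k) '' M) := by
  set A₀ := kernelTablesArr A with hA₀
  set A₁ := tabArr 14 Term.rankTerm A₀ with hA₁
  set A₂ := tabArr 15 Term.activeTerm A₁ with hA₂
  set A₃ := tabArr 16 Term.radixTerm A₂ with hA₃
  have h₀ : EncodesTables A₀ G k := hG.encodesTables hk
  have h₁ : EncodesTables A₁ G k := h₀.update (by decide) _
  have h₂ : EncodesTables A₂ G k := h₁.update (by decide) _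
  have h₃ : EncodesTables A₃ G k := h₂.update (by decide) _
  have hrank : ∀ a, A₁ 14 (keptEmb G k a) = a := by
    intro a
    rw [hA₁, tabArr_apply_self h₀.order, Term.rankTerm, Term.eval_count h₀.order]
    simp only [Term.holds_and, Term.holds_get, Term.holds_lt, Term.eval, Function.update_self,
      h₀.kept]
    exact ncard_kept_lt_keptEmb G k a
  have h4 : ∀ j, A₁ 4 j = (encodeEdges M).getD j 0 := by
    intro j
    rw [hA₁, tabArr_apply_of_ne (by decide), hA₀,
      kernelTablesArr_apply_of_ne (by decide) (by decide) (by decide) (by decide), hM]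
  -- The row length of the solution matrix is the number of retained vertices; multiplying by it
  -- means adding the rank once for each retained vertex.
  have hentry : ∀ a b, (∑ w ∈ Finset.range (A₁ 0 0), if A₁ 13 w = 0 then 0 else
      A₁ 14 (keptEmb G k a)) + A₁ 14 (keptEmb G k b) = (keptVertices G k).ncard * a + b := by
    intro a b
    classical
    have hcard : (Finset.univ.filter (· ∈ keptVertices G k)).card = (keptVertices G k).ncard := by
      rw [Set.ncard_eq_toFinset_card']
      congr 1
      ext w
      simp
    rw [h₁.order, Finset.sum_range]
    simp only [hrank, ← hcard, ← smul_eq_mul, ← Finset.sum_const, Finset.sum_filter]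
    congr 1
    refine Finset.sum_congr rfl fun w _ => ?_
    rw [← ite_not]
    exact if_congr (h₁.kept w) rfl rfl
  have hcut₁ : ∀ u v : Fin n, Term.cutTerm.Holds A₁ (env₂ u v) ↔
      s(u, v) ∈ Sym2.map (keptEmb G k) '' M := by
    intro u v
    have hget : ∀ a b : Fin (keptVertices G k).ncard, A₁ 4 ((keptVertices G k).ncard * a + b) ≠ 0 ↔ s(a, b) ∈ M := by
      intro a b
      rw [h4, encodeEdges_getD M a b]
      split_ifs with hab <;> simp [hab]
    have h50 : ∀ w, Function.update (env₂ u v) 50 w 0 = u := fun w => by simp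
    simp only [Term.cutTerm, Term.holds_and, Term.holds_get, Term.eval, env₂_zero, env₂_one,
      Function.update_self, h50, h₁.kept]
    rw [mk_mem_image_map_iff]
    constructor
    · rintro ⟨hu, hv, h⟩
      obtain ⟨a, rfl⟩ := (range_keptEmb G k).superset hu
      obtain ⟨b, rfl⟩ := (range_keptEmb G k).superset hv
      rw [hentry, hget] at h
      exact ⟨a, b, rfl, rfl, h⟩
    · rintro ⟨a, b, rfl, rfl, hab⟩
      refine ⟨(range_keptEmb G k).subset ⟨a, rfl⟩, (range_keptEmb G k).subset ⟨b, rfl⟩, ?_⟩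
      rwa [hentry, hget]
  have hcut₂ : ∀ u v : Fin n, Term.cutTerm.Holds A₂ (env₂ u v) ↔
      s(u, v) ∈ Sym2.map (keptEmb G k) '' M := by
    intro u v
    rw [← hcut₁, hA₂, tabArr, Term.Holds, Term.eval_update_of_avoids (by decide)]
    rfl
  have hcut₃ : ∀ u v : Fin n, Term.cutTerm.Holds A₃ (env₂ u v) ↔
      s(u, v) ∈ Sym2.map (keptEmb G k) '' M := by
    intro u v
    rw [← hcut₂, hA₃, tabArr, Term.Holds, Term.eval_update_of_avoids (by decide)]
    rfl
  have hactive : ∀ v : Fin n, A₂ 15 v ≠ 0 ↔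
      v ∈ activeCenters G (lowRest G k)ᶜ (Sym2.map (keptEmb G k) '' M) := by
    intro v
    rw [hA₂, tabArr_apply_self h₁.order]
    change Term.activeTerm.Holds A₁ _ ↔ _
    rw [Term.activeTerm, Term.holds_ex h₁.order, activeCenters, Set.mem_ofPred_eq]
    refine exists_congr fun w => ?_
    rw [Term.holds_and, h₁.holds_pendant (u := w) (v := v) (by decide) (by simp) (by simp)]
    exact and_congr_right fun _ => hcut₁ v w
  change EncodesLift A₃ G k _
  refine ⟨h₃, hcut₃, ?_, ?_⟩
  · intro v
    rw [hA₃, tabArr_apply_of_ne (by decide), hactive]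
  · intro v
    rw [hA₃, tabArr_apply_self h₂.order, Term.radixTerm, Term.eval_ite, Term.eval_count h₂.order,
      Term.holds_get]
    have hset : {w : Fin n | (Term.pendant 1 0).Holds A₂ (Function.update (env₁ v) 1 w)} =
        pendantNbrs G (lowRest G k)ᶜ v := by
      ext w
      exact h₂.holds_pendant (u := w) (v := v) (by decide) (by simp) (by simp)
    simp only [Term.eval, env₁_zero, pendantRadix, hset]
    split_ifs <;> simp_all

/-- The radices of the counter of the lifting algorithm. -/
noncomputable def liftRadix (G : SimpleGraph (Fin n)) (k : ℕ) (N : Set (Sym2 (Fin n))) (v : ℕ) :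
    ℕ := if h : v < n then pendantRadix G (lowRest G k)ᶜ N ⟨v, h⟩ else 1

theorem liftRadix_pos (v : ℕ) : 0 < liftRadix G k N v := by
  rw [liftRadix]
  split_ifs
  · exact pendantRadix_pos _
  · exact one_pos

theorem liftRadix_apply (v : Fin n) :
    liftRadix G k N v = pendantRadix G (lowRest G k)ᶜ N v := by
  rw [liftRadix, dif_pos v.2]

theorem EncodesLift.holds_notLast (h : EncodesLift A G k N) {t : ℕ}
    (hd : ∀ v : Fin n, A 18 v = mixedDigit (liftRadix G k N) t v) {ρ : ℕ → ℕ} {i : ℕ} {v : Fin n}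
    (hv : ρ i = v) : (Term.notLast i).Holds A ρ ↔
      mixedDigit (liftRadix G k N) t v + 1 < liftRadix G k N v := by
  simp only [Term.notLast, Term.holds_lt, Term.eval, hv, hd, h.radix, liftRadix_apply]

/-- The flag is computed from the old digits and tells whether the counter can still advance. The
new digits pass through array `19`, since a table must not overwrite the array its term reads. -/
theorem EncodesLift.lifterNextArr (h : EncodesLift A G k N) {t : ℕ}
    (hd : ∀ v : Fin n, A 18 v = mixedDigit (liftRadix G k N) t v) :
    EncodesLift (lifterNextArr A) G k N ∧
      (∀ v : Fin n, lifterNextArr A 18 v = mixedDigit (liftRadix G k N) (t + 1) v) ∧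
      (lifterNextArr A 20 0 ≠ 0 ↔
        ∃ v < n, mixedDigit (liftRadix G k N) t v + 1 < liftRadix G k N v) := by
  set A₁ := Function.update A 20 (Function.update (A 20) 0 (Term.flagTerm.eval A 0)) with hA₁
  set A₂ := tabArr 19 Term.nextTerm A₁ with hA₂
  have h₁ : EncodesLift A₁ G k N := h.update (by decide) _
  have h₂ : EncodesLift A₂ G k N := h₁.update (by decide) _
  have hd₁ : ∀ v : Fin n, A₁ 18 v = mixedDigit (liftRadix G k N) t v := by
    intro v
    rw [hA₁, Function.update_of_ne (by decide), hd]
  refine ⟨h₂.update (by decide) _, ?_, ?_⟩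
  · intro v
    rw [RAM.lifterNextArr, tabArr_apply_self h₂.order]
    simp only [Term.eval, env₁_zero]
    rw [hA₂, tabArr_apply_self h₁.order, mixedDigit_succ liftRadix_pos, Term.nextTerm, Term.eval_ite,
      Term.eval_ite, Term.holds_all h₁.order, h₁.holds_notLast hd₁ (env₁_zero _)]
    have : (∀ j : Fin n, (Term.imp (Term.lt (Term.var 1) (Term.var 0))
        (Term.not (Term.notLast 1))).Holds A₁ (Function.update (env₁ v) 1 j)) ↔
        ∀ u < (v : ℕ), ¬ mixedDigit (liftRadix G k N) t u + 1 < liftRadix G k N u := by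
      have h3 : ∀ j : Fin n, (Term.notLast 1).Holds A₁ (Function.update (env₁ v) 1 j) ↔
          mixedDigit (liftRadix G k N) t j + 1 < liftRadix G k N j :=
        fun j => h₁.holds_notLast hd₁ (by simp)
      simp only [Term.holds_imp, Term.holds_not, Term.holds_lt, Term.eval, h3]
      constructor
      · intro h4 u hu
        exact h4 ⟨u, hu.trans v.2⟩ hu
      · intro h4 j hj
        exact h4 j hj
    simp only [this, Term.eval, env₁_zero, hd₁]
    split_ifs <;> rfl
  · rw [RAM.lifterNextArr, tabArr_apply_of_ne (by decide), tabArr_apply_of_ne (by decide),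
      Function.update_self, Function.update_self]
    change Term.flagTerm.Holds A 0 ↔ _
    rw [Term.flagTerm, Term.holds_ex h.order]
    constructor
    · rintro ⟨v, hv⟩
      exact ⟨v, v.2, (h.holds_notLast hd (by simp)).1 hv⟩
    · rintro ⟨v, hvn, hv⟩
      exact ⟨⟨v, hvn⟩, (h.holds_notLast (v := ⟨v, hvn⟩) hd (by simp)).2 hv⟩

theorem EncodesLift.holds_chosen (h : EncodesLift A G k N) {ρ : ℕ → ℕ} {i j : ℕ} (hi : i < 3)
    (hj : j < 3) {u v : Fin n} (hu : ρ i = u) (hv : ρ j = v) : (Term.chosen i j).Holds A ρ ↔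
      u ∈ pendantNbrs G (lowRest G k)ᶜ v ∧ v ∈ activeCenters G (lowRest G k)ᶜ N ∧
        pendantRank G (lowRest G k)ᶜ v u = A 18 v := by
  rw [Term.chosen, Term.holds_and, h.holds_pendant (by omega) hu hv, Term.holds_and,
    Term.holds_get, Term.holds_eq, Term.eval_count h.order]
  simp only [Term.eval, hv, h.active]
  have : {w : Fin n | (Term.and (Term.pendant 3 j) (Term.lt (Term.var 3) (Term.var i))).Holds A
      (Function.update ρ 3 w)} = {w | w ∈ pendantNbrs G (lowRest G k)ᶜ v ∧ w < u} := by
    ext w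
    rw [Set.mem_ofPred_eq, Term.holds_and, Term.holds_lt, h.holds_pendant (u := w) (v := v)
      (by decide) (by simp) (by rw [Function.update_of_ne (by omega), hv])]
    simp [Term.eval, Function.update_of_ne (show i ≠ 3 by omega), hu]
  rw [this, pendantRank]

theorem EncodesLift.flatMap_eq (h : EncodesLift A G k N) {c : Fin n → ℕ}
    (hc : ∀ v : Fin n, A 18 v = c v) :
    ((List.range (A 0 0)).flatMap fun i => (List.range (A 0 0)).flatMap fun j =>
      if (Term.const 1).eval A (env₂ i j) = 0 then []
      else [Term.liftEntryTerm.eval A (env₂ i j)]) =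
    encodeEdges (liftCut G (lowRest G k)ᶜ N c) := by
  rw [h.order, flatMap_range_eq, encodeEdges_eq_flatMap]
  congr 1
  funext u
  rw [flatMap_range_eq, List.map_eq_flatMap]
  congr 1
  funext v
  have h01 := h.holds_chosen (ρ := env₂ u v) (i := 0) (j := 1) (by decide) (by decide)
    (env₂_zero _ _) (env₂_one _ _)
  have h10 := h.holds_chosen (ρ := env₂ u v) (i := 1) (j := 0) (by decide) (by decide)
    (env₂_one _ _) (env₂_zero _ _)
  have p01 := h.holds_pendant (ρ := env₂ u v) (i := 0) (j := 1) (by decide)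
    (env₂_zero _ _) (env₂_one _ _)
  have p10 := h.holds_pendant (ρ := env₂ u v) (i := 1) (j := 0) (by decide)
    (env₂_one _ _) (env₂_zero _ _)
  rw [hc] at h01 h10
  have hiff : (Term.or (Term.chosen 0 1) (Term.or (Term.chosen 1 0) (Term.and
      (Term.not (Term.pendant 0 1)) (Term.and (Term.not (Term.pendant 1 0)) Term.cutTerm)))).Holds A
      (env₂ u v) ↔ s(u, v) ∈ liftCut G (lowRest G k)ᶜ N c := by
    rw [mk_mem_liftCut_iff isVertexCover_compl_lowRest]
    simp only [Term.holds_or, Term.holds_and, Term.holds_not, h01, h10, p01, p10, h.cut]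
  rw [if_neg (by simp [Term.eval]), Term.liftEntryTerm, Term.eval_ite]
  by_cases hm : s(u, v) ∈ liftCut G (lowRest G k)ᶜ N c
  · rw [if_pos (hiff.2 hm), if_pos hm, Term.eval]
  · rw [if_neg (mt hiff.1 hm), if_neg hm, Term.eval]

/-- A bound for the delay of the lifting algorithm. -/
noncomputable def lifterTime : Polynomial ℕ :=
  lifterTablesTime + writeMatrixTime (Term.const 1) Term.liftEntryTerm + lifterNextTime + 3

theorem enumeratesWithDelay_lifter (x : MulticutInstance)
    (M : Set (Sym2 (Fin x.kernel.order))) :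
    EnumeratesWithDelay lifter
      [x.encode, [x.cover], x.kernel.encode, [x.kernel.cover], encodeEdges M]
      ((List.range (∏ u ∈ Finset.range x.order, liftRadix x.graph x.cover
          (Sym2.map (keptEmb x.graph x.cover) '' M) u)).map fun t =>
        encodeEdges (liftCut x.graph (lowRest x.graph x.cover)ᶜ
          (Sym2.map (keptEmb x.graph x.cover) '' M) fun v =>
            mixedDigit (liftRadix x.graph x.cover (Sym2.map (keptEmb x.graph x.cover) '' M)) t v))
      (lifterTime.eval x.order) := by
  set args := [x.encode, [x.cover], x.kernel.encode, [x.kernel.cover], encodeEdges M] with hargs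
  set N := Sym2.map (keptEmb x.graph x.cover) '' M with hN
  set A := (initStore args).arr with hA
  have hG : EncodesGraph A x.graph := encodesGraph_initStore x _
  -- Array `18` is initially zero, and so holds the digits of `0` without any initialization.
  let state : ℕ → ℕ → ℕ → ℕ := fun t => lifterNextArr^[t] (lifterTablesArr A)
  have hsucc : ∀ t, state (t + 1) = lifterNextArr (state t) :=
    fun t => Function.iterate_succ_apply' _ _ _
  have hstate : ∀ t, EncodesLift (state t) x.graph x.cover N ∧
      ∀ v : Fin x.order, state t 18 v = mixedDigit (liftRadix x.graph x.cover N) t v := by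
    intro t
    induction t with
    | zero =>
      refine ⟨encodesLift_lifterTablesArr hG rfl fun _ => rfl, fun v => ?_⟩
      have h0 : mixedDigit (liftRadix x.graph x.cover N) 0 v = 0 := by simp [mixedDigit]
      rw [h0]
      change lifterTablesArr A 18 v = 0
      rw [lifterTablesArr, tabArr_apply_of_ne (by decide), tabArr_apply_of_ne (by decide),
        tabArr_apply_of_ne (by decide),
        kernelTablesArr_apply_of_ne (by decide) (by decide) (by decide) (by decide)]
      rfl
    | succ t ih =>
      rw [hsucc]
      have := ih.1.lifterNextArr ih.2
      exact ⟨this.1, this.2.1⟩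
  have horder : ∀ t, state t 0 0 = x.order := fun t => (hstate t).1.order
  refine enumeratesWithDelay_enumerate (state := state)
    (t₀ := lifterTablesTime.eval x.order)
    (t₁ := (writeMatrixTime (Term.const 1) Term.liftEntryTerm).eval x.order)
    (t₂ := lifterNextTime.eval x.order) ?_ ?_ ?_ ?_ ?_ ?_
  · have := runs_lifterTables A
    rwa [hG.order] at this
  · intro t _
    have := runs_writeMatrix (g := Term.const 1) (t := Term.liftEntryTerm) (by decide) (by decide)
      (state t)
    rwa [(hstate t).1.flatMap_eq (hstate t).2, horder] at this
  · intro t _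
    have := runs_lifterNext (state t)
    rwa [horder, ← hsucc] at this
  · intro t ht
    rw [hsucc, ((hstate t).1.lifterNextArr (hstate t).2).2.2,
      exists_mixedDigit_succ_lt_iff liftRadix_pos ht]
  · exact Finset.prod_pos fun u _ => liftRadix_pos u
  · simp [lifterTime]

end RAM

end Lifter

/-! ## The lifted sets -/

section Lifted

variable {n k : ℕ} {G : SimpleGraph (Fin n)}

theorem mem_keptVertices_of_mk_mem_image {M : Set (Sym2 (Fin (keptVertices G k).ncard))}
    {u v : Fin n} (h : s(u, v) ∈ Sym2.map (keptEmb G k) '' M) : v ∈ keptVertices G k := by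
  obtain ⟨a, b, -, rfl, -⟩ := mk_mem_image_map_iff.1 h
  exact (range_keptEmb G k).subset ⟨b, rfl⟩

theorem subsingleton_image_inter_pendantEdges (M : Set (Sym2 (Fin (keptVertices G k).ncard)))
    (x : Fin n) :
    (Sym2.map (keptEmb G k) '' M ∩ pendantEdges G (lowRest G k)ᶜ x).Subsingleton := by
  rw [subsingleton_inter_pendantEdges_iff]
  intro u hu v hv h1 h2
  exact eq_of_mem_pendantNbrs_of_mem_keptVertices hu hv (mem_keptVertices_of_mk_mem_image h1)
    (mem_keptVertices_of_mk_mem_image h2)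

/-- Each centre has only one retained pendant neighbour, so within the kernel equal counts of
pendant edges mean equal edges. This makes the lifts of different solutions disjoint. -/
theorem image_subset_of_pendantEquiv {M N : Set (Sym2 (Fin (keptVertices G k).ncard))}
    (h : PendantEquiv G (lowRest G k)ᶜ (Sym2.map (keptEmb G k) '' M)
      (Sym2.map (keptEmb G k) '' N)) :
    Sym2.map (keptEmb G k) '' M ⊆ Sym2.map (keptEmb G k) '' N := by
  intro p hp
  by_cases hL : p ∈ ⋃ x ∈ (lowRest G k)ᶜ, pendantEdges G (lowRest G k)ᶜ x
  · simp only [Set.mem_iUnion] at hL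
    obtain ⟨x, hx, u, hu, rfl⟩ := hL
    have h1 : (Sym2.map (keptEmb G k) '' M ∩ pendantEdges G (lowRest G k)ᶜ x).Nonempty :=
      ⟨_, hp, u, hu, rfl⟩
    rw [← Set.encard_ne_zero, h.2 x hx, Set.encard_ne_zero, nonempty_inter_pendantEdges_iff] at h1
    obtain ⟨v, hv, hvN⟩ := h1
    rwa [eq_of_mem_pendantNbrs_of_mem_keptVertices hu hv (mem_keptVertices_of_mk_mem_image hp)
      (mem_keptVertices_of_mk_mem_image hvN)]
  · exact (h.1.subset ⟨hp, hL⟩).1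

theorem eq_of_pendantEquiv_image {M M' : Set (Sym2 (Fin (keptVertices G k).ncard))}
    {N : Set (Sym2 (Fin n))}
    (h : PendantEquiv G (lowRest G k)ᶜ (Sym2.map (keptEmb G k) '' M) N)
    (h' : PendantEquiv G (lowRest G k)ᶜ (Sym2.map (keptEmb G k) '' M') N) : M = M' := by
  refine Set.image_injective.2 (Sym2.map.injective (keptEmb G k).injective) ?_
  exact (image_subset_of_pendantEquiv ⟨h.1.trans h'.1.symm, fun x hx =>
    (h.2 x hx).trans (h'.2 x hx).symm⟩).antisymm (image_subset_of_pendantEquiv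
    ⟨h'.1.trans h.1.symm, fun x hx => (h'.2 x hx).trans (h.2 x hx).symm⟩)

theorem subset_edgeSet_of_mem_matchingMulticuts {V : Type*} {G : SimpleGraph V} {l : ℤ}
    {M : Set (Sym2 V)} (h : M ∈ matchingMulticuts G l) : M ⊆ G.edgeSet := by
  obtain ⟨P, -, -, rfl⟩ := h
  exact fun p hp => hp.1

theorem subset_edgeSet_of_pendantEquiv {V : Type*} {G : SimpleGraph V} {X : Set V}
    {M N : Set (Sym2 V)} (h : PendantEquiv G X N M) (hN : N ⊆ G.edgeSet) : M ⊆ G.edgeSet := by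
  intro p hp
  by_cases hL : p ∈ ⋃ x ∈ X, pendantEdges G X x
  · simp only [Set.mem_iUnion] at hL
    obtain ⟨x, -, u, hu, rfl⟩ := hL
    exact hu.2.1
  · exact hN (h.1.superset ⟨hp, hL⟩).1

theorem image_subset_edgeSet {M : Set (Sym2 (Fin (keptVertices G k).ncard))}
    (hM : M ⊆ (G.comap (keptEmb G k)).edgeSet) : Sym2.map (keptEmb G k) '' M ⊆ G.edgeSet := by
  rintro _ ⟨p, hp, rfl⟩
  induction p using Sym2.ind with
  | _ a b => exact hM hp

/-- The words listed by the lifting algorithm. -/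
noncomputable def liftedWords (x : MulticutInstance) (s : List ℕ) : Set (List ℕ) :=
  {w | ∃ M : Set (Sym2 (Fin x.kernel.order)), encodeEdges M = s ∧ ∃ N,
    PendantEquiv x.graph (lowRest x.graph x.cover)ᶜ (Sym2.map (keptEmb x.graph x.cover) '' M) N ∧
    encodeEdges N = w}

theorem mem_matchingMulticuts_iff_kernel (x : MulticutInstance) {N : Set (Sym2 (Fin x.order))}
    (hN : N ⊆ x.graph.edgeSet) : N ∈ matchingMulticuts x.graph x.parts ↔
      ∃ M ∈ matchingMulticuts x.kernel.graph x.kernel.parts,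
        PendantEquiv x.graph (lowRest x.graph x.cover)ᶜ
          (Sym2.map (keptEmb x.graph x.cover) '' M) N := by
  have h := isMarkedEmbedding_keptVertices (keptEmb x.graph x.cover).injective
    (range_keptEmb x.graph x.cover)
  have hiso : {v | v ∉ Set.range (keptEmb x.graph x.cover) ∧ ∀ w, ¬ x.graph.Adj v w} =
      {v | ∀ w, ¬ x.graph.Adj v w} := by
    ext v
    refine ⟨fun hv => hv.2, fun hv => ⟨fun hr => ?_, hv⟩⟩
    exact not_adj_of_mem_keptVertices_compl hv ((range_keptEmb x.graph x.cover).subset hr)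
  have hclamp := matchingMulticuts_clamp (G := x.kernel.graph)
    (x.parts - {v | ∀ w, ¬ x.graph.Adj v w}.ncard)
  rw [Nat.card_fin] at hclamp
  rw [h.mem_matchingMulticuts_iff hN, hiso]
  change (∃ M ∈ matchingMulticuts x.kernel.graph _, _) ↔ _
  rw [← hclamp]
  rfl

theorem iUnion_liftedWords (x : MulticutInstance) :
    ⋃ s ∈ EnumMatchingMulticut.Sol x.kernel, liftedWords x s = EnumMatchingMulticut.Sol x := by
  ext w
  simp only [Set.mem_iUnion]
  constructor
  · rintro ⟨_, ⟨M, hM, rfl⟩, M', h1, N, hN, rfl⟩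
    obtain rfl := encodeEdges_injective h1
    refine ⟨N, (mem_matchingMulticuts_iff_kernel x ?_).2 ⟨M', hM, hN⟩, rfl⟩
    exact subset_edgeSet_of_pendantEquiv hN
      (image_subset_edgeSet (subset_edgeSet_of_mem_matchingMulticuts hM))
  · rintro ⟨N, hN, rfl⟩
    obtain ⟨M, hM, h⟩ := (mem_matchingMulticuts_iff_kernel x
      (subset_edgeSet_of_mem_matchingMulticuts hN)).1 hN
    exact ⟨encodeEdges M, ⟨M, hM, rfl⟩, M, rfl, N, h, rfl⟩

theorem disjoint_liftedWords (x : MulticutInstance) {s s' : List ℕ} (h : s ≠ s') :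
    Disjoint (liftedWords x s) (liftedWords x s') := by
  rw [Set.disjoint_left]
  rintro _ ⟨M, rfl, N, hN, rfl⟩ ⟨M', rfl, N', hN', h'⟩
  obtain rfl := encodeEdges_injective h'
  exact h (congrArg _ (eq_of_pendantEquiv_image hN hN'))

/-- The image of `M` in `G` is equivalent to itself. -/
theorem nonempty_liftedWords (x : MulticutInstance) (M : Set (Sym2 (Fin x.kernel.order))) :
    (liftedWords x (encodeEdges M)).Nonempty :=
  ⟨_, M, rfl, _, ⟨rfl, fun _ _ => rfl⟩, rfl⟩

end Lifted

/-! ### Assembling the kernel and the theorem -/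

namespace RAM

theorem Computes.mono {c : Cmd} {args : List (List ℕ)} {out : List ℕ} {t t' : ℕ}
    (h : Computes c args out t) (ht : t ≤ t') : Computes c args out t' := by
  obtain ⟨τ, σ, h1, h2, h3⟩ := h
  exact ⟨τ, σ, h1, h2, h3.trans ht⟩

theorem EnumeratesWithDelay.mono {c : Cmd} {args items : List (List ℕ)} {d d' : ℕ}
    (h : EnumeratesWithDelay c args items d) (hd : d ≤ d') :
    EnumeratesWithDelay c args items d' := by
  obtain ⟨blocks, last, σ, h1, h2, h3, h4, h5⟩ := h
  exact ⟨blocks, last, σ, h1, fun b hb => ⟨(h2 b hb).1, (h2 b hb).2.trans hd⟩, h3, h4.trans hd, h5⟩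

theorem exists_enumeratesWithDelay_lifter (x : MulticutInstance)
    (M : Set (Sym2 (Fin x.kernel.order))) :
    ∃ items : List (List ℕ), EnumeratesWithDelay lifter
      [x.encode, [x.cover], x.kernel.encode, [x.kernel.cover], encodeEdges M] items
      (lifterTime.eval x.order) ∧ items.Nodup ∧
      {w | w ∈ items} = liftedWords x (encodeEdges M) := by
  refine ⟨_, enumeratesWithDelay_lifter x M, ?_, ?_⟩
  all_goals
    set X : Set (Fin x.order) := (lowRest x.graph x.cover)ᶜ with hX
    set N := Sym2.map (keptEmb x.graph x.cover) '' M with hN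
    have hcover : x.graph.IsVertexCover X := isVertexCover_compl_lowRest
    have hlt : ∀ t (v : Fin x.order), mixedDigit (liftRadix x.graph x.cover N) t v <
        pendantRadix x.graph X N v := by
      intro t v
      rw [hX, ← liftRadix_apply]
      exact mixedDigit_lt liftRadix_pos t v
  · refine List.Nodup.map_on ?_ List.nodup_range
    intro t ht t' ht' h
    have h1 := eq_of_liftCut_eq hcover (hlt t) (hlt t') (encodeEdges_injective h)
    exact eq_of_mixedDigit_eq (List.mem_range.1 ht) (List.mem_range.1 ht')
      fun v hv => congrFun h1 ⟨v, hv⟩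
  · ext w
    simp only [Set.mem_ofPred_eq, List.mem_map, List.mem_range]
    constructor
    · rintro ⟨t, -, rfl⟩
      exact ⟨M, rfl, _, pendantEquiv_liftCut hcover
        (fun v _ => subsingleton_image_inter_pendantEdges M v) (hlt t), rfl⟩
    · rintro ⟨M', h1, N', hN', rfl⟩
      obtain rfl := encodeEdges_injective h1
      obtain ⟨c, hc, rfl⟩ := exists_eq_liftCut hcover
        (fun v _ => subsingleton_image_inter_pendantEdges M' v) hN'
      -- The digits `c` of the given equivalent set are those of some counter value; the value `0`
      -- beyond the order is never consulted.
      obtain ⟨t, ht, h⟩ := exists_mixedDigit_eq (n := x.order)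
        (r := liftRadix x.graph x.cover N) (c := fun v => if h : v < x.order then c ⟨v, h⟩ else 0)
        (fun v hv => by rw [dif_pos hv, liftRadix, dif_pos hv]; exact hc _)
      refine ⟨t, ht, ?_⟩
      congr 2
      funext v
      rw [h v v.2, dif_pos v.2]

end RAM

theorem computable_kernelBound : Computable fun k : ℕ =>
    (3 + (9 * k ^ 2) * (9 * k ^ 2)) * (9 * k ^ 2 + 2) + k := by
  have h2 : Primrec fun k : ℕ => 9 * k ^ 2 := by
    simp only [sq]
    exact Primrec.nat_mul.comp (Primrec.const 9) (Primrec.nat_mul.comp Primrec.id Primrec.id)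
  exact (Primrec.nat_add.comp (Primrec.nat_mul.comp
    (Primrec.nat_add.comp (Primrec.const 3) (Primrec.nat_mul.comp h2 h2))
    (Primrec.nat_add.comp h2 (Primrec.const 2))) Primrec.id).to_comp

theorem isPDEKernel_kernel :
    IsPDEKernel EnumMatchingMulticut RAM.compressor RAM.lifter MulticutInstance.kernel where
  compress := by
    refine ⟨RAM.compressorTime, fun x : MulticutInstance => ?_⟩
    exact (RAM.computes_compressor x).mono (Polynomial.eval_nat_mono _
      (x.order_le_size.trans (Nat.le_add_right _ _)))
  bounded := by
    refine ⟨_, computable_kernelBound, fun x : MulticutInstance => ⟨?_, ?_⟩⟩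
    · exact x.bitSize_encode_kernel_le.trans (Nat.le_add_right _ _)
    · exact x.cover_kernel.le.trans (Nat.le_add_left _ _)
  lift := by
    refine ⟨liftedWords, ⟨RAM.lifterTime, ?_⟩, fun x : MulticutInstance => ⟨?_, ?_, ?_⟩⟩
    · rintro (x : MulticutInstance) _ ⟨M, -, rfl⟩
      obtain ⟨items, h1, h2, h3⟩ := RAM.exists_enumeratesWithDelay_lifter x M
      refine ⟨items, h1.mono (Polynomial.eval_nat_mono _ (x.order_le_size.trans ?_)), h2, h3⟩
      omega
    · rintro _ ⟨M, -, rfl⟩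
      exact nonempty_liftedWords x M
    · exact fun s _ s' _ h => disjoint_liftedWords x h
    · exact iUnion_liftedWords x

theorem mainTheorem5 :
    (∃ (A A' : RAM.Cmd) (comp : MulticutInstance → MulticutInstance),
      IsPDEKernel EnumMatchingMulticut A A' comp ∧
      ∃ C : ℕ, ∀ x : MulticutInstance,
        (comp x).order ≤ C * EnumMatchingMulticut.param x ^ 2) ∧
    (∀ (V : Type*) [Finite V] (G : SimpleGraph V) (X Z : Set V),
      (∀ v, ∃ w, G.Adj v w) → G.IsVertexCover X → IsMarking G X Z →
      (X ∪ Z).ncard ≤ 2 * X.ncard + 3 * X.ncard.choose 2 ∧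
      ∀ (l : ℤ) (M : Set (Sym2 V)), M ⊆ G.edgeSet →
        (M ∈ matchingMulticuts G l ↔
          ∃ M' ∈ matchingMulticuts (G.induce (X ∪ Z)) l,
            PendantEquiv G X (Sym2.map Subtype.val '' M') M)) := by
  refine ⟨⟨RAM.compressor, RAM.lifter, MulticutInstance.kernel, isPDEKernel_kernel, 9,
    MulticutInstance.order_kernel_le⟩, ?_⟩
  intro V _ G X Z hiso hX hZ
  refine ⟨hZ.ncard_le, fun l M hM => ?_⟩
  -- There are no isolated vertices to delete, hence the number of parts is not shifted.
  have h0 : {v | v ∉ Set.range (Subtype.val : ↥(X ∪ Z) → V) ∧ ∀ w, ¬ G.Adj v w} = ∅ := by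
    refine Set.eq_empty_of_forall_notMem fun v hv => ?_
    obtain ⟨w, hw⟩ := hiso v
    exact hv.2 w hw
  rw [(hZ.isMarkedEmbedding hiso hX).mem_matchingMulticuts_iff hM, h0, Set.ncard_empty,
    Nat.cast_zero, sub_zero]
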